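/- **Setting.** Let $d\in\{2,3\}$, let $\Omega\subset\mathbb R^d$ be a bounded polyhedral domain with a conforming partition $\mathcal T_h$ into finitely many $d$-simplices, and let the boundary facets be divided into those forming $\Gamma_c$ and those forming $\Gamma_t$, both nonempty. Call $\mathcal T_h$ $\sigma$-shape-regular if every element $T$ contains a ball of radius $\operatorname{diam}(T)/\sigma$. Let $\boldsymbol V_{h,1}$ be the continuous piecewise linear vector fields vanishing on $\overline\Gamma_c$, $\boldsymbol V_b$ the span of the facet bubbles $\big(\prod_{z\in F}\lambda_z\big)\boldsymbol n_F$ over the facets $F\not\subset\overline{\Gamma}_c$ ($\lambda_z$ barycentric coordinates, $\boldsymbol n_F$ a unit normal), $\boldsymbol V_h=\boldsymbol V_b\oplus\boldsymbol V_{h,1}$, $Q_h$ the piecewise constants, and $\boldsymbol W_h$ the lowest order Raviart–Thomas–Nédélec space with zero normal component on $\Gamma_c$; put $\boldsymbol X_h=\boldsymbol V_h\times Q_h\times\boldsymbol W_h$ and $\boldsymbol X_h^E=\boldsymbol V_{h,1}\times Q_h\times\boldsymbol W_h$, identified with their coefficient vectors in the bubble basis above, the nodal basis of $\boldsymbol V_{h,1}$,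 the element indicators and the facet basis of $\boldsymbol W_h$. The parameters are $\lambda\ge 0$ and $\mu,\alpha,M,\mu_f,\tau>0$, and $\boldsymbol K$ is a measurable, symmetric, bounded, uniformly positive definite tensor field. Let $A_{bb},A_{bl},A_{ll}$ be the blocks of the matrix $A_{\boldsymbol u}=\begin{pmatrix}A_{bb}&A_{bl}\\A_{bl}^T&A_{ll}\end{pmatrix}$ of $a(\boldsymbol u,\boldsymbol v)=2\mu\int_\Omega\varepsilon(\boldsymbol u):\varepsilon(\boldsymbol v)+\lambda\int_\Omega\operatorname{div}\boldsymbol u\operatorname{div}\boldsymbol v$, where $\varepsilon(\boldsymbol u)=\frac12(\nabla\boldsymbol u+\nabla\boldsymbol u^T)$; let $B_b,B_l,B_{\boldsymbol w}$ be the matrices of $-(\operatorname{div}\cdot,q)$ on $\boldsymbol V_b,\boldsymbol V_{h,1},\boldsymbol W_h$ (with $q\in Q_h$), $M_p$ that of $(p,q)$, and $M_{\boldsymbol w}$ that of $(\boldsymbol K^{-1}\mu_f\boldsymbol w,\boldsymbol r)$. Put $D_{bb}=(d+1)\operatorname{diag}(A_{bb})$, $A_{\boldsymbol w}=B_{\boldsymbol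 w}^TM_p^{-1}B_{\boldsymbol w}$, $\zeta=\sqrt{\lambda+2\mu/d}$, $c_p=\left(\frac{\alpha^2}{\zeta^2}+\frac1M\right)^{-1}$. The full system is $$\mathcal A=\begin{pmatrix}A_{bb}&A_{bl}&\alpha B_b^T&0\\A_{bl}^T&A_{ll}&\alpha B_l^T&0\\-\alpha B_b&-\alpha B_l&\frac1MM_p&-\tau B_{\boldsymbol w}\\0&0&\tau B_{\boldsymbol w}^T&\tau M_{\boldsymbol w}\end{pmatrix},$$ $\mathcal A^D$ is $\mathcal A$ with $A_{bb}$ replaced by $D_{bb}$, and the bubble-eliminated system is $$\mathcal A^E=\begin{pmatrix}A_{ll}-A_{bl}^TD_{bb}^{-1}A_{bl}&\alpha B_l^T-\alpha A_{bl}^TD_{bb}^{-1}B_b^T&0\\-\alpha B_l+\alpha B_bD_{bb}^{-1}A_{bl}&\frac1MM_p+\alpha^2B_bD_{bb}^{-1}B_b^T&-\tau B_{\boldsymbol w}\\0&\tau B_{\boldsymbol w}^T&\tau M_{\boldsymbol w}\end{pmatrix}.$$ For a matrix $H$ write $\|\boldsymbol v\|_H=(H\boldsymbol v,\boldsymbol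 v)^{1/2}$. On $\boldsymbol X_h$ let $|||(\boldsymbol u,p,\boldsymbol w)|||^2=\|\boldsymbol u\|_{A_{\boldsymbol u}}^2+c_p^{-1}\|p\|_{M_p}^2+\tau\|\boldsymbol w\|_{M_{\boldsymbol w}}^2+\tau^2c_p\|B_{\boldsymbol w}\boldsymbol w\|_{M_p^{-1}}^2$ and $$\mathcal D=\operatorname{diag}\left(\begin{pmatrix}D_{bb}&A_{bl}\\A_{bl}^T&A_{ll}\end{pmatrix},\ c_p^{-1}M_p,\ \tau M_{\boldsymbol w}+\tau^2c_pA_{\boldsymbol w}\right),$$ and on $\boldsymbol X_h^E$ let $$\mathcal D^E=\operatorname{diag}\left(A_{ll}-A_{bl}^TD_{bb}^{-1}A_{bl},\ \alpha^2B_bD_{bb}^{-1}B_b^T+c_p^{-1}M_p,\ \tau M_{\boldsymbol w}+\tau^2c_pA_{\boldsymbol w}\right).$$ Say that the full system is *well-posed with constants $\varsigma,\gamma>0$* if $$\sup_{\boldsymbol 0\ne\boldsymbol x\in\boldsymbol X_h}\ \sup_{\boldsymbol 0\ne\boldsymbol y\in\boldsymbol X_h}\frac{(\mathcal A\boldsymbol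 x,\boldsymbol y)}{|||\boldsymbol x|||\,|||\boldsymbol y|||}\le\varsigma,\qquad\inf_{\boldsymbol 0\ne\boldsymbol y\in\boldsymbol X_h}\ \sup_{\boldsymbol 0\ne\boldsymbol x\in\boldsymbol X_h}\frac{(\mathcal A\boldsymbol x,\boldsymbol y)}{|||\boldsymbol x|||\,|||\boldsymbol y|||}\ge\gamma .$$ Consider the inequalities $$\text{(D)}\ \inf_{\boldsymbol 0\ne\boldsymbol y\in\boldsymbol X_h}\sup_{\boldsymbol 0\ne\boldsymbol x\in\boldsymbol X_h}\frac{(\mathcal A^D\boldsymbol x,\boldsymbol y)}{\|\boldsymbol x\|_{\mathcal D}\|\boldsymbol y\|_{\mathcal D}}\ge\tilde\gamma,\qquad\text{(E)}\ \inf_{\boldsymbol 0\ne\boldsymbol x^E\in\boldsymbol X_h^E}\sup_{\boldsymbol 0\ne\boldsymbol y^E\in\boldsymbol X_h^E}\frac{(\mathcal A^E\boldsymbol x^E,\boldsymbol y^E)}{\|\boldsymbol x^E\|_{\mathcal D^E}\|\boldsymbol y^E\|_{\mathcal D^E}}\ge\gamma^*,$$ $$\text{(C)}\ \sup_{\boldsymbol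 0\ne\boldsymbol x^E\in\boldsymbol X_h^E}\ \sup_{\boldsymbol 0\ne\boldsymbol y^E\in\boldsymbol X_h^E}\frac{(\mathcal A^E\boldsymbol x^E,\boldsymbol y^E)}{\|\boldsymbol x^E\|_{\mathcal D^E}\|\boldsymbol y^E\|_{\mathcal D^E}}\le\varsigma .$$ **Theorem.** Let $d\in\{2,3\}$ and $\gamma>0$. 1. For every $\sigma>0$ there is $\tilde\gamma>0$, depending only on $d,\gamma,\sigma$, such that for every $\sigma$-shape-regular partition, every $\boldsymbol K$ and every $\varsigma>0$: if the full system is well-posed with the constants $\varsigma,\gamma$ for all values of the parameters $\lambda,\mu,\alpha,M,\mu_f,\tau$, then, for all values of these parameters, (D) holds with $\tilde\gamma$, (E) holds with $\gamma^*=\tilde\gamma/16$, and (C) holds with $\varsigma$. 2. For every single partition, every $\boldsymbol K$, every single choice of the parameters and every $\varsigma>0$: if the full system is well-posed with constants $\varsigma,\gamma$, then (D) holds for some $\tilde\gamma>0$; whenever (D) holds with some $\tilde\gamma>0$, (E) holds with $\gamma^*=\tilde\gamma/16$; and (C) holds with $\varsigma$. In particular the bubble-eliminated system is well-posed with respect to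 $\|\cdot\|_{\mathcal D^E}$, robustly in the mesh size, the time step and the physical parameters. -/

import Mathlib

open MeasureTheory

noncomputable section

namespace BiotFE

/-- The Euclidean space in which the domain lies. -/
abbrev E (d : ℕ) : Type := EuclideanSpace ℝ (Fin d)

/-! ### Simplicial partitions -/

/-- A conforming partition of a bounded polyhedral domain `Ω ⊂ ℝ^d` into finitely many
`d`-simplices. The simplices, with all their faces, form a geometric simplicial complex, a face
being given by the finite set of its vertices; `Ω` is the interior of `complex.space`.
The boundary is split into `Γ_c` (the union of the facets in `clamped`) and its complement `Γ_t`,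
both of nonzero surface measure. Every facet carries a choice of unit normal. -/
structure Mesh (d : ℕ) where
  complex : Geometry.SimplicialComplex ℝ (E d)
  finite_faces : complex.faces.Finite
  /-- every face is a face of some `d`-simplex -/
  pure : ∀ s ∈ complex.faces, ∃ T ∈ complex.faces, s ⊆ T ∧ T.card = d + 1
  /-- the facets that make up `Γ_c` -/
  clamped : Set (Finset (E d))
  /-- the facets in `Γ_c` are boundary facets: they lie in exactly one `d`-simplex -/
  clamped_boundary : ∀ F ∈ clamped, F ∈ complex.faces ∧ F.card = d ∧
    ∃! T, T ∈ complex.faces ∧ T.card = d + 1 ∧ F ⊆ T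
  clamped_nonempty : clamped.Nonempty
  /-- some boundary facet does not belong to `Γ_c` -/
  traction_nonempty : ∃ F ∈ complex.faces, F.card = d ∧ F ∉ clamped ∧
    ∃! T, T ∈ complex.faces ∧ T.card = d + 1 ∧ F ⊆ T
  /-- the chosen unit normal of each facet -/
  normal : Finset (E d) → E d
  norm_normal : ∀ F ∈ complex.faces, F.card = d → ‖normal F‖ = 1
  normal_orthogonal : ∀ F ∈ complex.faces, F.card = d →
    ∀ x ∈ F, ∀ y ∈ F, inner ℝ (normal F) (x - y) = 0

namespace Mesh

variable {d : ℕ} (m : Mesh d)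

/-- The elements: the `d`-simplices of the partition. -/
def Element : Type := {T : Finset (E d) // T ∈ m.complex.faces ∧ T.card = d + 1}

/-- The facets (edges if `d = 2`, triangular faces if `d = 3`) that do not lie on `Γ_c`. -/
def FreeFacet : Type :=
  {F : Finset (E d) // F ∈ m.complex.faces ∧ F.card = d ∧ F ∉ m.clamped}

/-- The vertices that do not lie on the closure of `Γ_c`. -/
def FreeVertex : Type :=
  {z : E d // {z} ∈ m.complex.faces ∧ ∀ F ∈ m.clamped, z ∉ F}

instance : Finite m.Element :=
  (m.finite_faces.subset (fun _ h => h.1) :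
    {T : Finset (E d) | T ∈ m.complex.faces ∧ T.card = d + 1}.Finite)

instance : Finite m.FreeFacet :=
  (m.finite_faces.subset (fun _ h => h.1) :
    {F : Finset (E d) | F ∈ m.complex.faces ∧ F.card = d ∧ F ∉ m.clamped}.Finite)

instance : Finite m.FreeVertex :=
  ((m.finite_faces.preimage (Finset.singleton_injective.injOn)).subset (fun _ h => h.1) :
    {z : E d | {z} ∈ m.complex.faces ∧ ∀ F ∈ m.clamped, z ∉ F}.Finite)

instance : Fintype m.Element := Fintype.ofFinite _
instance : Fintype m.FreeFacet := Fintype.ofFinite _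
instance : Fintype m.FreeVertex := Fintype.ofFinite _
instance : DecidableEq m.Element := Classical.decEq _
instance : DecidableEq m.FreeFacet := Classical.decEq _
instance : DecidableEq m.FreeVertex := Classical.decEq _

variable {m}

/-- The closed simplex occupied by an element. -/
def Element.carrier (T : m.Element) : Set (E d) := convexHull ℝ (T.1 : Set (E d))

variable (m)

/-- Shape regularity: each element `T` contains a ball of radius `diam T / κ`. -/
def ShapeRegular (κ : ℝ) : Prop :=
  ∀ T : m.Element, ∃ c : E d, Metric.closedBall c (Metric.diam T.carrier / κ) ⊆ T.carrier

variable {m}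

/-- The vertices of an element form an affine basis of `ℝ^d`. -/
def Element.affineBasis (T : m.Element) : AffineBasis T.1 ℝ (E d) where
  toFun := Subtype.val
  ind' := m.complex.indep T.2.1
  tot' := by
    rw [AffineIndependent.affineSpan_eq_top_iff_card_eq_finrank_add_one (m.complex.indep T.2.1)]
    simp [T.2.2]

open Classical in
/-- The barycentric coordinate of `T` belonging to `z`, an affine function on `ℝ^d`;
it is `0` if `z` is not a vertex of `T`. -/
def Element.bary (T : m.Element) (z : E d) (x : E d) : ℝ :=
  if h : z ∈ T.1 then T.affineBasis.coord ⟨z, h⟩ x else 0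

/-! ### Piecewise polynomial fields

A piecewise polynomial field is given by its polynomial pieces, one for each element; derivatives
and integrals are taken element by element. For the continuous displacement fields and the normally
continuous fluxes below this is the weak gradient, respectively the weak divergence. -/

variable (m)

/-- Piecewise smooth vector fields, as the family of their pieces. -/
abbrev VField : Type := m.Element → E d → E d

/-- Piecewise smooth scalar functions, as the family of their pieces. -/
abbrev SField : Type := m.Element → E d → ℝ

end Mesh

/-- The symmetric gradient `ε(v) = (∇v + ∇vᵀ)/2`. -/
def strain {d : ℕ} (v : E d → E d) (x : E d) : Matrix (Fin d) (Fin d) ℝ :=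
  Matrix.of fun i j => (fderiv ℝ v x (EuclideanSpace.single j 1) i +
    fderiv ℝ v x (EuclideanSpace.single i 1) j) / 2

/-- The divergence. -/
def divergence {d : ℕ} (v : E d → E d) (x : E d) : ℝ :=
  ∑ i, fderiv ℝ v x (EuclideanSpace.single i 1) i

/-- The absolute permeability tensor: a measurable, symmetric, uniformly positive definite and
bounded matrix field. -/
structure Permeability (d : ℕ) where
  tensor : E d → Matrix (Fin d) (Fin d) ℝ
  measurable_tensor : ∀ i j, Measurable fun x => tensor x i j
  symm : ∀ x, (tensor x).IsSymm
  lower : ℝ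
  lower_pos : 0 < lower
  upper : ℝ
  lower_le : ∀ x (ξ : Fin d → ℝ), lower * (ξ ⬝ᵥ ξ) ≤ ξ ⬝ᵥ (tensor x).mulVec ξ
  le_upper : ∀ x (ξ : Fin d → ℝ), ξ ⬝ᵥ (tensor x).mulVec ξ ≤ upper * (ξ ⬝ᵥ ξ)

/-- The scalar physical parameters and the time step of the problem. -/
structure Params where
  /-- first Lamé coefficient `λ` -/
  lam : ℝ
  /-- second Lamé coefficient `μ` -/
  mu : ℝ
  /-- Biot-Willis constant `α` -/
  alpha : ℝ
  /-- bulk modulus `M` -/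
  M : ℝ
  /-- fluid viscosity `μ_f` -/
  muf : ℝ
  /-- time step `τ` -/
  tau : ℝ
  lam_nonneg : 0 ≤ lam
  mu_pos : 0 < mu
  alpha_pos : 0 < alpha
  M_pos : 0 < M
  muf_pos : 0 < muf
  tau_pos : 0 < tau

namespace Params

/-- `ζ = √(λ + 2μ/d)`. -/
def zeta (P : Params) (d : ℕ) : ℝ := √(P.lam + 2 * P.mu / d)

/-- `c_p = (α²/ζ² + 1/M)⁻¹`. -/
def cp (P : Params) (d : ℕ) : ℝ := (P.alpha ^ 2 / P.zeta d ^ 2 + 1 / P.M)⁻¹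

end Params

namespace Mesh

variable {d : ℕ} (m : Mesh d) (κ : Permeability d) (P : Params)

/-! ### Bilinear forms -/

/-- `a(u,v) = 2μ ∫ ε(u):ε(v) + λ ∫ div u div v`. -/
def elasticity (u v : m.VField) : ℝ :=
  ∑ T : m.Element, ∫ x in T.carrier,
    (2 * P.mu * ∑ i, ∑ j, strain (u T) x i j * strain (v T) x i j +
      P.lam * (divergence (u T) x * divergence (v T) x))

/-- `(div v, q)`. -/
def divForm (v : m.VField) (q : m.SField) : ℝ :=
  ∑ T : m.Element, ∫ x in T.carrier, divergence (v T) x * q T x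

/-- `(p, q)`. -/
def massForm (p q : m.SField) : ℝ :=
  ∑ T : m.Element, ∫ x in T.carrier, p T x * q T x

/-- `(K⁻¹ μ_f w, r)`. -/
def fluxForm (w r : m.VField) : ℝ :=
  ∑ T : m.Element, ∫ x in T.carrier,
    P.muf * (((κ.tensor x)⁻¹).mulVec (w T x) ⬝ᵥ (r T x : Fin d → ℝ))

/-! ### Bases of the finite element spaces -/

/-- Basis of the bubble space: `∏_{z ∈ F} λ_z` times the unit normal of `F`, for the facets `F`
that do not lie on `Γ_c`. It is supported on the elements that contain `F`. -/
def bubble (F : m.FreeFacet) : m.VField :=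
  fun T x => (∏ z ∈ F.1, T.bary z x) • m.normal F.1

/-- Nodal basis of the continuous piecewise linear vector fields that vanish on `Γ_c`: the hat
function of a vertex times a coordinate vector. -/
def hat (i : m.FreeVertex × Fin d) : m.VField :=
  fun T x => T.bary i.1.1 x • EuclideanSpace.single i.2 (1 : ℝ)

/-- Basis of the piecewise constant functions: the indicator functions of the elements. -/
def indicator (S : m.Element) : m.SField := fun T _ => if T = S then 1 else 0

open Classical in
/-- Basis of the lowest order Raviart-Thomas-Nédélec space with zero normal component on `Γ_c`:
the basis function of the facet `F` vanishes on the elements that do not contain `F`; on an element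
`T ⊇ F`, with `z` the vertex of `T` opposite to `F`, it is the multiple of `x - z` whose component
along the chosen normal of `F` equals `1` on `F` (note that `∇λ_z · (y - z) = -1` for `y ∈ F`, and
`∇λ_z` is a multiple of the normal). -/
def raviartThomas (F : m.FreeFacet) : m.VField :=
  fun T x => if F.1 ⊆ T.1 then
    ∑ z ∈ T.1.filter (· ∉ F.1), (-(fderiv ℝ (T.bary z) x (m.normal F.1))) • (x - z) else 0

/-! ### Blocks -/

/-- `A_bb`. -/
def Abb : Matrix m.FreeFacet m.FreeFacet ℝ :=
  Matrix.of fun i j => m.elasticity P (m.bubble j) (m.bubble i)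

/-- `A_bl`. -/
def Abl : Matrix m.FreeFacet (m.FreeVertex × Fin d) ℝ :=
  Matrix.of fun i j => m.elasticity P (m.hat j) (m.bubble i)

/-- `A_ll`. -/
def All : Matrix (m.FreeVertex × Fin d) (m.FreeVertex × Fin d) ℝ :=
  Matrix.of fun i j => m.elasticity P (m.hat j) (m.hat i)

/-- `B_b`. -/
def Bb : Matrix m.Element m.FreeFacet ℝ :=
  Matrix.of fun i j => -m.divForm (m.bubble j) (m.indicator i)

/-- `B_l`. -/
def Bl : Matrix m.Element (m.FreeVertex × Fin d) ℝ :=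
  Matrix.of fun i j => -m.divForm (m.hat j) (m.indicator i)

/-- `B_w`. -/
def Bw : Matrix m.Element m.FreeFacet ℝ :=
  Matrix.of fun i j => -m.divForm (m.raviartThomas j) (m.indicator i)

/-- `M_w`. -/
def Mw : Matrix m.FreeFacet m.FreeFacet ℝ :=
  Matrix.of fun i j => m.fluxForm κ P (m.raviartThomas j) (m.raviartThomas i)

/-- `M_p`. -/
def Mp : Matrix m.Element m.Element ℝ :=
  Matrix.of fun i j => m.massForm (m.indicator j) (m.indicator i)

/-- `D_bb = (d+1) diag(A_bb)`. -/
def Dbb : Matrix m.FreeFacet m.FreeFacet ℝ :=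
  ((d : ℝ) + 1) • Matrix.diagonal (m.Abb P).diag

/-- `A_w = B_wᵀ M_p⁻¹ B_w`. -/
def Aw : Matrix m.FreeFacet m.FreeFacet ℝ :=
  m.Bw.transpose * m.Mp⁻¹ * m.Bw

/-! ### The coefficient spaces and the systems -/

/-- Indices of the displacement space (bubbles, then piecewise linears). -/
abbrev DispIdx : Type := m.FreeFacet ⊕ (m.FreeVertex × Fin d)

/-- Indices of `X_h`: (bubble, linear), (pressure, Darcy velocity). -/
abbrev FullIdx : Type := m.DispIdx ⊕ (m.Element ⊕ m.FreeFacet)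

/-- Indices of `X_h^E`: linear, (pressure, Darcy velocity). -/
abbrev ElimIdx : Type := (m.FreeVertex × Fin d) ⊕ (m.Element ⊕ m.FreeFacet)

/-- `A_u = [[A_bb, A_bl], [A_blᵀ, A_ll]]`. -/
def Au : Matrix m.DispIdx m.DispIdx ℝ :=
  Matrix.fromBlocks (m.Abb P) (m.Abl P) (m.Abl P).transpose (m.All P)

/-- `A_u^D = [[D_bb, A_bl], [A_blᵀ, A_ll]]`. -/
def AuD : Matrix m.DispIdx m.DispIdx ℝ :=
  Matrix.fromBlocks (m.Dbb P) (m.Abl P) (m.Abl P).transpose (m.All P)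

/-- The block matrix
`[[A, [[α B_bᵀ, 0], [α B_lᵀ, 0]]], [[[-α B_b, -α B_l], [0, 0]], [[M_p/M, -τ B_w], [τ B_wᵀ, τ M_w]]]]`
with a given displacement block `A`. -/
def systemWith (A : Matrix m.DispIdx m.DispIdx ℝ) : Matrix m.FullIdx m.FullIdx ℝ :=
  Matrix.fromBlocks
    A
    (Matrix.fromBlocks (P.alpha • m.Bb.transpose) 0 (P.alpha • m.Bl.transpose) 0)
    (Matrix.fromBlocks (-P.alpha • m.Bb) (-P.alpha • m.Bl) 0 0)
    (Matrix.fromBlocks ((1 / P.M) • m.Mp) (-P.tau • m.Bw)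
      (P.tau • m.Bw.transpose) (P.tau • m.Mw κ P))

/-- The full bubble system `𝒜`. -/
def fullSystem : Matrix m.FullIdx m.FullIdx ℝ := m.systemWith κ P (m.Au P)

/-- The system `𝒜^D`, in which `A_bb` is replaced by `D_bb`. -/
def diagSystem : Matrix m.FullIdx m.FullIdx ℝ := m.systemWith κ P (m.AuD P)

/-- `A_u^E = A_ll - A_blᵀ D_bb⁻¹ A_bl`. -/
def AuE : Matrix (m.FreeVertex × Fin d) (m.FreeVertex × Fin d) ℝ :=
  m.All P - (m.Abl P).transpose * (m.Dbb P)⁻¹ * m.Abl P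

/-- The bubble-eliminated system `𝒜^E`. -/
def elimSystem : Matrix m.ElimIdx m.ElimIdx ℝ :=
  Matrix.fromBlocks
    (m.AuE P)
    (Matrix.fromCols
      (P.alpha • m.Bl.transpose -
        P.alpha • ((m.Abl P).transpose * (m.Dbb P)⁻¹ * m.Bb.transpose)) 0)
    (Matrix.fromRows
      (-P.alpha • m.Bl + P.alpha • (m.Bb * (m.Dbb P)⁻¹ * m.Abl P)) 0)
    (Matrix.fromBlocks
      ((1 / P.M) • m.Mp + P.alpha ^ 2 • (m.Bb * (m.Dbb P)⁻¹ * m.Bb.transpose))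
      (-P.tau • m.Bw) (P.tau • m.Bw.transpose) (P.tau • m.Mw κ P))

end Mesh

/-! ### Norms and inf-sup constants -/

/-- `‖v‖_H = (Hv, v)^{1/2}`. -/
def hNorm {ι : Type*} [Fintype ι] (H : Matrix ι ι ℝ) (v : ι → ℝ) : ℝ :=
  √(H.mulVec v ⬝ᵥ v)

namespace Mesh

variable {d : ℕ} (m : Mesh d) (κ : Permeability d) (P : Params)

/-- The norm `|||x|||` for the full bubble system:
`|||(u,p,w)|||² = ‖u‖²_{A_u} + c_p⁻¹ ‖p‖²_{M_p} + τ ‖w‖²_{M_w} + τ² c_p ‖B_w w‖²_{M_p⁻¹}`. -/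
def weightedNorm (x : m.FullIdx → ℝ) : ℝ :=
  let u : m.DispIdx → ℝ := fun i => x (Sum.inl i)
  let p : m.Element → ℝ := fun i => x (Sum.inr (Sum.inl i))
  let w : m.FreeFacet → ℝ := fun i => x (Sum.inr (Sum.inr i))
  √(hNorm (m.Au P) u ^ 2 + (P.cp d)⁻¹ * hNorm m.Mp p ^ 2 + P.tau * hNorm (m.Mw κ P) w ^ 2 +
    P.tau ^ 2 * P.cp d * hNorm m.Mp⁻¹ (m.Bw.mulVec w) ^ 2)

/-- `𝒟 = diag(A_u^D, (α²/ζ² + 1/M) M_p, τ M_w + τ² c_p A_w)`. -/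
def normD : Matrix m.FullIdx m.FullIdx ℝ :=
  Matrix.fromBlocks (m.AuD P) 0 0
    (Matrix.fromBlocks ((P.alpha ^ 2 / P.zeta d ^ 2 + 1 / P.M) • m.Mp) 0 0
      (P.tau • m.Mw κ P + (P.tau ^ 2 * P.cp d) • m.Aw))

/-- `𝒟^E = diag(A_u^E, α² B_b D_bb⁻¹ B_bᵀ + c_p⁻¹ M_p, τ M_w + τ² c_p A_w)`. -/
def normE : Matrix m.ElimIdx m.ElimIdx ℝ :=
  Matrix.fromBlocks (m.AuE P) 0 0
    (Matrix.fromBlocks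
      (P.alpha ^ 2 • (m.Bb * (m.Dbb P)⁻¹ * m.Bb.transpose) + (P.cp d)⁻¹ • m.Mp) 0 0
      (P.tau • m.Mw κ P + (P.tau ^ 2 * P.cp d) • m.Aw))

end Mesh

section Constants

variable {ι : Type*} [Fintype ι] (A : Matrix ι ι ℝ) (N : (ι → ℝ) → ℝ)

/-- `(Ax, y) / (‖x‖ ‖y‖)`, as an extended real number so that suprema and infima are the true
ones. -/
def quotient (x y : ι → ℝ) : EReal := ((A.mulVec x ⬝ᵥ y / (N x * N y) : ℝ) : EReal)

/-- `sup_{x ≠ 0} sup_{y ≠ 0} (Ax, y) / (‖x‖ ‖y‖)`. -/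
def supSup : EReal :=
  ⨆ x : {x : ι → ℝ // x ≠ 0}, ⨆ y : {y : ι → ℝ // y ≠ 0}, quotient A N x.1 y.1

/-- `inf_{y ≠ 0} sup_{x ≠ 0} (Ax, y) / (‖x‖ ‖y‖)`. -/
def infSupTest : EReal :=
  ⨅ y : {y : ι → ℝ // y ≠ 0}, ⨆ x : {x : ι → ℝ // x ≠ 0}, quotient A N x.1 y.1

/-- `inf_{x ≠ 0} sup_{y ≠ 0} (Ax, y) / (‖x‖ ‖y‖)`. -/
def infSupTrial : EReal :=
  ⨅ x : {x : ι → ℝ // x ≠ 0}, ⨆ y : {y : ι → ℝ // y ≠ 0}, quotient A N x.1 y.1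

end Constants

namespace Mesh

variable {d : ℕ} (m : Mesh d) (κ : Permeability d) (P : Params)

/-- Well-posedness of the full bubble system with respect to the weighted norm, with continuity
constant `ς` and inf-sup constant `γ`. -/
def FullWellPosed (ς γ : ℝ) : Prop :=
  supSup (m.fullSystem κ P) (m.weightedNorm κ P) ≤ (ς : EReal) ∧
    (γ : EReal) ≤ infSupTest (m.fullSystem κ P) (m.weightedNorm κ P)

/-- The inf-sup condition with constant `γ` for `𝒜^D` with respect to `𝒟`. -/
def DiagInfSup (γ : ℝ) : Prop :=
  (γ : EReal) ≤ infSupTest (m.diagSystem κ P) (hNorm (m.normD κ P))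

/-- The inf-sup condition with constant `γ` for `𝒜^E` with respect to `𝒟^E`. -/
def ElimInfSup (γ : ℝ) : Prop :=
  (γ : EReal) ≤ infSupTrial (m.elimSystem κ P) (hNorm (m.normE κ P))

/-- Continuity with constant `ς` of `𝒜^E` with respect to `𝒟^E`. -/
def ElimContinuous (ς : ℝ) : Prop :=
  supSup (m.elimSystem κ P) (hNorm (m.normE κ P)) ≤ (ς : EReal)

end Mesh

end BiotFE

end

noncomputable section

namespace BiotFE

open Matrix

set_option linter.unusedSectionVars false

/-! ### Quadratic forms and inf-sup constants -/

section Forms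

/-! Eliminating the bubbles is exact at the level of bilinear forms. For `(u_l, p, w)` put `u_b =
-D_bb⁻¹ (A_bl u_l + α B_bᵀ p)` (`lift`). The bubble row of `𝒜^D` then vanishes, so the lifted vector
pairs with any test vector as `𝒜^E` pairs the unlifted one with the bubble-free part of the test
vector (`lift_system`). Completing the square shows that the lift is an isometry from `‖·‖_{𝒟^E}`
into `‖·‖_𝒟` (`lift_norm`). Hence (D) implies (E): exchange the roles of trial and test vectors
(`exists_test_of_infSupTest`), then drop the bubble part of the test vector, which costs a bounded
factor (`normE_le`). For (C), `𝒜^D` differs from `𝒜`, and `𝒟` from the weighted norm, by the same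
form `D_bb - A_bb`. It is semidefinite because at most `d + 1` bubbles live on an element, so
Cauchy-Schwarz together with `ς ≥ 1` keeps the constant (`systemD_le`).

All definiteness is extracted from the hypothesis: a positive inf-sup constant rules out nonzero
vectors of zero norm (`FullWellPosed.admissible`). For one set of parameters (D) is then pure linear
algebra: `𝒜^D` is injective, and the dimension is finite.

The uniform constant in (D) has two sources. First, well-posedness for all parameters contains the
Stokes inf-sup condition with constant `γ/4`: take `λ = 0`, a large `M` and a tiny `τ`, and test
with a pure pressure (`exists_stokes_stability`). Second, on shape-regular elements the lumped form
is bounded by `ζ²` times the squared strain (`exists_AuD_le`). This rests on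
`exists_bubble_stability`: an inverse inequality bounds the maximal strain, the strain bounds the
elongations `⟨y - x, u(y) - u(x)⟩`, and the value of `u` at the barycentre of a facet differs from
the mean of its vertex values exactly by the bubble coefficient times a multiple of the normal.
Elongations ignore infinitesimal rigid motions, so Korn's inequality is not needed. The pointwise
bounds `ζ² (div u)² ≤` energy density `≤ d ζ² |ε(u)|²` keep everything independent of `λ` and `μ`.
Finally `diag_infSup` assembles an explicit trial vector from the Stokes field and the weighted flux
divergence. -/

lemma isSymm_of_posSemidef {ι : Type*} {H : Matrix ι ι ℝ} (hH : H.PosSemidef) : H.IsSymm := by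
  have := hH.isHermitian
  rwa [IsHermitian, conjTranspose_eq_transpose_of_trivial] at this

variable {ι : Type*} [Fintype ι] {H A : Matrix ι ι ℝ}

lemma sq_le_mul_of_quadratic_nonneg {a b c : ℝ}
    (h : ∀ t : ℝ, 0 ≤ a * (t * t) + 2 * b * t + c) : b ^ 2 ≤ a * c := by
  have := discrim_le_zero h
  rw [discrim] at this
  nlinarith

lemma mulVec_dotProduct_comm (hH : H.IsSymm) (x y : ι → ℝ) :
    H.mulVec x ⬝ᵥ y = H.mulVec y ⬝ᵥ x := by
  rw [dotProduct_comm, dotProduct_mulVec, ← mulVec_transpose, hH.eq]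

lemma posSemidef_of_form (hs : H.IsSymm) (h : ∀ x, 0 ≤ H.mulVec x ⬝ᵥ x) : H.PosSemidef := by
  refine PosSemidef.of_dotProduct_mulVec_nonneg ?_ fun x => ?_
  · rwa [IsHermitian, conjTranspose_eq_transpose_of_trivial]
  · rw [star_trivial, dotProduct_comm]
    exact h x

lemma posDef_of_form (hs : H.IsSymm) (h : ∀ x, x ≠ 0 → 0 < H.mulVec x ⬝ᵥ x) : H.PosDef := by
  refine PosDef.of_dotProduct_mulVec_pos ?_ fun x hx => ?_
  · rwa [IsHermitian, conjTranspose_eq_transpose_of_trivial]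
  · rw [star_trivial, dotProduct_comm]
    exact h x hx

lemma form_nonneg (hH : H.PosSemidef) (x : ι → ℝ) : 0 ≤ H.mulVec x ⬝ᵥ x := by
  have := hH.dotProduct_mulVec_nonneg x
  rwa [star_trivial, dotProduct_comm] at this

lemma form_pos (hH : H.PosDef) {x : ι → ℝ} (hx : x ≠ 0) : 0 < H.mulVec x ⬝ᵥ x := by
  have := hH.dotProduct_mulVec_pos hx
  rwa [star_trivial, dotProduct_comm] at this

lemma form_sq_le (hH : H.PosSemidef) (x y : ι → ℝ) :
    (H.mulVec x ⬝ᵥ y) ^ 2 ≤ (H.mulVec x ⬝ᵥ x) * (H.mulVec y ⬝ᵥ y) := by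
  refine sq_le_mul_of_quadratic_nonneg fun t => ?_
  have h := form_nonneg hH (t • x + y)
  have hc := mulVec_dotProduct_comm (isSymm_of_posSemidef hH) y x
  simp only [mulVec_add, mulVec_smul, add_dotProduct, dotProduct_add, smul_dotProduct,
    dotProduct_smul, smul_eq_mul] at h
  rw [hc] at h
  linarith

lemma hNorm_sq (hH : H.PosSemidef) (x : ι → ℝ) : hNorm H x ^ 2 = H.mulVec x ⬝ᵥ x :=
  Real.sq_sqrt (form_nonneg hH x)

lemma hNorm_nonneg (x : ι → ℝ) : 0 ≤ hNorm H x := Real.sqrt_nonneg _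

lemma hNorm_pos (hH : H.PosDef) {x : ι → ℝ} (hx : x ≠ 0) : 0 < hNorm H x :=
  Real.sqrt_pos.2 (form_pos hH hx)

lemma abs_form_le (hH : H.PosSemidef) (x y : ι → ℝ) :
    |H.mulVec x ⬝ᵥ y| ≤ hNorm H x * hNorm H y := by
  refine abs_le_of_sq_le_sq ?_ (mul_nonneg (hNorm_nonneg _) (hNorm_nonneg _))
  rw [mul_pow, hNorm_sq hH, hNorm_sq hH]
  exact form_sq_le hH x y

/-- A positive definite form dominates every quadratic form on the same space. -/
lemma exists_form_le (hH : H.PosDef) (G : Matrix ι ι ℝ) :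
    ∃ C : ℝ, 0 < C ∧ ∀ x, G.mulVec x ⬝ᵥ x ≤ C * (H.mulVec x ⬝ᵥ x) := by
  have hcont : ∀ K : Matrix ι ι ℝ, Continuous fun x : ι → ℝ => K.mulVec x ⬝ᵥ x := fun K => by
    unfold dotProduct mulVec dotProduct
    fun_prop
  have hsph : IsCompact (Metric.sphere (0 : ι → ℝ) 1) := isCompact_sphere 0 1
  -- The sphere is empty exactly when the index type is; then every vector is zero.
  rcases (Metric.sphere (0 : ι → ℝ) 1).eq_empty_or_nonempty with he | hne
  · refine ⟨1, one_pos, fun x => ?_⟩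
    have hx : x = 0 := by
      by_contra hx
      have : (‖x‖⁻¹ • x) ∈ Metric.sphere (0 : ι → ℝ) 1 := by
        simp [norm_smul, inv_mul_cancel₀ (norm_ne_zero_iff.2 hx)]
      rw [he] at this
      exact this
    simp [hx]
  obtain ⟨a, ha, hamin⟩ := hsph.exists_isMinOn hne (hcont H).continuousOn
  obtain ⟨b, hb, hbmax⟩ := hsph.exists_isMaxOn hne (hcont G).continuousOn
  have ha0 : a ≠ 0 := by
    rintro rfl
    simp at ha
  have hapos := form_pos hH ha0
  set ca := H.mulVec a ⬝ᵥ a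
  set cb := G.mulVec b ⬝ᵥ b
  -- Maximum of one form over minimum of the other on the unit sphere; the added `1` only makes the
  -- constant positive.
  refine ⟨(|cb| + 1) / ca, by positivity, fun x => ?_⟩
  by_cases hx : x = 0
  · simp [hx]
  have hn : 0 < ‖x‖ := norm_pos_iff.2 hx
  have hmem : (‖x‖⁻¹ • x) ∈ Metric.sphere (0 : ι → ℝ) 1 := by
    simp [norm_smul, inv_mul_cancel₀ hn.ne']
  have h1 : ca ≤ _ := hamin hmem
  have h2 : _ ≤ cb := hbmax hmem
  simp only [mulVec_smul, smul_dotProduct, dotProduct_smul, smul_eq_mul] at h1 h2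
  have hsq : 0 < ‖x‖⁻¹ * ‖x‖⁻¹ := by positivity
  rw [← mul_assoc] at h1 h2
  set s := ‖x‖⁻¹ * ‖x‖⁻¹
  have h3 : s * (G.mulVec x ⬝ᵥ x) ≤ s * ((|cb| + 1) / ca * (H.mulVec x ⬝ᵥ x)) :=
    calc s * (G.mulVec x ⬝ᵥ x) ≤ |cb| + 1 := by linarith [le_abs_self cb]
      _ = (|cb| + 1) / ca * ca := by field_simp
      _ ≤ (|cb| + 1) / ca * (s * (H.mulVec x ⬝ᵥ x)) := by gcongr
      _ = _ := by ring
  exact le_of_mul_le_mul_left h3 hsq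

variable {N : (ι → ℝ) → ℝ} {γ γ' : ℝ}

/-- The inner supremum is not known to be attained, hence the passage to a strictly smaller
constant. -/
lemma exists_of_le_infSupTest (h : (γ : EReal) ≤ infSupTest A N) (hγ : γ' < γ) {y : ι → ℝ}
    (hy : y ≠ 0) : ∃ x, x ≠ 0 ∧ γ' < A.mulVec x ⬝ᵥ y / (N x * N y) := by
  have h1 : (γ' : EReal) < ⨆ x : {x : ι → ℝ // x ≠ 0}, quotient A N x.1 y :=
    (EReal.coe_lt_coe_iff.2 hγ).trans_le (h.trans (iInf_le _ (⟨y, hy⟩ : {y : ι → ℝ // y ≠ 0})))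
  obtain ⟨x, hx⟩ := lt_iSup_iff.1 h1
  exact ⟨x.1, x.2, EReal.coe_lt_coe_iff.1 hx⟩

lemma le_infSupTest (hN : ∀ x, x ≠ 0 → 0 < N x)
    (h : ∀ y, y ≠ 0 → ∃ x, x ≠ 0 ∧ γ * (N x * N y) ≤ A.mulVec x ⬝ᵥ y) :
    (γ : EReal) ≤ infSupTest A N := by
  refine le_iInf fun y => ?_
  obtain ⟨x, hx, hxy⟩ := h y.1 y.2
  refine le_iSup_of_le ⟨x, hx⟩ (EReal.coe_le_coe_iff.2 ?_)
  rwa [le_div_iff₀ (mul_pos (hN x hx) (hN y.1 y.2))]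

lemma le_infSupTrial (hN : ∀ x, x ≠ 0 → 0 < N x)
    (h : ∀ x, x ≠ 0 → ∃ y, y ≠ 0 ∧ γ * (N x * N y) ≤ A.mulVec x ⬝ᵥ y) :
    (γ : EReal) ≤ infSupTrial A N := by
  refine le_iInf fun x => ?_
  obtain ⟨y, hy, hxy⟩ := h x.1 x.2
  refine le_iSup_of_le ⟨y, hy⟩ (EReal.coe_le_coe_iff.2 ?_)
  rwa [le_div_iff₀ (mul_pos (hN x.1 x.2) (hN y hy))]

lemma supSup_le (hN : ∀ x, x ≠ 0 → 0 < N x)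
    (h : ∀ x y, A.mulVec x ⬝ᵥ y ≤ γ * (N x * N y)) : supSup A N ≤ (γ : EReal) := by
  refine iSup_le fun x => iSup_le fun y => EReal.coe_le_coe_iff.2 ?_
  rw [div_le_iff₀ (mul_pos (hN x.1 x.2) (hN y.1 y.2))]
  exact h x.1 y.1

lemma le_of_supSup_le (hN : ∀ x, x ≠ 0 → 0 < N x) (h : supSup A N ≤ (γ : EReal))
    {x y : ι → ℝ} (hx : x ≠ 0) (hy : y ≠ 0) : A.mulVec x ⬝ᵥ y ≤ γ * (N x * N y) := by
  rw [← div_le_iff₀ (mul_pos (hN x hx) (hN y hy)), ← EReal.coe_le_coe_iff]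
  refine le_trans ?_ h
  exact le_iSup₂_of_le (⟨x, hx⟩ : {x : ι → ℝ // x ≠ 0}) (⟨y, hy⟩ : {x : ι → ℝ // x ≠ 0}) le_rfl

/-- A positive inf-sup constant forces the norm to be definite. -/
lemma ne_zero_of_infSupTest (hγ : 0 < γ) (h : (γ : EReal) ≤ infSupTest A N) {y : ι → ℝ}
    (hy : y ≠ 0) : N y ≠ 0 := by
  intro h0
  -- With `a / 0 = 0` a vector of zero norm makes every quotient zero, against a supremum above `0`.
  obtain ⟨x, -, hxy⟩ := exists_of_le_infSupTest h hγ hy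
  simp [h0] at hxy

variable [DecidableEq ι]

/-- The inf-sup condition over test vectors implies the one over trial vectors. -/
lemma exists_test_of_infSupTest (hH : H.PosDef) (hγ : 0 < γ)
    (h : (γ : EReal) ≤ infSupTest A (hNorm H)) {x : ι → ℝ} (hx : x ≠ 0) :
    ∃ y, y ≠ 0 ∧ γ * (hNorm H x * hNorm H y) ≤ A.mulVec x ⬝ᵥ y := by
  have hsymm := isSymm_of_posSemidef hH.posSemidef
  have hinj : Function.Injective A.transpose.mulVec := by
    refine (injective_iff_map_eq_zero A.transpose.mulVecLin).2 fun y hy => ?_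
    by_contra hy0
    obtain ⟨z, -, hz⟩ := exists_of_le_infSupTest h hγ hy0
    have : A.mulVec z ⬝ᵥ y = 0 := by
      rw [dotProduct_comm, dotProduct_mulVec, ← mulVec_transpose]
      rw [mulVecLin_apply] at hy
      simp [hy]
    simp [this] at hz
  -- Choose `y` with `Aᵀ y = H x`. Then `(A z, y) = (H x, z) ≤ ‖x‖ ‖z‖` for all `z`, so the
  -- condition at `y` says `γ ≤ ‖x‖ / ‖y‖`, while `(A x, y) = ‖x‖²`.
  obtain ⟨y, hy⟩ := (mulVec_injective_iff_isUnit.1 hinj |> mulVec_surjective_iff_isUnit.2)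
    (H.mulVec x)
  have key : ∀ z, A.mulVec z ⬝ᵥ y = H.mulVec x ⬝ᵥ z := fun z => by
    rw [dotProduct_comm, dotProduct_mulVec, ← mulVec_transpose, hy]
  have hxpos := form_pos hH hx
  have hy0 : y ≠ 0 := by
    rintro rfl
    have := key x
    simp only [dotProduct_zero] at this
    linarith
  have hNy := hNorm_pos hH hy0
  have hNx := hNorm_pos hH hx
  refine ⟨y, hy0, ?_⟩
  have hle : (γ : EReal) ≤ ((hNorm H x / hNorm H y : ℝ) : EReal) := by
    refine (h.trans (iInf_le _ (⟨y, hy0⟩ : {y : ι → ℝ // y ≠ 0}))).trans (iSup_le fun z => ?_)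
    refine EReal.coe_le_coe_iff.2 ?_
    have hNz := hNorm_pos hH z.2
    rw [key, div_le_div_iff₀ (mul_pos hNz hNy) hNy]
    have := (le_abs_self _).trans (abs_form_le hH.posSemidef x z.1)
    nlinarith
  have hle' := EReal.coe_le_coe_iff.1 hle
  rw [le_div_iff₀ hNy] at hle'
  rw [key, ← hNorm_sq hH.posSemidef]
  nlinarith

/-- An invertible system satisfies an inf-sup condition with some positive constant. -/
lemma exists_le_infSupTest (hH : H.PosDef) (hA : ∀ x, A.mulVec x = 0 → x = 0) :
    ∃ γ : ℝ, 0 < γ ∧ (γ : EReal) ≤ infSupTest A (hNorm H) := by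
  have hinj : Function.Injective A.mulVec := (injective_iff_map_eq_zero A.mulVecLin).2 hA
  have hunit : IsUnit A := mulVec_injective_iff_isUnit.1 hinj
  have hdet := (isUnit_iff_isUnit_det A).1 hunit
  -- The trial vector for `y` is `A⁻¹ H y`: it pairs with `y` to `‖y‖²`, and its norm is at most `√C
  -- ‖y‖`.
  obtain ⟨K, hK⟩ : ∃ K, K = A⁻¹ * H := ⟨_, rfl⟩
  obtain ⟨C, hC, hle⟩ := exists_form_le hH (K.transpose * H * K)
  refine ⟨(√C)⁻¹, by positivity, le_infSupTest (fun x hx => hNorm_pos hH hx) fun y hy => ?_⟩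
  have hAK : A.mulVec (K.mulVec y) = H.mulVec y := by
    rw [mulVec_mulVec, hK, mul_nonsing_inv_cancel_left _ _ hdet]
  have hNy := hNorm_pos hH hy
  refine ⟨K.mulVec y, ?_, ?_⟩
  · intro h0
    have := form_pos hH hy
    rw [← hAK, h0] at this
    simp at this
  · rw [hAK, ← hNorm_sq hH.posSemidef]
    have h1 : hNorm H (K.mulVec y) ≤ √C * hNorm H y := by
      rw [hNorm, hNorm, ← Real.sqrt_mul hC.le]
      refine Real.sqrt_le_sqrt ((le_of_eq ?_).trans (hle y))
      rw [← mulVec_mulVec, ← mulVec_mulVec, mulVec_transpose, ← dotProduct_mulVec]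
    have hs : 0 < √C := Real.sqrt_pos.2 hC
    rw [inv_mul_le_iff₀ hs]
    nlinarith

end Forms

/-! ### The algebra of bubble elimination -/

/-- The matrices and scalars of a three-field system with a distinguished block of unknowns `b`. -/
structure BlockData (b l e f : Type) where
  Abb : Matrix b b ℝ
  Abl : Matrix b l ℝ
  All : Matrix l l ℝ
  Dbb : Matrix b b ℝ
  Bb : Matrix e b ℝ
  Bl : Matrix e l ℝ
  Mp : Matrix e e ℝ
  Bw : Matrix e f ℝ
  Mw : Matrix f f ℝ
  alpha : ℝ
  M : ℝ
  tau : ℝ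
  zeta : ℝ

namespace BlockData

variable {b l e f : Type} [Fintype b] [Fintype l] [Fintype e] [Fintype f]
  [DecidableEq b] [DecidableEq e] (S : BlockData b l e f)

/-- The weight `c_p`. -/
def cp : ℝ := (S.alpha ^ 2 / S.zeta ^ 2 + 1 / S.M)⁻¹

/-- The displacement block. -/
def Au : Matrix (b ⊕ l) (b ⊕ l) ℝ := fromBlocks S.Abb S.Abl S.Abl.transpose S.All

/-- The displacement block with modified bubble block. -/
def AuD : Matrix (b ⊕ l) (b ⊕ l) ℝ := fromBlocks S.Dbb S.Abl S.Abl.transpose S.All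

/-- The divergence matrix of the displacements. -/
def B : Matrix e (b ⊕ l) ℝ := fromCols S.Bb S.Bl

/-- The weighted flux matrix. -/
def Hw : Matrix f f ℝ :=
  S.tau • S.Mw + (S.tau ^ 2 * S.cp) • (S.Bw.transpose * S.Mp⁻¹ * S.Bw)

/-- The system with displacement block `A`. -/
def system (A : Matrix (b ⊕ l) (b ⊕ l) ℝ) : Matrix ((b ⊕ l) ⊕ (e ⊕ f)) ((b ⊕ l) ⊕ (e ⊕ f)) ℝ :=
  fromBlocks A
    (fromBlocks (S.alpha • S.Bb.transpose) 0 (S.alpha • S.Bl.transpose) 0)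
    (fromBlocks (-S.alpha • S.Bb) (-S.alpha • S.Bl) 0 0)
    (fromBlocks ((1 / S.M) • S.Mp) (-S.tau • S.Bw) (S.tau • S.Bw.transpose) (S.tau • S.Mw))

/-- The norm matrix with displacement block `A`. -/
def normWith (A : Matrix (b ⊕ l) (b ⊕ l) ℝ) :
    Matrix ((b ⊕ l) ⊕ (e ⊕ f)) ((b ⊕ l) ⊕ (e ⊕ f)) ℝ :=
  fromBlocks A 0 0 (fromBlocks ((S.alpha ^ 2 / S.zeta ^ 2 + 1 / S.M) • S.Mp) 0 0 S.Hw)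

/-- The Schur complement of the displacement block. -/
def AuE : Matrix l l ℝ := S.All - S.Abl.transpose * S.Dbb⁻¹ * S.Abl

/-- The system after elimination. -/
def elimSystem : Matrix (l ⊕ (e ⊕ f)) (l ⊕ (e ⊕ f)) ℝ :=
  fromBlocks S.AuE
    (fromCols (S.alpha • S.Bl.transpose -
        S.alpha • (S.Abl.transpose * S.Dbb⁻¹ * S.Bb.transpose)) 0)
    (fromRows (-S.alpha • S.Bl + S.alpha • (S.Bb * S.Dbb⁻¹ * S.Abl)) 0)
    (fromBlocks ((1 / S.M) • S.Mp + S.alpha ^ 2 • (S.Bb * S.Dbb⁻¹ * S.Bb.transpose))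
      (-S.tau • S.Bw) (S.tau • S.Bw.transpose) (S.tau • S.Mw))

/-- The norm matrix after elimination. -/
def normE : Matrix (l ⊕ (e ⊕ f)) (l ⊕ (e ⊕ f)) ℝ :=
  fromBlocks S.AuE 0 0
    (fromBlocks (S.alpha ^ 2 • (S.Bb * S.Dbb⁻¹ * S.Bb.transpose) + S.cp⁻¹ • S.Mp) 0 0 S.Hw)

/-- The properties of the blocks on which the elimination rests. -/
structure Admissible : Prop where
  alpha_pos : 0 < S.alpha
  M_pos : 0 < S.M
  tau_pos : 0 < S.tau
  zeta_pos : 0 < S.zeta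
  gap_psd : (S.Dbb - S.Abb).PosSemidef
  Mw_psd : S.Mw.PosSemidef
  div_bound : ∀ q u, (q ⬝ᵥ S.B.mulVec u) ^ 2 * S.zeta ^ 2 ≤
    (S.Mp.mulVec q ⬝ᵥ q) * (S.Au.mulVec u ⬝ᵥ u)
  posDef : (S.normWith S.Au).PosDef

/-- The displacement-pressure and pressure-flux couplings appear with opposite signs, so they cancel
when the system is tested with its own argument. -/
lemma system_form (A : Matrix (b ⊕ l) (b ⊕ l) ℝ) (u v : b ⊕ l → ℝ) (p q : e → ℝ) (w r : f → ℝ) :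
    (S.system A).mulVec (Sum.elim u (Sum.elim p w)) ⬝ᵥ Sum.elim v (Sum.elim q r) =
      A.mulVec u ⬝ᵥ v + S.alpha * (p ⬝ᵥ S.B.mulVec v) - S.alpha * (q ⬝ᵥ S.B.mulVec u) +
        1 / S.M * (S.Mp.mulVec p ⬝ᵥ q) - S.tau * (q ⬝ᵥ S.Bw.mulVec w) +
        S.tau * (p ⬝ᵥ S.Bw.mulVec r) + S.tau * (S.Mw.mulVec w ⬝ᵥ r) := by
  obtain ⟨ub, ul, rfl⟩ : ∃ ub ul, u = Sum.elim ub ul := ⟨u ∘ Sum.inl, u ∘ Sum.inr, by simp⟩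
  obtain ⟨vb, vl, rfl⟩ : ∃ ub ul, v = Sum.elim ub ul := ⟨v ∘ Sum.inl, v ∘ Sum.inr, by simp⟩
  simp only [system, B, fromBlocks_mulVec, fromCols_mulVec_sumElim, Sum.elim_comp_inl,
    Sum.elim_comp_inr, add_dotProduct, dotProduct_add, sumElim_dotProduct_sumElim, smul_mulVec,
    zero_mulVec, smul_dotProduct, smul_eq_mul, mulVec_transpose, neg_mulVec, neg_dotProduct,
    ← dotProduct_mulVec, neg_smul, add_zero, zero_dotProduct]
  rw [dotProduct_comm (S.Bb.mulVec ub) q, dotProduct_comm (S.Bl.mulVec ul) q,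
    dotProduct_comm (S.Bw.mulVec w) q]
  ring

lemma norm_form (A : Matrix (b ⊕ l) (b ⊕ l) ℝ) (u v : b ⊕ l → ℝ) (p q : e → ℝ) (w r : f → ℝ) :
    (S.normWith A).mulVec (Sum.elim u (Sum.elim p w)) ⬝ᵥ Sum.elim v (Sum.elim q r) =
      A.mulVec u ⬝ᵥ v + (S.alpha ^ 2 / S.zeta ^ 2 + 1 / S.M) * (S.Mp.mulVec p ⬝ᵥ q) +
        S.Hw.mulVec w ⬝ᵥ r := by
  simp only [normWith, fromBlocks_mulVec, Sum.elim_comp_inl, Sum.elim_comp_inr,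
    sumElim_dotProduct_sumElim, smul_mulVec, zero_mulVec, smul_dotProduct, smul_eq_mul, add_zero,
    zero_add]
  ring

lemma Hw_form (w r : f → ℝ) :
    S.Hw.mulVec w ⬝ᵥ r = S.tau * (S.Mw.mulVec w ⬝ᵥ r) +
      S.tau ^ 2 * S.cp * (S.Mp⁻¹.mulVec (S.Bw.mulVec w) ⬝ᵥ S.Bw.mulVec r) := by
  simp only [Hw, add_mulVec, smul_mulVec, ← mulVec_mulVec, add_dotProduct, smul_dotProduct,
    smul_eq_mul, mulVec_transpose, ← dotProduct_mulVec]

lemma exists_eq_elim {β γ δ : Type} (x : β ⊕ (γ ⊕ δ) → ℝ) :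
    ∃ u p w, x = Sum.elim u (Sum.elim p w) :=
  ⟨x ∘ Sum.inl, x ∘ Sum.inr ∘ Sum.inl, x ∘ Sum.inr ∘ Sum.inr, by
    ext (i | i | i) <;> rfl⟩

lemma AuD_form (u v : b ⊕ l → ℝ) :
    S.AuD.mulVec u ⬝ᵥ v = S.Au.mulVec u ⬝ᵥ v +
      (S.Dbb - S.Abb).mulVec (u ∘ Sum.inl) ⬝ᵥ (v ∘ Sum.inl) := by
  obtain ⟨ub, ul, rfl⟩ : ∃ ub ul, u = Sum.elim ub ul := ⟨u ∘ Sum.inl, u ∘ Sum.inr, by simp⟩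
  obtain ⟨vb, vl, rfl⟩ : ∃ ub ul, v = Sum.elim ub ul := ⟨v ∘ Sum.inl, v ∘ Sum.inr, by simp⟩
  simp only [AuD, Au, fromBlocks_mulVec, Sum.elim_comp_inl, Sum.elim_comp_inr,
    sumElim_dotProduct_sumElim, add_dotProduct, sub_mulVec, sub_dotProduct]
  ring

lemma AuD_elim_form (ub vb : b → ℝ) (ul vl : l → ℝ) :
    S.AuD.mulVec (Sum.elim ub ul) ⬝ᵥ Sum.elim vb vl =
      S.Dbb.mulVec ub ⬝ᵥ vb + S.Abl.mulVec ul ⬝ᵥ vb + ub ⬝ᵥ S.Abl.mulVec vl +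
        S.All.mulVec ul ⬝ᵥ vl := by
  simp only [AuD, fromBlocks_mulVec, Sum.elim_comp_inl, Sum.elim_comp_inr,
    sumElim_dotProduct_sumElim, add_dotProduct, mulVec_transpose, ← dotProduct_mulVec]
  ring

lemma AuE_form (ul vl : l → ℝ) :
    S.AuE.mulVec ul ⬝ᵥ vl = S.All.mulVec ul ⬝ᵥ vl -
      S.Dbb⁻¹.mulVec (S.Abl.mulVec ul) ⬝ᵥ S.Abl.mulVec vl := by
  simp only [AuE, sub_mulVec, sub_dotProduct, ← mulVec_mulVec, mulVec_transpose,
    ← dotProduct_mulVec]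

lemma elimSystem_form (ul vl : l → ℝ) (p q : e → ℝ) (w r : f → ℝ) :
    S.elimSystem.mulVec (Sum.elim ul (Sum.elim p w)) ⬝ᵥ Sum.elim vl (Sum.elim q r) =
      S.AuE.mulVec ul ⬝ᵥ vl +
        S.alpha * (p ⬝ᵥ S.Bl.mulVec vl -
          S.Dbb⁻¹.mulVec (S.Bb.transpose.mulVec p) ⬝ᵥ S.Abl.mulVec vl) -
        S.alpha * (q ⬝ᵥ S.Bl.mulVec ul -
          S.Bb.transpose.mulVec q ⬝ᵥ S.Dbb⁻¹.mulVec (S.Abl.mulVec ul)) +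
        1 / S.M * (S.Mp.mulVec p ⬝ᵥ q) +
        S.alpha ^ 2 * (S.Dbb⁻¹.mulVec (S.Bb.transpose.mulVec p) ⬝ᵥ S.Bb.transpose.mulVec q) -
        S.tau * (q ⬝ᵥ S.Bw.mulVec w) +
        S.tau * (p ⬝ᵥ S.Bw.mulVec r) + S.tau * (S.Mw.mulVec w ⬝ᵥ r) := by
  have h1 : ∀ y, S.Bb.mulVec y ⬝ᵥ q = y ⬝ᵥ S.Bb.transpose.mulVec q := fun y => by
    rw [dotProduct_mulVec, vecMul_transpose]
  simp only [elimSystem, fromBlocks_mulVec, Sum.elim_comp_inl, Sum.elim_comp_inr,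
    fromCols_mulVec_sumElim, fromRows_mulVec, add_dotProduct, sub_dotProduct, add_mulVec,
    sub_mulVec, sumElim_dotProduct_sumElim, smul_mulVec, zero_mulVec, smul_dotProduct,
    smul_eq_mul, neg_mulVec, neg_dotProduct, neg_smul, add_zero, zero_dotProduct,
    ← mulVec_mulVec, h1, mulVec_transpose S.Bl, mulVec_transpose S.Bw,
    mulVec_transpose S.Abl, ← dotProduct_mulVec]
  rw [dotProduct_comm (S.Bl.mulVec ul) q, dotProduct_comm (S.Bw.mulVec w) q,
    dotProduct_comm (S.Dbb⁻¹.mulVec (S.Abl.mulVec ul)) (S.Bb.transpose.mulVec q)]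
  ring

lemma normE_form (ul : l → ℝ) (p : e → ℝ) (w : f → ℝ) :
    S.normE.mulVec (Sum.elim ul (Sum.elim p w)) ⬝ᵥ Sum.elim ul (Sum.elim p w) =
      S.AuE.mulVec ul ⬝ᵥ ul +
        S.alpha ^ 2 * (S.Dbb⁻¹.mulVec (S.Bb.transpose.mulVec p) ⬝ᵥ S.Bb.transpose.mulVec p) +
        (S.alpha ^ 2 / S.zeta ^ 2 + 1 / S.M) * (S.Mp.mulVec p ⬝ᵥ p) + S.Hw.mulVec w ⬝ᵥ w := by
  have h1 : ∀ y, S.Bb.mulVec y ⬝ᵥ p = y ⬝ᵥ S.Bb.transpose.mulVec p := fun y => by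
    rw [dotProduct_mulVec, vecMul_transpose]
  simp only [normE, fromBlocks_mulVec, Sum.elim_comp_inl, Sum.elim_comp_inr, add_dotProduct,
    add_mulVec, sumElim_dotProduct_sumElim, smul_mulVec, zero_mulVec, smul_dotProduct,
    smul_eq_mul, add_zero, zero_add, ← mulVec_mulVec, h1, cp, inv_inv]
  ring

end BlockData

lemma isSymm_of_form {ι : Type*} [Fintype ι] [DecidableEq ι] {H : Matrix ι ι ℝ}
    (h : ∀ x y, H.mulVec x ⬝ᵥ y = H.mulVec y ⬝ᵥ x) : H.IsSymm := by
  ext i j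
  have := h (Pi.single i 1) (Pi.single j 1)
  simpa using this

namespace BlockData

variable {b l e f : Type} [Fintype b] [Fintype l] [Fintype e] [Fintype f]
  [DecidableEq b] [DecidableEq l] [DecidableEq e] [DecidableEq f] {S : BlockData b l e f}

lemma B_elim (ub : b → ℝ) (ul : l → ℝ) :
    S.B.mulVec (Sum.elim ub ul) = S.Bb.mulVec ub + S.Bl.mulVec ul := by
  rw [B, fromCols_mulVec_sumElim]

/-! ### Definiteness of the blocks, and continuity of the lumped system -/

namespace Admissible

lemma weight_pos (h : S.Admissible) : 0 < S.alpha ^ 2 / S.zeta ^ 2 + 1 / S.M := by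
  have := h.alpha_pos
  have := h.M_pos
  have := h.zeta_pos
  positivity

lemma cp_pos (h : S.Admissible) : 0 < S.cp := inv_pos.2 h.weight_pos

/-- Together with `norm_form_pos` this lets each diagonal block inherit symmetry and definiteness by
inserting vectors supported in that block. -/
lemma norm_form_comm (h : S.Admissible) (u v : b ⊕ l → ℝ) (p q : e → ℝ) (w r : f → ℝ) :
    S.Au.mulVec u ⬝ᵥ v + (S.alpha ^ 2 / S.zeta ^ 2 + 1 / S.M) * (S.Mp.mulVec p ⬝ᵥ q) +
        S.Hw.mulVec w ⬝ᵥ r =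
      S.Au.mulVec v ⬝ᵥ u + (S.alpha ^ 2 / S.zeta ^ 2 + 1 / S.M) * (S.Mp.mulVec q ⬝ᵥ p) +
        S.Hw.mulVec r ⬝ᵥ w := by
  rw [← norm_form, ← norm_form]
  exact mulVec_dotProduct_comm (isSymm_of_posSemidef h.posDef.posSemidef) _ _

lemma norm_form_pos (h : S.Admissible) (u : b ⊕ l → ℝ) (p : e → ℝ) (w : f → ℝ)
    (hne : Sum.elim u (Sum.elim p w) ≠ 0) :
    0 < S.Au.mulVec u ⬝ᵥ u + (S.alpha ^ 2 / S.zeta ^ 2 + 1 / S.M) * (S.Mp.mulVec p ⬝ᵥ p) +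
        S.Hw.mulVec w ⬝ᵥ w := by
  rw [← norm_form]
  exact form_pos h.posDef hne

lemma Au_posDef (h : S.Admissible) : S.Au.PosDef := by
  refine posDef_of_form (isSymm_of_form fun u v => ?_) fun u hu => ?_
  · simpa using h.norm_form_comm u v 0 0 0 0
  · refine lt_of_lt_of_eq (h.norm_form_pos u 0 0 fun h0 => hu ?_) (by simp)
    funext i
    exact congr_fun h0 (Sum.inl i)

lemma Mp_posDef (h : S.Admissible) : S.Mp.PosDef := by
  have hw := h.weight_pos
  refine posDef_of_form (isSymm_of_form fun p q => ?_) fun p hp => ?_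
  · have := h.norm_form_comm 0 0 p q 0 0
    simp only [mulVec_zero, zero_dotProduct, zero_add, add_zero] at this
    exact mul_left_cancel₀ hw.ne' this
  · have := h.norm_form_pos 0 p 0 fun h0 => hp <| by
      funext i
      exact congr_fun h0 (Sum.inr (Sum.inl i))
    simp only [mulVec_zero, zero_dotProduct, zero_add, add_zero] at this
    exact pos_of_mul_pos_right this hw.le

lemma Hw_posDef (h : S.Admissible) : S.Hw.PosDef := by
  refine posDef_of_form (isSymm_of_form fun p q => ?_) fun p hp => ?_
  · simpa using h.norm_form_comm 0 0 0 0 p q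
  · refine lt_of_lt_of_eq (h.norm_form_pos 0 0 p fun h0 => hp ?_) (by simp)
    funext i
    exact congr_fun h0 (Sum.inr (Sum.inr i))

lemma AuD_form_ge (h : S.Admissible) (u : b ⊕ l → ℝ) :
    S.Au.mulVec u ⬝ᵥ u ≤ S.AuD.mulVec u ⬝ᵥ u := by
  rw [AuD_form]
  linarith [form_nonneg h.gap_psd (u ∘ Sum.inl)]

lemma AuD_posDef (h : S.Admissible) : S.AuD.PosDef := by
  refine posDef_of_form (isSymm_of_form fun u v => ?_) fun u hu => ?_
  · rw [AuD_form, AuD_form, mulVec_dotProduct_comm (isSymm_of_posSemidef h.gap_psd),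
      mulVec_dotProduct_comm (isSymm_of_posSemidef h.Au_posDef.posSemidef)]
  · exact (form_pos h.Au_posDef hu).trans_le (h.AuD_form_ge u)

lemma Dbb_posDef (h : S.Admissible) : S.Dbb.PosDef := by
  refine posDef_of_form (isSymm_of_form fun u v => ?_) fun u hu => ?_
  · have := mulVec_dotProduct_comm (isSymm_of_posSemidef h.AuD_posDef.posSemidef)
      (Sum.elim u 0) (Sum.elim v 0)
    simpa [AuD_elim_form] using this
  · have hne : Sum.elim u (0 : l → ℝ) ≠ 0 := fun h0 => hu <| by
      funext i
      exact congr_fun h0 (Sum.inl i)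
    have := form_pos h.AuD_posDef hne
    simpa [AuD_elim_form] using this

/-- Lumping changes the norm by the form of `D_bb - A_bb` on the bubble part; by `systemD_form` it
changes the system by the same form. -/
lemma normD_form (S : BlockData b l e f) (x y : (b ⊕ l) ⊕ (e ⊕ f) → ℝ) :
    (S.normWith S.AuD).mulVec x ⬝ᵥ y = (S.normWith S.Au).mulVec x ⬝ᵥ y +
      (S.Dbb - S.Abb).mulVec (x ∘ Sum.inl ∘ Sum.inl) ⬝ᵥ (y ∘ Sum.inl ∘ Sum.inl) := by
  obtain ⟨u, p, w, rfl⟩ := exists_eq_elim x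
  obtain ⟨v, q, r, rfl⟩ := exists_eq_elim y
  simp only [norm_form, AuD_form, ← Function.comp_assoc, Sum.elim_comp_inl]
  ring

lemma systemD_form (S : BlockData b l e f) (x y : (b ⊕ l) ⊕ (e ⊕ f) → ℝ) :
    (S.system S.AuD).mulVec x ⬝ᵥ y = (S.system S.Au).mulVec x ⬝ᵥ y +
      (S.Dbb - S.Abb).mulVec (x ∘ Sum.inl ∘ Sum.inl) ⬝ᵥ (y ∘ Sum.inl ∘ Sum.inl) := by
  obtain ⟨u, p, w, rfl⟩ := exists_eq_elim x
  obtain ⟨v, q, r, rfl⟩ := exists_eq_elim y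
  simp only [system_form, AuD_form, ← Function.comp_assoc, Sum.elim_comp_inl]
  ring

lemma normD_posDef (h : S.Admissible) : (S.normWith S.AuD).PosDef := by
  refine posDef_of_form (isSymm_of_form fun u v => ?_) fun u hu => ?_
  · rw [normD_form, normD_form, mulVec_dotProduct_comm (isSymm_of_posSemidef h.gap_psd),
      mulVec_dotProduct_comm (isSymm_of_posSemidef h.posDef.posSemidef)]
  · rw [normD_form]
    linarith [form_pos h.posDef hu, form_nonneg h.gap_psd (u ∘ Sum.inl ∘ Sum.inl)]

/-- Continuity survives the replacement of the bubble block with the same constant. -/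
lemma systemD_le [Nonempty b] (h : S.Admissible) {c : ℝ}
    (hc : supSup (S.system S.Au) (hNorm (S.normWith S.Au)) ≤ (c : EReal))
    (x y : (b ⊕ l) ⊕ (e ⊕ f) → ℝ) :
    (S.system S.AuD).mulVec x ⬝ᵥ y ≤
      c * (hNorm (S.normWith S.AuD) x * hNorm (S.normWith S.AuD) y) := by
  have hN : ∀ x, x ≠ 0 → 0 < hNorm (S.normWith S.Au) x := fun x hx => hNorm_pos h.posDef hx
  -- On pure displacements the system and the squared norm coincide, so the quotient at `(u, u)` is
  -- `1`. The vector of ones is nonzero because a bubble exists.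
  have hc1 : 1 ≤ c := by
    set u : b ⊕ l → ℝ := 1
    have hu : u ≠ 0 := fun h0 => by
      have := congr_fun h0 (Sum.inl (Classical.arbitrary b))
      simp [u] at this
    have hx : Sum.elim u (Sum.elim (0 : e → ℝ) (0 : f → ℝ)) ≠ 0 := fun h0 => hu <| by
      funext i
      exact congr_fun h0 (Sum.inl i)
    have h1 := le_of_supSup_le hN hc hx hx
    rw [← sq, hNorm_sq h.posDef.posSemidef, system_form, norm_form] at h1
    simp only [mulVec_zero, dotProduct_zero, zero_dotProduct, mul_zero, add_zero, sub_zero] at h1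
    have := form_pos h.Au_posDef hu
    nlinarith
  by_cases hx : x = 0
  · simp [hx, hNorm]
  by_cases hy : y = 0
  · simp [hy, hNorm]
  have h1 := le_of_supSup_le hN hc hx hy
  have h2 := (le_abs_self _).trans
    (abs_form_le h.gap_psd (x ∘ Sum.inl ∘ Sum.inl) (y ∘ Sum.inl ∘ Sum.inl))
  have hsq : ∀ z, hNorm (S.normWith S.AuD) z ^ 2 =
      hNorm (S.normWith S.Au) z ^ 2 + hNorm (S.Dbb - S.Abb) (z ∘ Sum.inl ∘ Sum.inl) ^ 2 :=
    fun z => by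
      rw [hNorm_sq h.normD_posDef.posSemidef, hNorm_sq h.posDef.posSemidef,
        hNorm_sq h.gap_psd, normD_form]
  have ex := hsq x
  have ey := hsq y
  have p1 := hNorm_nonneg (H := S.normWith S.Au) x
  have p2 := hNorm_nonneg (H := S.normWith S.Au) y
  have p3 := hNorm_nonneg (H := S.Dbb - S.Abb) (x ∘ Sum.inl ∘ Sum.inl)
  have p4 := hNorm_nonneg (H := S.Dbb - S.Abb) (y ∘ Sum.inl ∘ Sum.inl)
  have p5 := hNorm_nonneg (H := S.normWith S.AuD) x
  have p6 := hNorm_nonneg (H := S.normWith S.AuD) y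
  rw [systemD_form]
  generalize hNorm (S.normWith S.AuD) x = X at *
  generalize hNorm (S.normWith S.AuD) y = Y at *
  generalize hNorm (S.normWith S.Au) x = x1 at *
  generalize hNorm (S.normWith S.Au) y = y1 at *
  generalize hNorm (S.Dbb - S.Abb) (x ∘ Sum.inl ∘ Sum.inl) = x2 at *
  generalize hNorm (S.Dbb - S.Abb) (y ∘ Sum.inl ∘ Sum.inl) = y2 at *
  -- Cauchy-Schwarz in the plane, for the pairs of old norm and gap seminorm.
  have h3 : x1 * y1 + x2 * y2 ≤ X * Y := by
    refine abs_le_of_sq_le_sq' ?_ (mul_nonneg p5 p6) |>.2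
    rw [mul_pow, ex, ey]
    nlinarith [sq_nonneg (x1 * y2 - x2 * y1)]
  have h4 : x2 * y2 ≤ c * (x2 * y2) := le_mul_of_one_le_left (mul_nonneg p3 p4) hc1
  have h5 : c * (x1 * y1 + x2 * y2) ≤ c * (X * Y) := by gcongr
  linarith

end Admissible

/-! ### Lifting and elimination of the bubbles -/

/-- The bubble unknowns determined by the first row of the modified system. -/
def lift (S : BlockData b l e f) (ul : l → ℝ) (p : e → ℝ) : b → ℝ :=
  -(S.Dbb⁻¹.mulVec (S.Abl.mulVec ul + S.alpha • S.Bb.transpose.mulVec p))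

namespace Admissible

lemma Dbb_mulVec_inv (h : S.Admissible) (x : b → ℝ) : S.Dbb.mulVec (S.Dbb⁻¹.mulVec x) = x := by
  rw [mulVec_mulVec, mul_nonsing_inv _ ((isUnit_iff_isUnit_det _).1 h.Dbb_posDef.isUnit),
    one_mulVec]

lemma inv_form_comm (h : S.Admissible) (x y : b → ℝ) :
    S.Dbb⁻¹.mulVec x ⬝ᵥ y = S.Dbb⁻¹.mulVec y ⬝ᵥ x :=
  mulVec_dotProduct_comm (isSymm_of_posSemidef h.Dbb_posDef.inv.posSemidef) _ _

lemma dotProduct_Bb (S : BlockData b l e f) (q : e → ℝ) (y : b → ℝ) :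
    q ⬝ᵥ S.Bb.mulVec y = S.Bb.transpose.mulVec q ⬝ᵥ y := by
  rw [dotProduct_mulVec, mulVec_transpose]

/-- The bubble row vanishes on lifted vectors, so the bubble part `vb` of the test vector is
arbitrary; the other rows become those of the Schur complement. -/
lemma lift_system (h : S.Admissible) (ul vl : l → ℝ) (vb : b → ℝ) (p q : e → ℝ) (w r : f → ℝ) :
    (S.system S.AuD).mulVec (Sum.elim (Sum.elim (S.lift ul p) ul) (Sum.elim p w)) ⬝ᵥ
        Sum.elim (Sum.elim vb vl) (Sum.elim q r) =
      S.elimSystem.mulVec (Sum.elim ul (Sum.elim p w)) ⬝ᵥ Sum.elim vl (Sum.elim q r) := by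
  rw [system_form, elimSystem_form, AuD_elim_form, AuE_form, B_elim, B_elim]
  simp only [lift, mulVec_neg, h.Dbb_mulVec_inv, mulVec_add, dotProduct_add, add_dotProduct,
    neg_dotProduct, dotProduct_neg, smul_dotProduct, dotProduct_smul, mulVec_smul, smul_eq_mul,
    dotProduct_Bb]
  rw [dotProduct_comm (S.Bb.transpose.mulVec q) (S.Dbb⁻¹.mulVec (S.Bb.transpose.mulVec p))]
  ring

/-- With `s = A_bl u_l + α B_bᵀ p` the terms containing `u_b` sum to `(D_bb⁻¹ s, s) - 2 (D_bb⁻¹ s,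
A_bl u_l)`. Completing the square leaves `α² (D_bb⁻¹ B_bᵀ p, B_bᵀ p)` and the correction in `A_ll -
A_blᵀ D_bb⁻¹ A_bl`. -/
lemma lift_form (h : S.Admissible) (ul : l → ℝ) (p : e → ℝ) (w : f → ℝ) :
    (S.normWith S.AuD).mulVec (Sum.elim (Sum.elim (S.lift ul p) ul) (Sum.elim p w)) ⬝ᵥ
        Sum.elim (Sum.elim (S.lift ul p) ul) (Sum.elim p w) =
      S.normE.mulVec (Sum.elim ul (Sum.elim p w)) ⬝ᵥ Sum.elim ul (Sum.elim p w) := by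
  rw [norm_form, normE_form, AuD_elim_form, AuE_form]
  simp only [lift, mulVec_neg, h.Dbb_mulVec_inv, mulVec_add, dotProduct_add, add_dotProduct,
    neg_dotProduct, dotProduct_neg, smul_dotProduct, dotProduct_smul, mulVec_smul, smul_eq_mul]
  rw [dotProduct_comm (S.Abl.mulVec ul) (S.Dbb⁻¹.mulVec (S.Abl.mulVec ul)),
    dotProduct_comm (S.Abl.mulVec ul) (S.Dbb⁻¹.mulVec (S.Bb.transpose.mulVec p)),
    dotProduct_comm (S.Bb.transpose.mulVec p) (S.Dbb⁻¹.mulVec (S.Bb.transpose.mulVec p)),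
    dotProduct_comm (S.Bb.transpose.mulVec p) (S.Dbb⁻¹.mulVec (S.Abl.mulVec ul)),
    h.inv_form_comm (S.Abl.mulVec ul) (S.Bb.transpose.mulVec p)]
  ring

lemma lift_norm (h : S.Admissible) (ul : l → ℝ) (p : e → ℝ) (w : f → ℝ) :
    hNorm (S.normWith S.AuD) (Sum.elim (Sum.elim (S.lift ul p) ul) (Sum.elim p w)) =
      hNorm S.normE (Sum.elim ul (Sum.elim p w)) := by
  rw [hNorm, hNorm, h.lift_form]

lemma normE_pos (h : S.Admissible) {x : l ⊕ (e ⊕ f) → ℝ} (hx : x ≠ 0) : 0 < hNorm S.normE x := by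
  obtain ⟨ul, p, w, rfl⟩ := exists_eq_elim x
  rw [← h.lift_norm]
  refine hNorm_pos h.normD_posDef fun h0 => hx ?_
  funext i
  rcases i with i | i
  · exact congr_fun h0 (Sum.inl (Sum.inr i))
  · exact congr_fun h0 (Sum.inr i)

lemma div_bound_AuD (h : S.Admissible) (q : e → ℝ) (u : b ⊕ l → ℝ) :
    (q ⬝ᵥ S.B.mulVec u) ^ 2 * S.zeta ^ 2 ≤ (S.Mp.mulVec q ⬝ᵥ q) * (S.AuD.mulVec u ⬝ᵥ u) :=
  (h.div_bound q u).trans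
    (mul_le_mul_of_nonneg_left (h.AuD_form_ge u) (form_nonneg h.Mp_posDef.posSemidef q))

/-- The bubble field `D_bb⁻¹ B_bᵀ q` has lumped energy equal to its pairing with `q`. The divergence
bound for it reads `X² ζ² ≤ (M_p q, q) X`, and `X` cancels. -/
lemma inv_form_le (h : S.Admissible) (q : e → ℝ) :
    (S.Dbb⁻¹.mulVec (S.Bb.transpose.mulVec q) ⬝ᵥ S.Bb.transpose.mulVec q) * S.zeta ^ 2 ≤
      S.Mp.mulVec q ⬝ᵥ q := by
  have h1 := h.div_bound_AuD q (Sum.elim (S.Dbb⁻¹.mulVec (S.Bb.transpose.mulVec q)) 0)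
  rw [B_elim, AuD_elim_form, mulVec_zero, mulVec_zero, mulVec_zero, add_zero, dotProduct_Bb,
    h.Dbb_mulVec_inv, zero_dotProduct, dotProduct_zero, zero_dotProduct,
    dotProduct_comm (S.Bb.transpose.mulVec q), add_zero, add_zero, add_zero] at h1
  have h2 := form_nonneg h.Dbb_posDef.inv.posSemidef (S.Bb.transpose.mulVec q)
  have h3 := form_nonneg h.Mp_posDef.posSemidef q
  rcases h2.eq_or_lt with h0 | h0
  · rw [← h0, zero_mul]
    exact h3
  · refine le_of_mul_le_mul_right ?_ h0
    nlinarith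

/-- The Schur complement is the minimum of the displacement form over the bubble part, and by
`inv_form_le` the extra pressure term is at most `α²/ζ²` times the pressure mass form, which `𝒟`
already contains. -/
lemma normE_le (h : S.Admissible) (vb : b → ℝ) (vl : l → ℝ) (q : e → ℝ) (r : f → ℝ) :
    hNorm S.normE (Sum.elim vl (Sum.elim q r)) ^ 2 ≤
      2 * hNorm (S.normWith S.AuD) (Sum.elim (Sum.elim vb vl) (Sum.elim q r)) ^ 2 := by
  rw [← h.lift_norm vl q r, hNorm_sq h.normD_posDef.posSemidef, h.lift_form,
    hNorm_sq h.normD_posDef.posSemidef, norm_form, normE_form, AuD_elim_form, AuE_form]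
  have h1 := form_nonneg h.Dbb_posDef.posSemidef (vb + S.Dbb⁻¹.mulVec (S.Abl.mulVec vl))
  simp only [mulVec_add, dotProduct_add, add_dotProduct, h.Dbb_mulVec_inv] at h1
  have h2 : S.Dbb.mulVec vb ⬝ᵥ S.Dbb⁻¹.mulVec (S.Abl.mulVec vl) = S.Abl.mulVec vl ⬝ᵥ vb := by
    rw [mulVec_dotProduct_comm (isSymm_of_posSemidef h.Dbb_posDef.posSemidef), h.Dbb_mulVec_inv]
  rw [h2, dotProduct_comm (S.Abl.mulVec vl) (S.Dbb⁻¹.mulVec (S.Abl.mulVec vl))] at h1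
  rw [dotProduct_comm vb]
  have h3 := h.inv_form_le q
  have h4 := form_nonneg h.Hw_posDef.posSemidef r
  have h5 := form_nonneg h.Mp_posDef.posSemidef q
  have hz := pow_pos h.zeta_pos 2
  have h6 : S.alpha ^ 2 * (S.Dbb⁻¹.mulVec (S.Bb.transpose.mulVec q) ⬝ᵥ
      S.Bb.transpose.mulVec q) ≤ S.alpha ^ 2 / S.zeta ^ 2 * (S.Mp.mulVec q ⬝ᵥ q) := by
    rw [div_mul_eq_mul_div, le_div_iff₀ hz, mul_assoc]
    exact mul_le_mul_of_nonneg_left h3 (sq_nonneg _)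
  have h7 : 0 ≤ 1 / S.M * (S.Mp.mulVec q ⬝ᵥ q) := by
    have := h.M_pos
    positivity
  have h8 := form_nonneg h.AuD_posDef.posSemidef (Sum.elim vb vl)
  rw [AuD_elim_form, dotProduct_comm vb] at h8
  linarith

/-- The inf-sup condition passes from the modified to the eliminated system. -/
theorem elim_infSup (h : S.Admissible) {γ : ℝ} (hγ : 0 < γ)
    (hD : (γ : EReal) ≤ infSupTest (S.system S.AuD) (hNorm (S.normWith S.AuD))) :
    ((γ / 16 : ℝ) : EReal) ≤ infSupTrial S.elimSystem (hNorm S.normE) := by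
  refine le_infSupTrial (fun x hx => h.normE_pos hx) fun x hx => ?_
  have hxpos := h.normE_pos hx
  obtain ⟨ul, p, w, rfl⟩ := exists_eq_elim x
  rw [← h.lift_norm] at hxpos
  have hx' : Sum.elim (Sum.elim (S.lift ul p) ul) (Sum.elim p w) ≠ 0 := fun h0 => by
    simp [h0, hNorm] at hxpos
  obtain ⟨y, hy, hxy⟩ := exists_test_of_infSupTest h.normD_posDef hγ hD hx'
  have hypos := hNorm_pos h.normD_posDef hy
  obtain ⟨v, q, r, rfl⟩ := exists_eq_elim y
  obtain ⟨vb, vl, rfl⟩ : ∃ ub ul, v = Sum.elim ub ul := ⟨v ∘ Sum.inl, v ∘ Sum.inr, by simp⟩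
  rw [h.lift_system] at hxy
  have hle := h.normE_le vb vl q r
  -- The test vector without its bubbles; if it vanished, so would the pairing, which is positive.
  refine ⟨Sum.elim vl (Sum.elim q r), fun h0 => ?_, ?_⟩
  · rw [h0, dotProduct_zero] at hxy
    exact absurd hxy (not_le.2 (by positivity))
  · rw [← h.lift_norm ul]
    refine le_trans ?_ hxy
    -- The factor `√2` from `normE_le` would do; `16` is a crude bound for it.
    have : hNorm S.normE (Sum.elim vl (Sum.elim q r)) ≤
        16 * hNorm (S.normWith S.AuD) (Sum.elim (Sum.elim vb vl) (Sum.elim q r)) := by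
      refine le_of_sq_le_sq ?_ (by positivity)
      nlinarith [sq_nonneg (hNorm (S.normWith S.AuD) (Sum.elim (Sum.elim vb vl) (Sum.elim q r)))]
    calc _ = γ / 16 * hNorm (S.normWith S.AuD) (Sum.elim (Sum.elim (S.lift ul p) ul)
            (Sum.elim p w)) * hNorm S.normE (Sum.elim vl (Sum.elim q r)) := by ring
      _ ≤ γ / 16 * hNorm (S.normWith S.AuD) (Sum.elim (Sum.elim (S.lift ul p) ul)
            (Sum.elim p w)) * (16 * hNorm (S.normWith S.AuD) (Sum.elim (Sum.elim vb vl)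
            (Sum.elim q r))) := by gcongr
      _ = _ := by ring

/-- Continuity passes from the full to the eliminated system with the same constant. -/
theorem elim_continuous [Nonempty b] (h : S.Admissible) {c : ℝ}
    (hc : supSup (S.system S.Au) (hNorm (S.normWith S.Au)) ≤ (c : EReal)) :
    supSup S.elimSystem (hNorm S.normE) ≤ (c : EReal) := by
  refine supSup_le (fun x hx => h.normE_pos hx) fun x y => ?_
  obtain ⟨ul, p, w, rfl⟩ := exists_eq_elim x
  obtain ⟨vl, q, r, rfl⟩ := exists_eq_elim y
  rw [← h.lift_norm, ← h.lift_norm, ← h.lift_system ul vl (S.lift vl q)]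
  exact h.systemD_le hc _ _

/-- Testing with the vector itself leaves `u = 0`, `p = 0` and zero flux energy. As `M_w` is only
semidefinite here, the pressure row is also tested with `B_w w`: this gives `B_w w = 0`, and
definiteness of the weighted flux block gives `w = 0`. -/
lemma eq_zero_of_systemD_eq_zero (h : S.Admissible) {x : (b ⊕ l) ⊕ (e ⊕ f) → ℝ}
    (hx : (S.system S.AuD).mulVec x = 0) : x = 0 := by
  obtain ⟨u, p, w, rfl⟩ := exists_eq_elim x
  have hM := h.M_pos
  have hτ := h.tau_pos
  have key : ∀ v q r, (S.system S.AuD).mulVec (Sum.elim u (Sum.elim p w)) ⬝ᵥ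
      Sum.elim v (Sum.elim q r) = 0 := fun v q r => by rw [hx, zero_dotProduct]
  have h1 := key u p w
  rw [system_form] at h1
  have hu := form_nonneg h.AuD_posDef.posSemidef u
  have hp := form_nonneg h.Mp_posDef.posSemidef p
  have hw := form_nonneg h.Mw_psd w
  have hp' : 0 ≤ 1 / S.M * (S.Mp.mulVec p ⬝ᵥ p) := by positivity
  have hw' : 0 ≤ S.tau * (S.Mw.mulVec w ⬝ᵥ w) := by positivity
  have hu0 : u = 0 := by
    by_contra hne
    linarith [form_pos h.AuD_posDef hne]
  have hp0 : p = 0 := by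
    by_contra hne
    have := mul_pos (one_div_pos.2 hM) (form_pos h.Mp_posDef hne)
    linarith
  subst hu0 hp0
  have hw0 : S.Mw.mulVec w ⬝ᵥ w = 0 := by
    have : S.tau * (S.Mw.mulVec w ⬝ᵥ w) = 0 := by simpa using h1
    simpa [hτ.ne'] using this
  have hB : S.Bw.mulVec w = 0 := by
    have h2 := key 0 (S.Bw.mulVec w) 0
    rw [system_form] at h2
    simpa [hτ.ne'] using h2
  have : w = 0 := by
    by_contra hne
    have := form_pos h.Hw_posDef hne
    rw [Hw_form, hB, hw0] at this
    simp at this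
  subst this
  ext (i | i | i) <;> rfl

/-- The modified system satisfies some inf-sup condition. -/
theorem exists_diag_infSup (h : S.Admissible) :
    ∃ γ : ℝ, 0 < γ ∧ (γ : EReal) ≤ infSupTest (S.system S.AuD) (hNorm (S.normWith S.AuD)) :=
  exists_le_infSupTest h.normD_posDef fun _ hx => h.eq_zero_of_systemD_eq_zero hx

end Admissible

end BlockData

/-! ### Explicit inf-sup constant of the lumped system -/

lemma form_add_le {ι : Type*} [Fintype ι] {H : Matrix ι ι ℝ} (hH : H.PosSemidef) (x y : ι → ℝ) :
    H.mulVec (x + y) ⬝ᵥ (x + y) ≤ 2 * (H.mulVec x ⬝ᵥ x) + 2 * (H.mulVec y ⬝ᵥ y) := by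
  have h := form_nonneg hH (x - y)
  simp only [mulVec_add, mulVec_sub, dotProduct_add, add_dotProduct, sub_dotProduct,
    dotProduct_sub] at h ⊢
  linarith

/-- Young's inequality for a product known only through its square. -/
lemma neg_le_of_sq_le {X A B s : ℝ} (h : X ^ 2 ≤ A * B) (hA : 0 ≤ A) (hB : 0 ≤ B) (hs : 0 < s) :
    -(s * A + B / (4 * s)) ≤ X := by
  have h1 : X ^ 2 ≤ (s * A + B / (4 * s)) ^ 2 := by
    have : (s * A + B / (4 * s)) ^ 2 = (s * A - B / (4 * s)) ^ 2 + A * B := by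
      field_simp
      ring
    rw [this]
    nlinarith [sq_nonneg (s * A - B / (4 * s))]
  exact (abs_le_of_sq_le_sq' h1 (by positivity)).1

namespace BlockData.Admissible

variable {b l e f : Type} [Fintype b] [Fintype l] [Fintype e] [Fintype f]
  [DecidableEq b] [DecidableEq l] [DecidableEq e] [DecidableEq f] {S : BlockData b l e f}

set_option maxHeartbeats 800000 in
/-- The modified system inherits its inf-sup constant from the divergence pairing. -/
theorem diag_infSup (h : S.Admissible) {β : ℝ} (hβ : 0 < β) (hβ1 : β ≤ 1)
    (hdiv : ∀ q : e → ℝ, ∃ u, β * (S.Mp.mulVec q ⬝ᵥ q) ≤ -(q ⬝ᵥ S.B.mulVec u) ∧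
      S.AuD.mulVec u ⬝ᵥ u ≤ S.zeta ^ 2 * (S.Mp.mulVec q ⬝ᵥ q)) :
    ((β ^ 2 / 8 : ℝ) : EReal) ≤ infSupTest (S.system S.AuD) (hNorm (S.normWith S.AuD)) := by
  refine le_infSupTest (fun x hx => hNorm_pos h.normD_posDef hx) fun y hy => ?_
  have hypos := form_pos h.normD_posDef hy
  have hyN := hNorm_sq h.normD_posDef.posSemidef y
  have hypos' := hNorm_pos h.normD_posDef hy
  obtain ⟨v, q, r, rfl⟩ := exists_eq_elim y
  obtain ⟨u₀, hu₀, hu₀'⟩ := hdiv q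
  have hα := h.alpha_pos
  have hM := h.M_pos
  have hτ := h.tau_pos
  have hζ := h.zeta_pos
  have hcp := h.cp_pos
  have hc : S.alpha ^ 2 / S.zeta ^ 2 + 1 / S.M = S.cp⁻¹ := (inv_inv _).symm
  have hMp := h.Mp_posDef
  -- Two correctors: `u`, of lumped energy at most `a`, recovers the `α²/ζ²` part of the pressure
  -- norm, and `p = τ c_p M_p⁻¹ B_w r` recovers the divergence part `w` of the flux norm.
  set u := (S.alpha / S.zeta ^ 2) • u₀ with hu
  set g := S.Mp⁻¹.mulVec (S.Bw.mulVec r) with hg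
  set p := (S.tau * S.cp) • g with hp
  have hMg : S.Mp.mulVec g = S.Bw.mulVec r := by
    rw [hg, mulVec_mulVec, mul_nonsing_inv _ ((isUnit_iff_isUnit_det _).1 hMp.isUnit), one_mulVec]
  set Q := S.Mp.mulVec q ⬝ᵥ q with hQ
  set V := S.AuD.mulVec v ⬝ᵥ v with hV
  set t := S.Mw.mulVec r ⬝ᵥ r with ht
  set G := g ⬝ᵥ S.Bw.mulVec r with hG
  set a := S.alpha ^ 2 / S.zeta ^ 2 * Q with ha
  set w := S.tau ^ 2 * S.cp * G with hw
  have hQ0 : 0 ≤ Q := form_nonneg hMp.posSemidef q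
  have hV0 : 0 ≤ V := form_nonneg h.AuD_posDef.posSemidef v
  have ht0 : 0 ≤ S.tau * t := mul_nonneg hτ.le (form_nonneg h.Mw_psd r)
  have hG0 : 0 ≤ G := by
    have := form_nonneg hMp.posSemidef g
    rwa [hMg, dotProduct_comm] at this
  have ha0 : 0 ≤ a := by positivity
  have hw0 : 0 ≤ w := by positivity
  have hQM : 0 ≤ Q / S.M := by positivity
  -- Both parts of the weight are at most `c_p⁻¹`; this bounds the cross terms of `p` uniformly in
  -- the parameters.
  have hcpM : S.cp / S.M ≤ 1 := by
    have : S.cp * (S.alpha ^ 2 / S.zeta ^ 2 + 1 / S.M) = 1 := by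
      rw [hc, mul_inv_cancel₀ hcp.ne']
    have h2 : 0 ≤ S.cp * (S.alpha ^ 2 / S.zeta ^ 2) := by positivity
    rw [div_eq_mul_one_div]
    linarith
  have hcpζ : S.cp * (S.alpha ^ 2 / S.zeta ^ 2) ≤ 1 := by
    have : S.cp * (S.alpha ^ 2 / S.zeta ^ 2 + 1 / S.M) = 1 := by
      rw [hc, mul_inv_cancel₀ hcp.ne']
    have h2 : 0 ≤ S.cp * (1 / S.M) := by positivity
    linarith
  have hpp : S.Mp.mulVec p ⬝ᵥ p = S.cp * w := by
    rw [hp, mulVec_smul, smul_dotProduct, dotProduct_smul, hMg, smul_eq_mul, smul_eq_mul,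
      dotProduct_comm]
    ring
  have hpr : S.tau * (p ⬝ᵥ S.Bw.mulVec r) = w := by
    rw [hp, smul_dotProduct, smul_eq_mul]
    ring
  have huu : S.AuD.mulVec u ⬝ᵥ u ≤ a := by
    rw [hu, mulVec_smul, smul_dotProduct, dotProduct_smul, smul_eq_mul, smul_eq_mul, ha]
    calc _ = (S.alpha / S.zeta ^ 2) ^ 2 * (S.AuD.mulVec u₀ ⬝ᵥ u₀) := by ring
      _ ≤ (S.alpha / S.zeta ^ 2) ^ 2 * (S.zeta ^ 2 * Q) := by gcongr
      _ = _ := by field_simp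
  have huq : β * a ≤ -(S.alpha * (q ⬝ᵥ S.B.mulVec u)) := by
    rw [hu, mulVec_smul, dotProduct_smul, smul_eq_mul, ha]
    calc _ = S.alpha ^ 2 / S.zeta ^ 2 * (β * Q) := by ring
      _ ≤ S.alpha ^ 2 / S.zeta ^ 2 * (-(q ⬝ᵥ S.B.mulVec u₀)) := by gcongr
      _ = _ := by ring
  have huv : (S.AuD.mulVec u ⬝ᵥ v) ^ 2 ≤ a * V :=
    (form_sq_le h.AuD_posDef.posSemidef u v).trans (by gcongr)
  have hpv : (S.alpha * (p ⬝ᵥ S.B.mulVec v)) ^ 2 ≤ w * V := by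
    have h1 := h.div_bound_AuD p v
    rw [hpp] at h1
    have h2 : (p ⬝ᵥ S.B.mulVec v) ^ 2 ≤ S.cp * w * V / S.zeta ^ 2 := by
      rwa [le_div_iff₀ (by positivity)]
    calc _ = S.alpha ^ 2 * (p ⬝ᵥ S.B.mulVec v) ^ 2 := by ring
      _ ≤ S.alpha ^ 2 * (S.cp * w * V / S.zeta ^ 2) := by gcongr
      _ = S.cp * (S.alpha ^ 2 / S.zeta ^ 2) * (w * V) := by ring
      _ ≤ 1 * (w * V) := by gcongr
      _ = _ := one_mul _
  have hpq : (1 / S.M * (S.Mp.mulVec p ⬝ᵥ q)) ^ 2 ≤ w * (Q / S.M) := by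
    have h1 := form_sq_le hMp.posSemidef p q
    rw [hpp] at h1
    calc _ = (1 / S.M) ^ 2 * (S.Mp.mulVec p ⬝ᵥ q) ^ 2 := by ring
      _ ≤ (1 / S.M) ^ 2 * (S.cp * w * Q) := by gcongr
      _ = S.cp / S.M * (w * (Q / S.M)) := by ring
      _ ≤ 1 * (w * (Q / S.M)) := by gcongr
      _ = _ := one_mul _
  have hform : (S.normWith S.AuD).mulVec (Sum.elim v (Sum.elim q r)) ⬝ᵥ
      Sum.elim v (Sum.elim q r) = V + a + Q / S.M + (S.tau * t + w) := by
    rw [norm_form, Hw_form]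
    ring
  rw [hform] at hypos hyN
  -- With the factors `β/2` and `1/2` on the correctors, Young's inequality leaves at least `V/4`,
  -- `β² a/4`, `Q/(2M)`, `w/4` and `τ t`; `β ≤ 1` makes `β²/4` a common lower factor.
  have hlow : β ^ 2 / 4 * (V + a + Q / S.M + (S.tau * t + w)) ≤
      (S.system S.AuD).mulVec (Sum.elim (v + (β / 2) • u) (Sum.elim (q + (1 / 2 : ℝ) • p) r)) ⬝ᵥ
        Sum.elim v (Sum.elim q r) := by
    rw [system_form]
    simp only [mulVec_add, add_dotProduct, dotProduct_add, mulVec_smul, smul_dotProduct,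
      dotProduct_smul, smul_eq_mul]
    have e1 := neg_le_of_sq_le huv ha0 hV0 (half_pos hβ)
    have e2 := neg_le_of_sq_le hpv hw0 hV0 (by norm_num : (0 : ℝ) < 1 / 4)
    have e3 := neg_le_of_sq_le hpq hw0 hQM (by norm_num : (0 : ℝ) < 1 / 4)
    have e4 : β / 2 * -(β / 2 * a + V / (4 * (β / 2))) = -(β ^ 2 / 4 * a + V / 4) := by
      field_simp
      ring
    have e5 := mul_le_mul_of_nonneg_left e1 (half_pos hβ).le
    have e6 := mul_le_mul_of_nonneg_left huq (half_pos hβ).le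
    rw [e4] at e5
    have hβ2 : β ^ 2 ≤ 1 := pow_le_one₀ hβ.le hβ1
    have f1 : β ^ 2 / 4 * V ≤ 1 / 4 * V := by gcongr
    have f2 : β ^ 2 / 4 * (Q / S.M) ≤ 1 / 4 * (Q / S.M) := by gcongr
    have f3 : β ^ 2 / 4 * (S.tau * t) ≤ 1 / 4 * (S.tau * t) := by gcongr
    have f4 : β ^ 2 / 4 * w ≤ 1 / 4 * w := by gcongr
    have f5 : 1 / S.M * Q = Q / S.M := by ring
    linarith
  have hup : hNorm (S.normWith S.AuD)
      (Sum.elim (v + (β / 2) • u) (Sum.elim (q + (1 / 2 : ℝ) • p) r)) ≤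
      2 * hNorm (S.normWith S.AuD) (Sum.elim v (Sum.elim q r)) := by
    refine le_of_sq_le_sq ?_ (by positivity)
    rw [mul_pow, hyN, hNorm_sq h.normD_posDef.posSemidef, norm_form, Hw_form, hc]
    have e1 := form_add_le h.AuD_posDef.posSemidef v ((β / 2) • u)
    have e2 := form_add_le hMp.posSemidef q ((1 / 2 : ℝ) • p)
    simp only [mulVec_smul, smul_dotProduct, dotProduct_smul, smul_eq_mul, hpp] at e1 e2
    have e3 : β / 2 * (β / 2 * (S.AuD.mulVec u ⬝ᵥ u)) ≤ 1 / 4 * a := by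
      have : β / 2 * (β / 2) ≤ 1 / 4 := by nlinarith
      calc _ = β / 2 * (β / 2) * (S.AuD.mulVec u ⬝ᵥ u) := by ring
        _ ≤ 1 / 4 * a := mul_le_mul this huu
            (form_nonneg h.AuD_posDef.posSemidef u) (by norm_num)
    have e4 := mul_le_mul_of_nonneg_left e2 (inv_pos.2 hcp).le
    have e5 : S.cp⁻¹ * (2 * Q + 2 * (1 / 2 * (1 / 2 * (S.cp * w)))) =
        2 * (a + Q / S.M) + w / 2 := by
      have : S.cp⁻¹ * Q = a + Q / S.M := by
        rw [← hc, ha]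
        ring
      linear_combination 2 * this + w / 2 * inv_mul_cancel₀ hcp.ne'
    rw [e5] at e4
    linarith
  generalize Sum.elim (v + (β / 2) • u) (Sum.elim (q + (1 / 2 : ℝ) • p) r) = x at hlow hup
  refine ⟨x, fun h0 => ?_, ?_⟩
  · rw [h0, mulVec_zero, zero_dotProduct] at hlow
    exact absurd hlow (not_le.2 (by positivity))
  · refine le_trans ?_ hlow
    rw [← hyN]
    calc β ^ 2 / 8 * (_ * hNorm (S.normWith S.AuD) (Sum.elim v (Sum.elim q r)))
        ≤ β ^ 2 / 8 * (2 * hNorm (S.normWith S.AuD) (Sum.elim v (Sum.elim q r)) *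
          hNorm (S.normWith S.AuD) (Sum.elim v (Sum.elim q r))) := by gcongr
      _ = _ := by ring

end BlockData.Admissible

/-! ### Piecewise smooth fields -/

lemma contDiff_affineMap {d : ℕ} {n : WithTop ℕ∞} (f : E d →ᵃ[ℝ] ℝ) : ContDiff ℝ n f :=
  ContinuousAffineMap.contDiff ⟨f, f.continuous_of_finiteDimensional⟩

lemma continuous_strain {d : ℕ} {v : E d → E d} (hv : ContDiff ℝ 1 v) (i j : Fin d) :
    Continuous fun x => strain v x i j := by
  have h := hv.continuous_fderiv one_ne_zero
  simp only [strain, Matrix.of_apply]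
  fun_prop

lemma continuous_divergence {d : ℕ} {v : E d → E d} (hv : ContDiff ℝ 1 v) :
    Continuous fun x => divergence v x := by
  have h := hv.continuous_fderiv one_ne_zero
  simp only [divergence]
  fun_prop

lemma strain_sum {d : ℕ} {ι : Type*} [Fintype ι] {φ : ι → E d → E d}
    (hφ : ∀ k, ContDiff ℝ 1 (φ k)) (c : ι → ℝ) (x : E d) (i j : Fin d) :
    strain (fun y => ∑ k, c k • φ k y) x i j = ∑ k, c k * strain (φ k) x i j := by
  have hd : ∀ k, DifferentiableAt ℝ (φ k) x := fun k =>
    (hφ k).differentiable one_ne_zero x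
  have h : fderiv ℝ (fun y => ∑ k, c k • φ k y) x = ∑ k, c k • fderiv ℝ (φ k) x := by
    rw [fderiv_fun_sum (A := fun k y => c k • φ k y) fun k _ => (hd k).const_smul (c k)]
    exact Finset.sum_congr rfl fun k _ => fderiv_fun_const_smul (hd k) (c k)
  simp only [strain, Matrix.of_apply, h, _root_.sum_apply,
    _root_.smul_apply, WithLp.ofLp_sum, WithLp.ofLp_smul, Finset.sum_apply,
    Pi.smul_apply, smul_eq_mul, ← Finset.sum_add_distrib, Finset.sum_div]
  exact Finset.sum_congr rfl fun k _ => by ring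

lemma divergence_eq_sum_strain {d : ℕ} (v : E d → E d) (x : E d) :
    divergence v x = ∑ i, strain v x i i := by
  simp [divergence, strain]

lemma divergence_sum {d : ℕ} {ι : Type*} [Fintype ι] {φ : ι → E d → E d}
    (hφ : ∀ k, ContDiff ℝ 1 (φ k)) (c : ι → ℝ) (x : E d) :
    divergence (fun y => ∑ k, c k • φ k y) x = ∑ k, c k * divergence (φ k) x := by
  simp only [divergence_eq_sum_strain, strain_sum hφ, Finset.mul_sum]
  exact Finset.sum_comm

/-- The squared Frobenius norm of the strain. -/
def strainSq {d : ℕ} (v : E d → E d) (x : E d) : ℝ := ∑ i, ∑ j, strain v x i j ^ 2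

lemma strainSq_nonneg {d : ℕ} (v : E d → E d) (x : E d) : 0 ≤ strainSq v x :=
  Finset.sum_nonneg fun _ _ => Finset.sum_nonneg fun _ _ => sq_nonneg _

lemma continuous_strainSq {d : ℕ} {v : E d → E d} (hv : ContDiff ℝ 1 v) :
    Continuous (strainSq v) :=
  continuous_finsetSum _ fun i _ => continuous_finsetSum _ fun j _ =>
    (continuous_strain hv i j).pow 2

lemma divergence_sq_le {d : ℕ} (v : E d → E d) (x : E d) :
    divergence v x ^ 2 ≤ d * strainSq v x := by
  rw [divergence_eq_sum_strain, strainSq]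
  refine sq_sum_le_card_mul_sum_sq.trans ?_
  rw [Finset.card_univ, Fintype.card_fin]
  gcongr with i
  exact Finset.single_le_sum (f := fun j => strain v x i j ^ 2) (fun j _ => sq_nonneg _)
    (Finset.mem_univ i)

/-- The elastic energy density. -/
def density {d : ℕ} (P : Params) (u v : E d → E d) (x : E d) : ℝ :=
  2 * P.mu * ∑ i, ∑ j, strain u x i j * strain v x i j +
      P.lam * (divergence u x * divergence v x)

lemma density_self {d : ℕ} (P : Params) (u : E d → E d) (x : E d) :
    density P u u x = 2 * P.mu * strainSq u x + P.lam * divergence u x ^ 2 := by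
  simp only [density, strainSq, sq]

lemma continuous_density {d : ℕ} (P : Params) {u v : E d → E d} (hu : ContDiff ℝ 1 u)
    (hv : ContDiff ℝ 1 v) : Continuous (density P u v) :=
  (continuous_const.mul (continuous_finsetSum _ fun i _ => continuous_finsetSum _ fun j _ =>
    (continuous_strain hu i j).mul (continuous_strain hv i j))).add
    (continuous_const.mul ((continuous_divergence hu).mul (continuous_divergence hv)))

lemma density_sum {d : ℕ} (P : Params) {ι : Type*} [Fintype ι] {φ : ι → E d → E d}
    (hφ : ∀ k, ContDiff ℝ 1 (φ k)) (c c' : ι → ℝ) (x : E d) :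
    density P (fun y => ∑ k, c k • φ k y) (fun y => ∑ k, c' k • φ k y) x =
      ∑ k, ∑ l, c k * c' l * density P (φ k) (φ l) x := by
  simp only [density, strain_sum hφ, divergence_sum hφ, Finset.sum_mul_sum]
  simp only [mul_add, Finset.sum_add_distrib, Finset.mul_sum]
  congr 1
  · calc _ = ∑ i, ∑ k, ∑ j, ∑ l, 2 * P.mu * (c k * strain (φ k) x i j *
          (c' l * strain (φ l) x i j)) :=
        Finset.sum_congr rfl fun i _ => Finset.sum_comm
      _ = ∑ k, ∑ i, ∑ l, ∑ j, 2 * P.mu * (c k * strain (φ k) x i j *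
          (c' l * strain (φ l) x i j)) := by
        rw [Finset.sum_comm]
        exact Finset.sum_congr rfl fun k _ => Finset.sum_congr rfl fun i _ => Finset.sum_comm
      _ = ∑ k, ∑ l, ∑ i, ∑ j, 2 * P.mu * (c k * strain (φ k) x i j *
          (c' l * strain (φ l) x i j)) :=
        Finset.sum_congr rfl fun k _ => Finset.sum_comm
      _ = _ := by
        refine Finset.sum_congr rfl fun k _ => Finset.sum_congr rfl fun l _ =>
          Finset.sum_congr rfl fun i _ => Finset.sum_congr rfl fun j _ => by ring
  · exact Finset.sum_congr rfl fun k _ => Finset.sum_congr rfl fun l _ => by ring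

lemma density_comm {d : ℕ} (P : Params) (u v : E d → E d) (x : E d) :
    density P u v x = density P v u x := by
  simp only [density, mul_comm]

lemma Params.zeta_sq {d : ℕ} (hd : d ≠ 0) (P : Params) : P.zeta d ^ 2 = P.lam + 2 * P.mu / d := by
  have := P.lam_nonneg
  have := P.mu_pos
  exact Real.sq_sqrt (by positivity)

lemma Params.zeta_pos {d : ℕ} (hd : d ≠ 0) (P : Params) : 0 < P.zeta d := by
  have := P.lam_nonneg
  have := P.mu_pos
  have : (0 : ℝ) < d := by positivity
  exact Real.sqrt_pos.2 (by positivity)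

/-- This explains the weight `ζ² = λ + 2μ/d`: the `λ` part is exact, and `(div u)² ≤ d |ε(u)|²` lets
the shear energy pay for `(2μ/d) (div u)²`. -/
lemma divergence_sq_le_density {d : ℕ} (hd : d ≠ 0) (P : Params) (u : E d → E d) (x : E d) :
    P.zeta d ^ 2 * divergence u x ^ 2 ≤ density P u u x := by
  rw [P.zeta_sq hd, density_self]
  have h := divergence_sq_le u x
  have hd' : (0 : ℝ) < d := by positivity
  have hμ := P.mu_pos
  have : 2 * P.mu / d * divergence u x ^ 2 ≤ 2 * P.mu / d * (d * strainSq u x) := by gcongr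
  have e : 2 * P.mu / d * (d * strainSq u x) = 2 * P.mu * strainSq u x := by field_simp
  linarith

/-- An upper bound with the same `ζ²`, so that stability of strains becomes stability in energy
without loss in `λ` or `μ`. -/
lemma density_le {d : ℕ} (hd : d ≠ 0) (P : Params) (u : E d → E d) (x : E d) :
    density P u u x ≤ d * P.zeta d ^ 2 * strainSq u x := by
  rw [P.zeta_sq hd, density_self]
  have h := divergence_sq_le u x
  have hd' : (0 : ℝ) < d := by positivity
  have hl := P.lam_nonneg
  have : P.lam * divergence u x ^ 2 ≤ P.lam * (d * strainSq u x) := by gcongr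
  have e : d * (P.lam + 2 * P.mu / d) * strainSq u x =
    P.lam * (d * strainSq u x) + 2 * P.mu * strainSq u x := by field_simp
  linarith

lemma density_nonneg {d : ℕ} (P : Params) (u : E d → E d) (x : E d) : 0 ≤ density P u u x := by
  rw [density_self]
  have := P.lam_nonneg
  have := P.mu_pos
  have := strainSq_nonneg u x
  positivity

/-- Quadratic sums with few nonzero terms. -/
lemma sq_sum_le_of_support {ι : Type*} [Fintype ι] (A : Finset ι) {n : ℝ} (hA : (A.card : ℝ) ≤ n)
    (s : ι → ℝ) (hs : ∀ k, k ∉ A → s k = 0) : (∑ k, s k) ^ 2 ≤ n * ∑ k, s k ^ 2 := by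
  rw [← Finset.sum_subset (Finset.subset_univ A) fun k _ hk => hs k hk]
  refine sq_sum_le_card_mul_sum_sq.trans ?_
  refine mul_le_mul hA (Finset.sum_le_sum_of_subset_of_nonneg (Finset.subset_univ A)
    fun _ _ _ => sq_nonneg _) (Finset.sum_nonneg fun _ _ => sq_nonneg _)
    ((Nat.cast_nonneg _).trans hA)

/-- Strain and divergence are linear in the field, so Cauchy-Schwarz over the at most `n`
nonvanishing summands applies to each entry. -/
lemma density_sum_le {d : ℕ} (P : Params) {ι : Type*} [Fintype ι] {φ : ι → E d → E d}
    (hφ : ∀ k, ContDiff ℝ 1 (φ k)) (c : ι → ℝ) (A : Finset ι) {n : ℝ} (hA : (A.card : ℝ) ≤ n)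
    (h0 : ∀ k, k ∉ A → φ k = 0) (x : E d) :
    density P (fun y => ∑ k, c k • φ k y) (fun y => ∑ k, c k • φ k y) x ≤
      n * ∑ k, c k ^ 2 * density P (φ k) (φ k) x := by
  have hz : ∀ k, k ∉ A → ∀ i j, c k * strain (φ k) x i j = 0 := fun k hk i j => by
    rw [h0 k hk]
    simp [strain]
  have hz' : ∀ k, k ∉ A → c k * divergence (φ k) x = 0 := fun k hk => by
    rw [h0 k hk]
    simp [divergence]
  simp only [density_self, strainSq, strain_sum hφ, divergence_sum hφ]
  have h1 := sq_sum_le_of_support A hA _ hz'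
  have h2 : ∑ i, ∑ j, (∑ k, c k * strain (φ k) x i j) ^ 2 ≤
      ∑ i, ∑ j, n * ∑ k, (c k * strain (φ k) x i j) ^ 2 :=
    Finset.sum_le_sum fun i _ => Finset.sum_le_sum fun j _ =>
      sq_sum_le_of_support A hA _ fun k hk => hz k hk i j
  have h3 : ∑ i, ∑ j, n * ∑ k, (c k * strain (φ k) x i j) ^ 2 =
      n * ∑ k, c k ^ 2 * ∑ i, ∑ j, strain (φ k) x i j ^ 2 := by
    simp only [← Finset.mul_sum]
    congr 1
    calc _ = ∑ i, ∑ k, ∑ j, (c k * strain (φ k) x i j) ^ 2 :=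
          Finset.sum_congr rfl fun _ _ => Finset.sum_comm
      _ = ∑ k, ∑ i, ∑ j, (c k * strain (φ k) x i j) ^ 2 := Finset.sum_comm
      _ = _ := by simp only [mul_pow, Finset.mul_sum]
  rw [h3] at h2
  have h4 : n * ∑ k, c k ^ 2 * (2 * P.mu * ∑ i, ∑ j, strain (φ k) x i j ^ 2 +
      P.lam * divergence (φ k) x ^ 2) =
      2 * P.mu * (n * ∑ k, c k ^ 2 * ∑ i, ∑ j, strain (φ k) x i j ^ 2) +
        P.lam * (n * ∑ k, (c k * divergence (φ k) x) ^ 2) := by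
    have h5 : ∀ k, c k ^ 2 * (2 * P.mu * ∑ i, ∑ j, strain (φ k) x i j ^ 2 +
        P.lam * divergence (φ k) x ^ 2) =
        2 * P.mu * (c k ^ 2 * ∑ i, ∑ j, strain (φ k) x i j ^ 2) +
          P.lam * (c k * divergence (φ k) x) ^ 2 := fun k => by ring
    simp only [h5]
    rw [Finset.sum_add_distrib, ← Finset.mul_sum, ← Finset.mul_sum]
    ring
  rw [h4]
  have := P.lam_nonneg
  have := P.mu_pos
  gcongr

namespace Mesh

variable {d : ℕ} {m : Mesh d}

/-! ### Elements and basis functions -/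

namespace Element

lemma isCompact_carrier (T : m.Element) : IsCompact T.carrier :=
  T.1.finite_toSet.isCompact_convexHull ℝ

lemma convex_carrier (T : m.Element) : Convex ℝ T.carrier := convex_convexHull ℝ _

lemma measurableSet_carrier (T : m.Element) : MeasurableSet T.carrier :=
  T.isCompact_carrier.measurableSet

lemma integrableOn (T : m.Element) {f : E d → ℝ} (hf : Continuous f) :
    IntegrableOn f T.carrier := hf.continuousOn.integrableOn_compact T.isCompact_carrier

lemma bary_of_mem (T : m.Element) {z : E d} (hz : z ∈ T.1) (x : E d) :
    T.bary z x = T.affineBasis.coord ⟨z, hz⟩ x := by rw [bary, dif_pos hz]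

lemma bary_of_notMem (T : m.Element) {z : E d} (hz : z ∉ T.1) (x : E d) : T.bary z x = 0 := by
  rw [bary, dif_neg hz]

lemma exists_affine_bary (T : m.Element) (z : E d) : ∃ f : E d →ᵃ[ℝ] ℝ, T.bary z = f := by
  by_cases hz : z ∈ T.1
  · exact ⟨T.affineBasis.coord ⟨z, hz⟩, funext fun x => T.bary_of_mem hz x⟩
  · exact ⟨AffineMap.const ℝ _ 0, funext fun x => T.bary_of_notMem hz x⟩

lemma contDiff_bary (T : m.Element) (z : E d) {n : WithTop ℕ∞} : ContDiff ℝ n (T.bary z) := by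
  obtain ⟨f, hf⟩ := T.exists_affine_bary z
  rw [hf]
  exact contDiff_affineMap f

end Element

lemma contDiff_bubble (F : m.FreeFacet) (T : m.Element) : ContDiff ℝ 1 (m.bubble F T) :=
  (contDiff_prod fun z _ => T.contDiff_bary z).smul contDiff_const

lemma contDiff_hat (i : m.FreeVertex × Fin d) (T : m.Element) : ContDiff ℝ 1 (m.hat i T) :=
  (T.contDiff_bary _).smul contDiff_const

lemma contDiff_raviartThomas (F : m.FreeFacet) (T : m.Element) :
    ContDiff ℝ 1 (m.raviartThomas F T) := by
  classical
  unfold raviartThomas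
  by_cases h : F.1 ⊆ T.1
  · simp only [h, if_true]
    refine ContDiff.sum fun z _ => ContDiff.fun_smul (ContDiff.neg ?_)
      (contDiff_id.sub contDiff_const)
    exact ((T.contDiff_bary (n := 2) z).fderiv_right (m := 1) (by norm_num)).clm_apply
      contDiff_const
  · simp only [h, if_false]
    exact contDiff_const

lemma bubble_eq_zero {F : m.FreeFacet} {T : m.Element} (h : ¬ F.1 ⊆ T.1) : m.bubble F T = 0 := by
  obtain ⟨z, hzF, hzT⟩ := Finset.not_subset.1 h
  funext x
  simp only [bubble, Pi.zero_apply]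
  rw [Finset.prod_eq_zero hzF (T.bary_of_notMem hzT x), zero_smul]

open Classical in
/-- The free facets of an element. -/
def Element.freeFacets (T : m.Element) : Finset m.FreeFacet :=
  Finset.univ.filter fun F => F.1 ⊆ T.1

lemma Element.card_freeFacets_le (T : m.Element) : T.freeFacets.card ≤ d + 1 := by
  classical
  have h : T.freeFacets.card ≤ (T.1.powersetCard d).card := by
    refine Finset.card_le_card_of_injOn (fun F => F.1) (fun F hF => ?_)
      (Subtype.val_injective.injOn)
    have hF' : F ∈ Finset.univ.filter fun F : m.FreeFacet => F.1 ⊆ T.1 := hF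
    rw [Finset.mem_filter] at hF'
    exact Finset.mem_coe.2 (Finset.mem_powersetCard.2 ⟨hF'.2, F.2.2.1⟩)
  rwa [Finset.card_powersetCard, T.2.2, Nat.choose_succ_self_right] at h

lemma Element.mem_freeFacets {T : m.Element} {F : m.FreeFacet} :
    F ∈ T.freeFacets ↔ F.1 ⊆ T.1 := by
  simp [freeFacets]

variable (m)

/-- The basis of the displacement space. -/
def dispBasis : m.DispIdx → m.VField := Sum.elim m.bubble m.hat

variable {m}

lemma contDiff_dispBasis (k : m.DispIdx) (T : m.Element) : ContDiff ℝ 1 (m.dispBasis k T) := by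
  rcases k with F | i
  · exact contDiff_bubble F T
  · exact contDiff_hat i T

/-- The linear combination of a family of fields with given coefficients. -/
def comb {ι : Type*} [Fintype ι] (φ : ι → m.VField) (c : ι → ℝ) : m.VField :=
  fun T x => ∑ k, c k • φ k T x

lemma contDiff_comb {ι : Type*} [Fintype ι] {φ : ι → m.VField}
    (hφ : ∀ k T, ContDiff ℝ 1 (φ k T)) (c : ι → ℝ) (T : m.Element) :
    ContDiff ℝ 1 (comb φ c T) :=
  ContDiff.sum fun k _ => contDiff_const.fun_smul (hφ k T)

/-! ### Matrices as bilinear forms -/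

lemma elasticity_eq (P : Params) (u v : m.VField) :
    m.elasticity P u v = ∑ T : m.Element, ∫ x in T.carrier, density P (u T) (v T) x := rfl

lemma sum_integral_bilinear {ι : Type*} [Fintype ι] (F : ι → ι → m.Element → E d → ℝ)
    (hF : ∀ k l T, IntegrableOn (F k l T) T.carrier) (c c' : ι → ℝ) :
    ∑ T : m.Element, ∫ x in T.carrier, ∑ k, ∑ l, c k * c' l * F k l T x =
      ∑ k, ∑ l, c k * c' l * ∑ T : m.Element, ∫ x in T.carrier, F k l T x := by
  have h : ∀ T : m.Element, ∫ x in T.carrier, ∑ k, ∑ l, c k * c' l * F k l T x =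
      ∑ k, ∑ l, c k * c' l * ∫ x in T.carrier, F k l T x := fun T => by
    rw [integral_finsetSum _ fun k _ => integrable_finsetSum _ fun l _ => (hF k l T).const_mul _]
    refine Finset.sum_congr rfl fun k _ => ?_
    rw [integral_finsetSum _ fun l _ => (hF k l T).const_mul _]
    exact Finset.sum_congr rfl fun l _ => integral_const_mul _ _
  simp only [h, Finset.mul_sum]
  rw [Finset.sum_comm]
  exact Finset.sum_congr rfl fun k _ => Finset.sum_comm

lemma mulVec_dotProduct_eq_sum {ι : Type*} [Fintype ι] (H : Matrix ι ι ℝ) (u v : ι → ℝ) :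
    H.mulVec u ⬝ᵥ v = ∑ k, ∑ l, u k * v l * H l k := by
  simp only [dotProduct, mulVec, Finset.sum_mul]
  rw [Finset.sum_comm]
  exact Finset.sum_congr rfl fun k _ => Finset.sum_congr rfl fun l _ => by ring

lemma elasticity_comb (P : Params) {ι : Type*} [Fintype ι] {φ : ι → m.VField}
    (hφ : ∀ k T, ContDiff ℝ 1 (φ k T)) (c c' : ι → ℝ) :
    m.elasticity P (comb φ c) (comb φ c') =
      (Matrix.of fun i j => m.elasticity P (φ j) (φ i)).mulVec c ⬝ᵥ c' := by
  rw [mulVec_dotProduct_eq_sum]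
  simp only [elasticity_eq, Matrix.of_apply]
  rw [← sum_integral_bilinear (fun k l T => density P (φ k T) (φ l T))
    (fun k l T => T.integrableOn (continuous_density P (hφ k T) (hφ l T)))]
  refine Finset.sum_congr rfl fun T _ => integral_congr_ae (ae_of_all _ fun x => ?_)
  exact density_sum P (fun k => hφ k T) c c' x

lemma elasticity_comm (P : Params) (u v : m.VField) : m.elasticity P u v = m.elasticity P v u := by
  simp only [elasticity_eq, density_comm P (u _) (v _)]

lemma elasticity_nonneg (P : Params) (u : m.VField) : 0 ≤ m.elasticity P u u :=
  Finset.sum_nonneg fun _ _ => integral_nonneg fun _ => density_nonneg P _ _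

lemma Au_eq (P : Params) :
    m.Au P = Matrix.of fun i j => m.elasticity P (m.dispBasis j) (m.dispBasis i) := by
  ext i j
  rcases i with i | i <;> rcases j with j | j <;> try rfl
  exact elasticity_comm P _ _

variable (m) in
/-- The displacement field with given coefficients. -/
def disp (u : m.DispIdx → ℝ) : m.VField := comb m.dispBasis u

lemma contDiff_disp (u : m.DispIdx → ℝ) (T : m.Element) : ContDiff ℝ 1 (m.disp u T) :=
  contDiff_comb contDiff_dispBasis u T

lemma Au_form (P : Params) (u v : m.DispIdx → ℝ) :
    (m.Au P).mulVec u ⬝ᵥ v = m.elasticity P (m.disp u) (m.disp v) := by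
  rw [Au_eq, disp, disp, elasticity_comb P contDiff_dispBasis]

lemma Au_posSemidef (P : Params) : (m.Au P).PosSemidef := by
  refine posSemidef_of_form ?_ fun u => ?_
  · rw [Au_eq]
    ext i j
    exact elasticity_comm P _ _
  · rw [Au_form]
    exact elasticity_nonneg P _

lemma Abb_form (P : Params) (u v : m.FreeFacet → ℝ) :
    (m.Abb P).mulVec u ⬝ᵥ v = m.elasticity P (comb m.bubble u) (comb m.bubble v) :=
  (elasticity_comb P contDiff_bubble u v).symm

lemma Dbb_form (P : Params) (u : m.FreeFacet → ℝ) :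
    (m.Dbb P).mulVec u ⬝ᵥ u =
      ((d : ℝ) + 1) * ∑ F, u F ^ 2 * m.elasticity P (m.bubble F) (m.bubble F) := by
  rw [Dbb, smul_mulVec, smul_dotProduct, smul_eq_mul]
  simp only [dotProduct, mulVec_diagonal]
  congr 1
  exact Finset.sum_congr rfl fun F _ => by
    simp only [diag_apply, Abb, of_apply]
    ring

/-- The scaled diagonal dominates the bubble block. -/
lemma gap_posSemidef (P : Params) : (m.Dbb P - m.Abb P).PosSemidef := by
  refine posSemidef_of_form ?_ fun u => ?_
  · refine IsSymm.sub ?_ ?_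
    · exact (isSymm_diagonal _).smul _
    · ext i j
      exact elasticity_comm P _ _
  · rw [sub_mulVec, sub_dotProduct, sub_nonneg, Abb_form, Dbb_form]
    simp only [elasticity_eq, Finset.mul_sum]
    rw [Finset.sum_comm]
    refine Finset.sum_le_sum fun T _ => ?_
    have hint : ∀ F, IntegrableOn (density P (m.bubble F T) (m.bubble F T)) T.carrier := fun F =>
      T.integrableOn (continuous_density P (contDiff_bubble F T) (contDiff_bubble F T))
    calc _ ≤ ∫ x in T.carrier, ((d : ℝ) + 1) *
          ∑ F, u F ^ 2 * density P (m.bubble F T) (m.bubble F T) x := by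
          refine setIntegral_mono (T.integrableOn (continuous_density P
            (contDiff_comb contDiff_bubble u T) (contDiff_comb contDiff_bubble u T)))
            ((integrable_finsetSum _ fun F _ => (hint F).const_mul _).const_mul _) fun x => ?_
          -- At most `d + 1` bubbles live on an element, which is the factor in `D_bb`.
          refine density_sum_le P (fun F => contDiff_bubble F T) u T.freeFacets ?_ (fun F hF =>
            bubble_eq_zero fun h => hF (Element.mem_freeFacets.2 h)) x
          exact_mod_cast T.card_freeFacets_le
      _ = _ := by
          rw [integral_const_mul, integral_finsetSum _ fun F _ => (hint F).const_mul _,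
            Finset.mul_sum]
          exact Finset.sum_congr rfl fun F _ => by rw [integral_const_mul]

lemma divForm_indicator (v : m.VField) (S : m.Element) :
    m.divForm v (m.indicator S) = ∫ x in S.carrier, divergence (v S) x := by
  rw [divForm, Finset.sum_eq_single S]
  · simp [indicator]
  · intro T _ hT
    simp [indicator, hT]
  · simp

variable (m) in
/-- The divergence matrix of the displacement space. -/
def Bdisp : Matrix m.Element m.DispIdx ℝ := fromCols m.Bb m.Bl

lemma integral_divergence_comb {ι : Type*} [Fintype ι] {φ : ι → m.VField}
    (hφ : ∀ k T, ContDiff ℝ 1 (φ k T)) (c : ι → ℝ) (T : m.Element) :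
    ∫ x in T.carrier, divergence (comb φ c T) x =
      ∑ k, c k * ∫ x in T.carrier, divergence (φ k T) x := by
  have h : ∀ x, divergence (comb φ c T) x = ∑ k, c k * divergence (φ k T) x := fun x =>
    divergence_sum (fun k => hφ k T) c x
  simp only [h]
  rw [integral_finsetSum _ fun k _ =>
    (T.integrableOn (continuous_divergence (hφ k T))).const_mul _]
  exact Finset.sum_congr rfl fun k _ => integral_const_mul _ _

lemma Bdisp_mulVec (u : m.DispIdx → ℝ) (T : m.Element) :
    m.Bdisp.mulVec u T = -∫ x in T.carrier, divergence (m.disp u T) x := by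
  rw [disp, integral_divergence_comb contDiff_dispBasis, ← Finset.sum_neg_distrib]
  refine Finset.sum_congr rfl fun k _ => ?_
  rcases k with F | i <;> simp [Bdisp, Bb, Bl, divForm_indicator, dispBasis, mul_comm]

lemma Bw_mulVec (w : m.FreeFacet → ℝ) (T : m.Element) :
    m.Bw.mulVec w T = -∫ x in T.carrier, divergence (comb m.raviartThomas w T) x := by
  rw [integral_divergence_comb contDiff_raviartThomas, ← Finset.sum_neg_distrib]
  exact Finset.sum_congr rfl fun k _ => by simp [Bw, divForm_indicator, mul_comm]

lemma Mp_eq : m.Mp = diagonal fun T => volume.real T.carrier := by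
  ext S T
  simp only [Mp, massForm, indicator, of_apply]
  rw [Finset.sum_eq_single T]
  · by_cases h : S = T
    · subst h
      simp
    · simp [h, Ne.symm h]
  · intro R _ hR
    simp [hR]
  · simp

lemma Mp_form (p q : m.Element → ℝ) :
    m.Mp.mulVec p ⬝ᵥ q = ∑ T, volume.real T.carrier * (p T * q T) := by
  simp only [Mp_eq, dotProduct, mulVec_diagonal, mul_assoc]

lemma Mp_posSemidef : m.Mp.PosSemidef := by
  rw [Mp_eq]
  exact PosSemidef.diagonal fun T => measureReal_nonneg

/-- Boundedness of the divergence pairing. -/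
lemma div_bound (hd : d ≠ 0) (P : Params) (q : m.Element → ℝ) (u : m.DispIdx → ℝ) :
    (q ⬝ᵥ m.Bdisp.mulVec u) ^ 2 * P.zeta d ^ 2 ≤
      (m.Mp.mulVec q ⬝ᵥ q) * ((m.Au P).mulVec u ⬝ᵥ u) := by
  have hc : ∀ T, Continuous fun x => divergence (m.disp u T) x := fun T =>
    continuous_divergence (contDiff_disp u T)
  have h1 : (q ⬝ᵥ m.Bdisp.mulVec u) ^ 2 ≤
      (m.Mp.mulVec q ⬝ᵥ q) * ∑ T, ∫ x in T.carrier, divergence (m.disp u T) x ^ 2 := by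
    -- Cauchy-Schwarz by the discriminant of `∑ ∫ (t q - div u)²` as a polynomial in `t`.
    refine sq_le_mul_of_quadratic_nonneg fun t => ?_
    have h2 : m.Mp.mulVec q ⬝ᵥ q * (t * t) + 2 * (q ⬝ᵥ m.Bdisp.mulVec u) * t +
        ∑ T, ∫ x in T.carrier, divergence (m.disp u T) x ^ 2 =
        ∑ T, ∫ x in T.carrier, (t * q T - divergence (m.disp u T) x) ^ 2 := by
      rw [Mp_form, dotProduct, Finset.sum_mul, Finset.mul_sum, Finset.sum_mul,
        ← Finset.sum_add_distrib, ← Finset.sum_add_distrib]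
      refine Finset.sum_congr rfl fun T _ => ?_
      have e : ∀ x, (t * q T - divergence (m.disp u T) x) ^ 2 = (t * q T) ^ 2 +
          (-(2 * t * q T)) * divergence (m.disp u T) x + divergence (m.disp u T) x ^ 2 :=
        fun x => by ring
      simp only [e]
      rw [integral_add (f := fun x => (t * q T) ^ 2 +
          (-(2 * t * q T)) * divergence (m.disp u T) x)
          (g := fun x => divergence (m.disp u T) x ^ 2) (T.integrableOn
          (continuous_const.add (continuous_const.mul (hc T)))) (T.integrableOn ((hc T).pow 2)),
        integral_add (T.integrableOn continuous_const) ((T.integrableOn (hc T)).const_mul _),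
        integral_const_mul, setIntegral_const, Bdisp_mulVec, smul_eq_mul]
      ring
    rw [h2]
    exact Finset.sum_nonneg fun T _ => integral_nonneg fun x => sq_nonneg _
  have h3 : (∑ T, ∫ x in T.carrier, divergence (m.disp u T) x ^ 2) * P.zeta d ^ 2 ≤
      (m.Au P).mulVec u ⬝ᵥ u := by
    rw [Au_form, elasticity_eq, Finset.sum_mul]
    refine Finset.sum_le_sum fun T _ => ?_
    rw [← integral_mul_const]
    refine setIntegral_mono (T.integrableOn (((hc T).pow 2).mul continuous_const))
      (T.integrableOn (continuous_density P (contDiff_disp u T) (contDiff_disp u T))) fun x => ?_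
    rw [mul_comm]
    exact divergence_sq_le_density hd P _ x
  calc _ ≤ (m.Mp.mulVec q ⬝ᵥ q) *
        (∑ T, ∫ x in T.carrier, divergence (m.disp u T) x ^ 2) * P.zeta d ^ 2 := by gcongr
    _ = (m.Mp.mulVec q ⬝ᵥ q) *
        ((∑ T, ∫ x in T.carrier, divergence (m.disp u T) x ^ 2) * P.zeta d ^ 2) := by ring
    _ ≤ _ := mul_le_mul_of_nonneg_left h3 (form_nonneg Mp_posSemidef q)

end Mesh

/-! ### The flux mass matrix -/

lemma measurable_det {α : Type*} [MeasurableSpace α] {n : ℕ}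
    {A : α → Matrix (Fin n) (Fin n) ℝ} (hA : ∀ i j, Measurable fun x => A x i j) :
    Measurable fun x => (A x).det := by
  simp only [det_apply']
  exact Finset.measurable_sum _ fun σ _ =>
    measurable_const.mul (Finset.measurable_prod _ fun i _ => hA _ _)

/-- Cramer's rule makes an entry of the inverse a quotient of two determinants; with `0⁻¹ = 0` this
is valid for singular matrices too. -/
lemma measurable_inv_apply {α : Type*} [MeasurableSpace α] {n : ℕ}
    {A : α → Matrix (Fin n) (Fin n) ℝ} (hA : ∀ i j, Measurable fun x => A x i j) (i j : Fin n) :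
    Measurable fun x => (A x)⁻¹ i j := by
  have h : ∀ x, (A x)⁻¹ i j = (A x).det⁻¹ * ((A x).updateRow j (Pi.single i 1)).det := fun x => by
    rw [inv_def, Matrix.smul_apply, smul_eq_mul, Ring.inverse_eq_inv', adjugate_apply]
  simp only [h]
  refine (measurable_det hA).inv.mul (measurable_det fun k l => ?_)
  by_cases h : k = j
  · subst h
    simp
  · simpa [updateRow_ne h] using hA k l

namespace Permeability

variable {d : ℕ} (κ : Permeability d)

lemma tensor_posDef (x : E d) : (κ.tensor x).PosDef := by
  refine posDef_of_form (κ.symm x) fun ξ hξ => ?_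
  have h := κ.lower_le x ξ
  rw [dotProduct_comm]
  refine lt_of_lt_of_le (mul_pos κ.lower_pos ?_) h
  have := dotProduct_star_self_pos_iff.2 hξ
  rwa [star_trivial] at this

/-- For the `j`-th column `ξ` of the inverse, coercivity reads `lower * |ξ|² ≤ ξ_j`. Hence first
`lower * ξ_j ≤ 1`, then `lower² ξ_i² ≤ 1`. -/
lemma abs_inv_le (x : E d) (i j : Fin d) : |(κ.tensor x)⁻¹ i j| ≤ 1 / κ.lower := by
  have hl := κ.lower_pos
  set ξ : Fin d → ℝ := (κ.tensor x)⁻¹.mulVec (Pi.single j 1) with hξ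
  have hij : ∀ k, (κ.tensor x)⁻¹ k j = ξ k := fun k => by simp [hξ]
  have h1 := κ.lower_le x ξ
  have h2 : (κ.tensor x).mulVec ξ = Pi.single j 1 := by
    rw [hξ, mulVec_mulVec, mul_nonsing_inv _ ((isUnit_iff_isUnit_det _).1
      (κ.tensor_posDef x).isUnit), one_mulVec]
  rw [h2, dotProduct_single, mul_one] at h1
  have h3 : ∀ k, ξ k ^ 2 ≤ ξ ⬝ᵥ ξ := fun k => by
    rw [sq]
    exact Finset.single_le_sum (f := fun k => ξ k * ξ k) (fun k _ => mul_self_nonneg _)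
      (Finset.mem_univ k)
  rw [hij]
  have hj := h3 j
  have hi := h3 i
  have e1 : κ.lower * ξ j ≤ 1 := by
    by_contra hc
    push Not at hc
    have : 0 < ξ j := by
      by_contra hn
      push Not at hn
      nlinarith
    nlinarith
  have e2 : ξ i ^ 2 ≤ (1 / κ.lower) ^ 2 := by
    have : κ.lower ^ 2 * ξ i ^ 2 ≤ 1 := by nlinarith [mul_le_mul_of_nonneg_left hi hl.le]
    rw [one_div, inv_pow, ← one_div, le_div_iff₀ (by positivity)]
    linarith
  exact abs_le_of_sq_le_sq e2 (by positivity)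

end Permeability

namespace Mesh

variable {d : ℕ} {m : Mesh d}

/-- The density of the flux form. -/
def fluxDensity (κ : Permeability d) (P : Params) (w r : E d → E d) (x : E d) : ℝ :=
  P.muf * ((κ.tensor x)⁻¹.mulVec (w x) ⬝ᵥ (r x : Fin d → ℝ))

lemma fluxForm_eq (κ : Permeability d) (P : Params) (w r : m.VField) :
    m.fluxForm κ P w r = ∑ T : m.Element, ∫ x in T.carrier, fluxDensity κ P (w T) (r T) x := rfl

lemma fluxDensity_comm (κ : Permeability d) (P : Params) (w r : E d → E d) (x : E d) :
    fluxDensity κ P w r x = fluxDensity κ P r w x := by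
  rw [fluxDensity, fluxDensity,
    mulVec_dotProduct_comm (isSymm_of_posSemidef (κ.tensor_posDef x).inv.posSemidef)]

lemma fluxDensity_nonneg (κ : Permeability d) (P : Params) (w : E d → E d) (x : E d) :
    0 ≤ fluxDensity κ P w w x :=
  mul_nonneg P.muf_pos.le (form_nonneg (κ.tensor_posDef x).inv.posSemidef _)

lemma eq_zero_of_fluxDensity_eq_zero {κ : Permeability d} {P : Params} {w : E d → E d} {x : E d}
    (h : fluxDensity κ P w w x = 0) : w x = 0 := by
  by_contra hne
  have hne' : (w x : Fin d → ℝ) ≠ 0 := fun h0 => hne (by ext i; exact congr_fun h0 i)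
  exact (mul_pos P.muf_pos (form_pos (κ.tensor_posDef x).inv hne')).ne' h

/-- The inverse tensor is merely measurable; its entrywise bound takes the place of continuity. -/
lemma Element.integrableOn_fluxDensity (T : m.Element) (κ : Permeability d) (P : Params)
    {w r : E d → E d} (hw : Continuous w) (hr : Continuous r) :
    IntegrableOn (fluxDensity κ P w r) T.carrier := by
  have e : fluxDensity κ P w r =
      fun x => ∑ i, ∑ j, (κ.tensor x)⁻¹ i j * (P.muf * (w x j * r x i)) := by
    funext x
    simp only [fluxDensity, dotProduct, mulVec, Finset.sum_mul, Finset.mul_sum]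
    exact Finset.sum_congr rfl fun i _ => Finset.sum_congr rfl fun j _ => by ring
  rw [e]
  refine integrable_finsetSum _ fun i _ => integrable_finsetSum _ fun j _ => ?_
  refine Integrable.bdd_mul (c := 1 / κ.lower) (T.integrableOn (by fun_prop))
    (measurable_inv_apply κ.measurable_tensor i j).aestronglyMeasurable
    (ae_of_all _ fun x => ?_)
  exact κ.abs_inv_le x i j

lemma fluxDensity_sum (κ : Permeability d) (P : Params) {ι : Type*} [Fintype ι]
    (φ : ι → E d → E d) (c c' : ι → ℝ) (x : E d) :
    fluxDensity κ P (fun y => ∑ k, c k • φ k y) (fun y => ∑ k, c' k • φ k y) x =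
      ∑ k, ∑ l, c k * c' l * fluxDensity κ P (φ k) (φ l) x := by
  simp only [fluxDensity, WithLp.ofLp_sum, WithLp.ofLp_smul, mulVec_sum, mulVec_smul,
    sum_dotProduct, dotProduct_sum, smul_dotProduct, dotProduct_smul, smul_eq_mul, Finset.mul_sum]
  rw [Finset.sum_comm]
  exact Finset.sum_congr rfl fun k _ => Finset.sum_congr rfl fun l _ => by ring

lemma Mw_form (κ : Permeability d) (P : Params) (w r : m.FreeFacet → ℝ) :
    (m.Mw κ P).mulVec w ⬝ᵥ r =
      m.fluxForm κ P (comb m.raviartThomas w) (comb m.raviartThomas r) := by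
  rw [mulVec_dotProduct_eq_sum]
  simp only [Mw, fluxForm_eq, Matrix.of_apply]
  rw [← sum_integral_bilinear
    (fun k l T => fluxDensity κ P (m.raviartThomas k T) (m.raviartThomas l T))
    (fun k l T => T.integrableOn_fluxDensity κ P (contDiff_raviartThomas k T).continuous
      (contDiff_raviartThomas l T).continuous)]
  refine Finset.sum_congr rfl fun T _ => integral_congr_ae (ae_of_all _ fun x => ?_)
  exact (fluxDensity_sum κ P (fun k => m.raviartThomas k T) w r x).symm

lemma Mw_posSemidef (κ : Permeability d) (P : Params) : (m.Mw κ P).PosSemidef := by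
  refine posSemidef_of_form ?_ fun w => ?_
  · ext i j
    simp only [transpose_apply, Mw, of_apply, fluxForm_eq]
    simp only [fluxDensity_comm κ P (m.raviartThomas i _)]
  · rw [Mw_form, fluxForm_eq]
    exact Finset.sum_nonneg fun T _ => integral_nonneg fun x => fluxDensity_nonneg κ P _ x

/-- Fluxes of zero energy are divergence free. -/
lemma Bw_mulVec_eq_zero {κ : Permeability d} {P : Params} {w : m.FreeFacet → ℝ}
    (h : (m.Mw κ P).mulVec w ⬝ᵥ w = 0) : m.Bw.mulVec w = 0 := by
  funext T
  have hC := contDiff_comb (m := m) contDiff_raviartThomas w T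
  set v := comb m.raviartThomas w T with hv
  rw [Mw_form, fluxForm_eq, Finset.sum_eq_zero_iff_of_nonneg fun T _ =>
    integral_nonneg fun x => fluxDensity_nonneg κ P _ x] at h
  have h1 := h T (Finset.mem_univ T)
  rw [← hv, setIntegral_eq_zero_iff_of_nonneg_ae
    (ae_of_all _ fun x => fluxDensity_nonneg κ P _ x)
    (T.integrableOn_fluxDensity κ P hC.continuous hC.continuous)] at h1
  have h2 : v =ᵐ[volume.restrict (interior T.carrier)] fun _ => 0 := by
    refine Filter.EventuallyEq.filter_mono ?_
      (ae_mono (Measure.restrict_mono interior_subset le_rfl))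
    filter_upwards [h1] with x hx
    exact eq_zero_of_fluxDensity_eq_zero hx
  -- A continuous field vanishing almost everywhere vanishes on the interior, and there so does its
  -- divergence; the boundary of a convex set is null.
  have h3 := Measure.eqOn_open_of_ae_eq h2 isOpen_interior hC.continuous.continuousOn
    continuousOn_const
  have h4 : ∀ x ∈ interior T.carrier, divergence v x = 0 := fun x hx => by
    have h5 : v =ᶠ[nhds x] fun _ => 0 :=
      h3.eventuallyEq_of_mem (isOpen_interior.mem_nhds hx)
    simp [divergence, h5.fderiv_eq]
  rw [Bw_mulVec, Pi.zero_apply, neg_eq_zero,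
    ← setIntegral_congr_set (interior_ae_eq_of_null_frontier
      (T.convex_carrier.addHaar_frontier volume)), ← hv]
  exact setIntegral_eq_zero_of_forall_eq_zero h4

end Mesh

/-! ### An inverse inequality for polynomials -/

/-- The affine functions. -/
def affineFunctions (d : ℕ) : Submodule ℝ (E d → ℝ) :=
  Submodule.span ℝ (insert 1 (Set.range fun (i : Fin d) (x : E d) => x i))

lemma one_mem_affineFunctions (d : ℕ) : (1 : E d → ℝ) ∈ affineFunctions d :=
  Submodule.subset_span (Set.mem_insert _ _)

lemma affine_mem_affineFunctions {d : ℕ} (L : E d →L[ℝ] ℝ) (a : ℝ) :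
    (fun x => L x + a) ∈ affineFunctions d := by
  have h : (fun x => L x + a) = (∑ i, L (EuclideanSpace.single i 1) • fun x : E d => x i) +
      a • (1 : E d → ℝ) := by
    funext x
    have hx : x = ∑ i, x i • EuclideanSpace.single i (1 : ℝ) := by
      ext j
      simp [Pi.single_apply]
    simp only [Pi.add_apply, Finset.sum_apply, Pi.smul_apply, smul_eq_mul, Pi.one_apply, mul_one]
    congr 1
    conv_lhs => rw [hx]
    rw [map_sum]
    exact Finset.sum_congr rfl fun i _ => by rw [map_smul, smul_eq_mul, mul_comm]
  rw [h]
  exact Submodule.add_mem _ (Submodule.sum_mem _ fun i _ => Submodule.smul_mem _ _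
    (Submodule.subset_span (Set.mem_insert_of_mem _ ⟨i, rfl⟩)))
    (Submodule.smul_mem _ _ (one_mem_affineFunctions d))

lemma one_mem_affineFunctions_pow (d k : ℕ) : (1 : E d → ℝ) ∈ affineFunctions d ^ k := by
  have := Submodule.pow_mem_pow (affineFunctions d) (one_mem_affineFunctions d) k
  rwa [one_pow] at this

lemma prod_mem_affineFunctions_pow {d : ℕ} {ι : Type*} (A : Finset ι) (f : ι → E d → ℝ)
    (hf : ∀ i ∈ A, f i ∈ affineFunctions d) : ∏ i ∈ A, f i ∈ affineFunctions d ^ A.card := by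
  classical
  induction A using Finset.induction_on with
  | empty => simp
  | insert i A hi ih =>
    rw [Finset.prod_insert hi, Finset.card_insert_of_notMem hi, pow_succ']
    exact Submodule.mul_mem_mul (hf i (Finset.mem_insert_self i A))
      (ih fun j hj => hf j (Finset.mem_insert_of_mem hj))

instance (d k : ℕ) : FiniteDimensional ℝ (affineFunctions d ^ k : Submodule ℝ (E d → ℝ)) :=
  Module.Finite.iff_fg.2 (Submodule.FG.pow
    (Submodule.fg_span ((Set.finite_range _).insert _)) k)

/-- Needed for the identity theorem: a polynomial that vanishes on a ball vanishes everywhere. -/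
lemma analyticOnNhd_of_mem {d k : ℕ} {f : E d → ℝ} (hf : f ∈ affineFunctions d ^ k) :
    AnalyticOnNhd ℝ f Set.univ := by
  have h1 : ∀ g ∈ affineFunctions d, AnalyticOnNhd ℝ g Set.univ := fun g hg => by
    induction hg using Submodule.span_induction with
    | mem g hg =>
      rcases hg with rfl | ⟨i, rfl⟩
      · exact analyticOnNhd_const
      · exact (EuclideanSpace.proj i : E d →L[ℝ] ℝ).analyticOnNhd _
    | zero => exact analyticOnNhd_const
    | add g g' _ _ hg hg' => exact hg.add hg'
    | smul a g _ hg => exact fun x hx => (analyticAt_const (v := a)).smul (hg x hx)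
  induction hf using Submodule.pow_induction_on_left' with
  | algebraMap r => exact analyticOnNhd_const
  | add f g i _ _ hf hg => exact hf.add hg
  | mem_mul g hg i f _ hf => exact (h1 g hg).mul hf

lemma gram_form {d n : ℕ} {b : Fin n → E d → ℝ} {K : Set (E d)} (hK : IsCompact K)
    (hb : ∀ i, Continuous (b i)) (c : Fin n → ℝ) :
    (Matrix.of fun i j => ∫ x in K, b i x * b j x).mulVec c ⬝ᵥ c =
      ∫ x in K, (∑ i, c i * b i x) ^ 2 := by
  have hint : ∀ i j, IntegrableOn (fun x => b i x * b j x) K := fun i j =>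
    ((hb i).mul (hb j)).continuousOn.integrableOn_compact hK
  have e : ∀ x, (∑ i, c i * b i x) ^ 2 = ∑ i, ∑ j, c i * c j * (b i x * b j x) := fun x => by
    rw [sq, Finset.sum_mul_sum]
    exact Finset.sum_congr rfl fun i _ => Finset.sum_congr rfl fun j _ => by ring
  simp only [e]
  rw [integral_finsetSum _ fun i _ => integrable_finsetSum _ fun j _ => (hint i j).const_mul _]
  simp only [dotProduct, mulVec, Finset.sum_mul]
  refine Finset.sum_congr rfl fun i _ => ?_
  rw [integral_finsetSum _ fun j _ => (hint i j).const_mul _]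
  refine Finset.sum_congr rfl fun j _ => ?_
  rw [integral_const_mul, Matrix.of_apply]
  ring

/-- A combination with zero mean square on the ball is zero there, hence everywhere by analyticity,
and linear independence as functions on the whole space applies. -/
lemma gram_posDef {d n : ℕ} {b : Fin n → E d → ℝ} (hb : ∀ i, AnalyticOnNhd ℝ (b i) Set.univ)
    (hli : LinearIndependent ℝ b) :
    (Matrix.of fun i j => ∫ x in Metric.closedBall (0 : E d) 1, b i x * b j x).PosDef := by
  have hcb : ∀ i, Continuous (b i) := fun i => continuousOn_univ.1 (hb i).continuousOn
  have hK : IsCompact (Metric.closedBall (0 : E d) 1) := isCompact_closedBall _ _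
  refine posDef_of_form ?_ fun c hc => ?_
  · ext i j
    simp [mul_comm]
  rw [gram_form hK hcb]
  refine lt_of_le_of_ne (integral_nonneg fun x => sq_nonneg _) fun h0 => hc ?_
  have han : AnalyticOnNhd ℝ (fun x => ∑ i, c i * b i x) Set.univ := fun x hx =>
    Finset.analyticAt_fun_sum _ fun i _ => analyticAt_const.mul (hb i x hx)
  have hcont := continuousOn_univ.1 han.continuousOn
  have h1 := (setIntegral_eq_zero_iff_of_nonneg_ae (ae_of_all _ fun x => sq_nonneg _)
    ((hcont.pow 2).continuousOn.integrableOn_compact hK)).1 h0.symm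
  have h2 : (fun x => ∑ i, c i * b i x) =ᵐ[volume.restrict (Metric.ball (0 : E d) 1)]
      fun _ => 0 := by
    refine Filter.EventuallyEq.filter_mono ?_
      (ae_mono (Measure.restrict_mono Metric.ball_subset_closedBall le_rfl))
    filter_upwards [h1] with x hx
    exact pow_eq_zero_iff two_ne_zero |>.1 hx
  have h3 := Measure.eqOn_open_of_ae_eq h2 Metric.isOpen_ball hcont.continuousOn
    continuousOn_const
  have h4 := han.eq_of_eventuallyEq (analyticOnNhd_const (v := (0 : ℝ))) (z₀ := (0 : E d))
    (h3.eventuallyEq_of_mem (Metric.ball_mem_nhds _ one_pos))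
  funext i
  refine Fintype.linearIndependent_iff.1 hli c ?_ i
  funext x
  have := congr_fun h4 x
  simpa using this

/-- On a space of polynomials the maximum norm on a large ball is controlled by the mean square on
the unit ball. -/
lemma exists_sq_le_integral (d k : ℕ) (R : ℝ) : ∃ C : ℝ, 0 < C ∧
    ∀ g ∈ affineFunctions d ^ k, ∀ y ∈ Metric.closedBall (0 : E d) R,
      g y ^ 2 ≤ C * ∫ x in Metric.closedBall (0 : E d) 1, g x ^ 2 := by
  obtain ⟨n, b, hbm, hli, hspan⟩ : ∃ (n : ℕ) (b : Fin n → E d → ℝ),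
      (∀ i, b i ∈ affineFunctions d ^ k) ∧ LinearIndependent ℝ b ∧
      ∀ g ∈ affineFunctions d ^ k, ∃ c : Fin n → ℝ, ∀ x, g x = ∑ i, c i * b i x := by
    let v := Module.finBasis ℝ (affineFunctions d ^ k : Submodule ℝ (E d → ℝ))
    refine ⟨_, fun i => v i, fun i => (v i).2, ?_, fun g hg => ⟨v.repr ⟨g, hg⟩, fun x => ?_⟩⟩
    · exact v.linearIndependent.map' (Submodule.subtype _) (Submodule.ker_subtype _)
    · have h := congr_fun (congr_arg Subtype.val (v.sum_repr ⟨g, hg⟩)) x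
      simp only [Submodule.coe_sum, Finset.sum_apply, Submodule.coe_smul, Pi.smul_apply,
        smul_eq_mul] at h
      exact h.symm
  have han : ∀ i, AnalyticOnNhd ℝ (b i) Set.univ := fun i => analyticOnNhd_of_mem (hbm i)
  have hcb : ∀ i, Continuous (b i) := fun i => continuousOn_univ.1 (han i).continuousOn
  -- The definite Gram matrix dominates the identity, so the mean square bounds the coefficients;
  -- Cauchy-Schwarz then bounds the values.
  obtain ⟨C, hC, hle⟩ := exists_form_le (gram_posDef han hli) (1 : Matrix (Fin n) (Fin n) ℝ)
  obtain ⟨M, hM⟩ := (isCompact_closedBall (0 : E d) R).exists_bound_of_continuousOn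
    (f := fun x => ∑ i, b i x ^ 2) (continuous_finsetSum _ fun i _ => (hcb i).pow 2).continuousOn
  refine ⟨C * (|M| + 1), by positivity, fun g hg y hy => ?_⟩
  obtain ⟨c, hgc⟩ := hspan g hg
  have h1 := hle c
  rw [one_mulVec, gram_form (isCompact_closedBall _ _) hcb] at h1
  simp only [← hgc] at h1
  have h2 : g y ^ 2 ≤ (∑ i, c i ^ 2) * ∑ i, b i y ^ 2 := by
    rw [hgc]
    exact Finset.sum_mul_sq_le_sq_mul_sq _ _ _
  have h3 : ∑ i, b i y ^ 2 ≤ |M| + 1 := by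
    have := (le_abs_self _).trans (hM y hy)
    linarith [le_abs_self M]
  have h4 : ∑ i, c i ^ 2 ≤ C * ∫ x in Metric.closedBall (0 : E d) 1, g x ^ 2 := by
    refine le_trans (le_of_eq ?_) h1
    exact Finset.sum_congr rfl fun i _ => sq _
  calc _ ≤ _ := h2
    _ ≤ (C * ∫ x in Metric.closedBall (0 : E d) 1, g x ^ 2) * (|M| + 1) := by
        refine mul_le_mul h4 h3 (Finset.sum_nonneg fun _ _ => sq_nonneg _) ?_
        exact mul_nonneg hC.le (integral_nonneg fun x => sq_nonneg _)
    _ = _ := by ring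

open Pointwise in
lemma setIntegral_closedBall_eq {d : ℕ} (c : E d) {ρ : ℝ} (hρ : 0 < ρ) (f : E d → ℝ) :
    ∫ x in Metric.closedBall c ρ, f x =
      ρ ^ d * ∫ y in Metric.closedBall (0 : E d) 1, f (c + ρ • y) := by
  have h1 := (measurePreserving_add_left (volume : Measure (E d)) c).setIntegral_preimage_emb
    (measurableEmbedding_addLeft c) f (Metric.closedBall c ρ)
  rw [← h1]
  have h2 : (fun x => c + x) ⁻¹' Metric.closedBall c ρ = ρ • Metric.closedBall (0 : E d) 1 := by
    rw [smul_closedBall _ _ zero_le_one]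
    ext x
    simp [abs_of_pos hρ]
  rw [h2, Measure.setIntegral_comp_smul_of_pos volume (fun x => f (c + x)) _ hρ]
  simp only [finrank_euclideanSpace, Fintype.card_fin, smul_eq_mul]
  rw [mul_inv_cancel_left₀ (by positivity)]

/-- The inverse inequality on balls of arbitrary size. -/
lemma exists_sq_le_integral_ball (d k : ℕ) (σ : ℝ) : ∃ C : ℝ, 0 < C ∧
    ∀ (c : E d) (ρ : ℝ), 0 < ρ → ∀ g : E d → ℝ, (fun y => g (c + ρ • y)) ∈ affineFunctions d ^ k →
      ∀ x ∈ Metric.closedBall c (σ * ρ),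
        g x ^ 2 ≤ C / ρ ^ d * ∫ x in Metric.closedBall c ρ, g x ^ 2 := by
  obtain ⟨C, hC, h⟩ := exists_sq_le_integral d k σ
  refine ⟨C, hC, fun c ρ hρ g hg x hx => ?_⟩
  have h1 := h _ hg (ρ⁻¹ • (x - c)) ?_
  · rw [setIntegral_closedBall_eq c hρ]
    simp only [smul_inv_smul₀ hρ.ne', add_sub_cancel] at h1
    refine h1.trans (le_of_eq ?_)
    field_simp
  · rw [mem_closedBall_zero_iff, norm_smul, norm_inv, Real.norm_of_nonneg hρ.le,
      inv_mul_le_iff₀ hρ, mul_comm, ← dist_eq_norm]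
    exact hx

/-! ### Elongation and strain -/

lemma inner_eq_sum {d : ℕ} (x y : E d) : inner ℝ x y = ∑ i, x i * y i := by
  rw [PiLp.inner_apply]
  exact Finset.sum_congr rfl fun i _ => by simp [mul_comm]

/-- The elongation of a segment is controlled by the strain along it. -/
lemma abs_inner_sub_le {d : ℕ} {u : E d → E d} (hu : ContDiff ℝ 1 u) {K : Set (E d)}
    (hK : Convex ℝ K) {s : ℝ} (hs : ∀ z ∈ K, ∀ i j, |strain u z i j| ≤ s) {x y : E d}
    (hx : x ∈ K) (hy : y ∈ K) : |inner ℝ (y - x) (u y - u x)| ≤ d * s * ‖y - x‖ ^ 2 := by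
  set h := y - x with hh
  have hder : ∀ t : ℝ, HasDerivAt (fun t : ℝ => inner ℝ h (u (x + t • h)))
      (inner ℝ h (fderiv ℝ u (x + t • h) h)) t := fun t => by
    have h1 : HasDerivAt (fun t : ℝ => x + t • h) h t := by
      simpa using ((hasDerivAt_id t).smul_const h).const_add x
    have h2 := ((hu.differentiable one_ne_zero (x + t • h)).hasFDerivAt).comp_hasDerivAt t h1
    simpa using (hasDerivAt_const t h).inner ℝ h2
  -- Mean value theorem along the segment, whose interior points stay in `K`.
  obtain ⟨t, ht, he⟩ := exists_hasDerivAt_eq_slope _ _ zero_lt_one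
    (fun t _ => (hder t).continuousAt.continuousWithinAt) fun t _ => hder t
  have hz : x + t • h ∈ K := by
    have := hK.add_smul_sub_mem hx hy (Set.Ioo_subset_Icc_self ht)
    exact this
  have e1 : inner ℝ h (u y - u x) = inner ℝ h (fderiv ℝ u (x + t • h) h) := by
    rw [he]
    simp [hh, inner_sub_right]
  have e2 : inner ℝ h (fderiv ℝ u (x + t • h) h) =
      ∑ i, ∑ j, strain u (x + t • h) i j * (h i * h j) := by
    have e3 : h = ∑ j, h j • EuclideanSpace.single j (1 : ℝ) := by
      ext j
      simp [Pi.single_apply]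
    have e4 : ∀ (D : E d →L[ℝ] E d) (i : Fin d), D h i =
        ∑ j, h j * D (EuclideanSpace.single j 1) i := fun D i => by
      conv_lhs => rw [e3, map_sum]
      simp
    -- Exchanging the indices does not change `hᵀ ∇u h`, so only the symmetric part of the gradient
    -- contributes.
    have e5 : ∑ i, ∑ j, fderiv ℝ u (x + t • h) (EuclideanSpace.single j 1) i * (h i * h j) =
        ∑ i, ∑ j, fderiv ℝ u (x + t • h) (EuclideanSpace.single i 1) j * (h i * h j) := by
      rw [Finset.sum_comm]
      exact Finset.sum_congr rfl fun i _ => Finset.sum_congr rfl fun j _ => by ring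
    have e6 : ∑ i, ∑ j, strain u (x + t • h) i j * (h i * h j) =
        (∑ i, ∑ j, fderiv ℝ u (x + t • h) (EuclideanSpace.single j 1) i * (h i * h j)) / 2 +
        (∑ i, ∑ j, fderiv ℝ u (x + t • h) (EuclideanSpace.single i 1) j * (h i * h j)) / 2 := by
      simp only [Finset.sum_div, ← Finset.sum_add_distrib]
      exact Finset.sum_congr rfl fun i _ => Finset.sum_congr rfl fun j _ => by
        simp only [strain, Matrix.of_apply]
        ring
    rw [e6, ← e5, add_halves, inner_eq_sum]
    refine Finset.sum_congr rfl fun i _ => ?_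
    rw [e4, Finset.mul_sum]
    exact Finset.sum_congr rfl fun j _ => by ring
  have hs0 : 0 ≤ (d : ℝ) * s := by
    rcases Nat.eq_zero_or_pos d with h0 | h0
    · subst h0
      simp
    · exact mul_nonneg (Nat.cast_nonneg _) ((abs_nonneg _).trans (hs x hx ⟨0, h0⟩ ⟨0, h0⟩))
  rw [e1, e2]
  calc _ ≤ ∑ i, ∑ j, |strain u (x + t • h) i j * (h i * h j)| :=
        (Finset.abs_sum_le_sum_abs _ _).trans
          (Finset.sum_le_sum fun i _ => Finset.abs_sum_le_sum_abs _ _)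
    _ ≤ ∑ i, ∑ j, s * (|h i| * |h j|) := by
        refine Finset.sum_le_sum fun i _ => Finset.sum_le_sum fun j _ => ?_
        rw [abs_mul, abs_mul]
        exact mul_le_mul_of_nonneg_right (hs _ hz i j) (by positivity)
    _ = s * (∑ i, |h i|) ^ 2 := by
        rw [sq, Finset.sum_mul_sum]
        simp only [Finset.mul_sum]
    _ ≤ d * s * ‖h‖ ^ 2 := by
        have h1 := sq_sum_le_card_mul_sum_sq (s := Finset.univ) (f := fun i : Fin d => |h i|)
        rw [Finset.card_univ, Fintype.card_fin] at h1
        simp only [sq_abs] at h1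
        have h2 : ‖h‖ ^ 2 = ∑ i, h i ^ 2 := by
          rw [EuclideanSpace.norm_sq_eq]
          simp
        rw [h2]
        rcases Nat.eq_zero_or_pos d with h0 | h0
        · subst h0
          simp
        · have hs1 : 0 ≤ s := (abs_nonneg _).trans (hs x hx ⟨0, h0⟩ ⟨0, h0⟩)
          calc _ ≤ s * (d * ∑ i, h i ^ 2) := mul_le_mul_of_nonneg_left h1 hs1
            _ = _ := by ring

/-- Only elongations are controlled, not mixed products. The symmetrised product of `i` and `j`
equals the two diagonal products minus the product of the differences, hence is at most `3 s`. -/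
lemma abs_inner_sum_le {V α : Type*} [NormedAddCommGroup V] [InnerProductSpace ℝ V] (F : Finset α)
    (p v : α → V) {s : ℝ} (h1 : ∀ i ∈ F, |inner ℝ (p i) (v i)| ≤ s)
    (h2 : ∀ i ∈ F, ∀ j ∈ F, |inner ℝ (p i - p j) (v i - v j)| ≤ s) :
    |inner ℝ (∑ i ∈ F, p i) (∑ i ∈ F, v i)| ≤ 3 / 2 * (F.card : ℝ) ^ 2 * s := by
  have e1 : inner ℝ (∑ i ∈ F, p i) (∑ i ∈ F, v i) = ∑ i ∈ F, ∑ j ∈ F, inner ℝ (p i) (v j) := by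
    rw [sum_inner]
    exact Finset.sum_congr rfl fun i _ => inner_sum _ _ _
  have e2 : 2 * inner ℝ (∑ i ∈ F, p i) (∑ i ∈ F, v i) = ∑ i ∈ F, ∑ j ∈ F,
      (inner ℝ (p i) (v i) + inner ℝ (p j) (v j) - inner ℝ (p i - p j) (v i - v j)) := by
    rw [two_mul]
    nth_rewrite 1 [e1]
    rw [e1.trans Finset.sum_comm, ← Finset.sum_add_distrib]
    refine Finset.sum_congr rfl fun i _ => ?_
    rw [← Finset.sum_add_distrib]
    refine Finset.sum_congr rfl fun j _ => ?_
    simp only [inner_sub_left, inner_sub_right]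
    ring
  have e3 : |2 * inner ℝ (∑ i ∈ F, p i) (∑ i ∈ F, v i)| ≤ ∑ i ∈ F, ∑ j ∈ F, 3 * s := by
    rw [e2]
    refine (Finset.abs_sum_le_sum_abs _ _).trans (Finset.sum_le_sum fun i hi => ?_)
    refine (Finset.abs_sum_le_sum_abs _ _).trans (Finset.sum_le_sum fun j hj => ?_)
    have a1 := abs_le.1 (h1 i hi)
    have a2 := abs_le.1 (h1 j hj)
    have a3 := abs_le.1 (h2 i hi j hj)
    rw [abs_le]
    constructor <;> linarith
  rw [abs_mul, abs_two] at e3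
  simp only [Finset.sum_const, nsmul_eq_mul] at e3
  linarith

/-! ### Barycentric coordinates and the geometry of an element -/

namespace Mesh

variable {d : ℕ} {m : Mesh d}

namespace Element

variable (T : m.Element)

lemma exists_bary_eq (z : E d) : ∃ (L : E d →L[ℝ] ℝ) (a : ℝ), ∀ x, T.bary z x = L x + a := by
  obtain ⟨f, hf⟩ := T.exists_affine_bary z
  refine ⟨LinearMap.toContinuousLinearMap f.linear, f 0, fun x => ?_⟩
  rw [hf]
  have := congr_fun f.decomp x
  simpa using this

lemma sum_bary (x : E d) : ∑ z ∈ T.1, T.bary z x = 1 := by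
  rw [← Finset.sum_coe_sort, ← T.affineBasis.sum_coord_apply_eq_one x]
  exact Finset.sum_congr rfl fun z _ => T.bary_of_mem z.2 x

lemma sum_bary_smul (x : E d) : ∑ z ∈ T.1, T.bary z x • z = x := by
  rw [← Finset.sum_coe_sort T.1 fun z => T.bary z x • z]
  conv_rhs => rw [← T.affineBasis.linear_combination_coord_eq_self x]
  exact Finset.sum_congr rfl fun z _ => by
    rw [T.bary_of_mem z.2]
    rfl

lemma bary_vertex {z y : E d} (hz : z ∈ T.1) (hy : y ∈ T.1) :
    T.bary z y = if z = y then 1 else 0 := by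
  classical
  have h := T.affineBasis.coord_apply ⟨z, hz⟩ ⟨y, hy⟩
  rw [T.bary_of_mem hz]
  have e : T.affineBasis ⟨y, hy⟩ = y := rfl
  rw [e] at h
  rw [h]
  simp [Subtype.ext_iff]

lemma bary_nonneg {x : E d} (hx : x ∈ T.carrier) (z : E d) : 0 ≤ T.bary z x := by
  by_cases hz : z ∈ T.1
  · rw [T.bary_of_mem hz]
    have h := T.affineBasis.convexHull_eq_nonneg_coord
    have e : Set.range T.affineBasis = (T.1 : Set (E d)) := by
      have : (T.affineBasis : T.1 → E d) = Subtype.val := rfl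
      rw [this, Subtype.range_coe_subtype]
      rfl
    rw [e] at h
    have hx' : x ∈ convexHull ℝ (T.1 : Set (E d)) := hx
    rw [h] at hx'
    exact hx' ⟨z, hz⟩
  · rw [T.bary_of_notMem hz]

lemma bary_le_one {x : E d} (hx : x ∈ T.carrier) (z : E d) : T.bary z x ≤ 1 := by
  by_cases hz : z ∈ T.1
  · rw [← T.sum_bary x]
    exact Finset.single_le_sum (f := fun z => T.bary z x) (fun y _ => T.bary_nonneg hx y) hz
  · rw [T.bary_of_notMem hz]
    exact zero_le_one

lemma vertex_mem {z : E d} (hz : z ∈ T.1) : z ∈ T.carrier :=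
  subset_convexHull ℝ _ (Finset.mem_coe.2 hz)

lemma bary_average {F : Finset (E d)} (hF : F.card = d) (hd : d ≠ 0) (z : E d) :
    T.bary z ((1 / d : ℝ) • ∑ y ∈ F, y) = 1 / d * ∑ y ∈ F, T.bary z y := by
  obtain ⟨L, a, h⟩ := T.exists_bary_eq z
  have hd' : (d : ℝ) ≠ 0 := Nat.cast_ne_zero.2 hd
  simp only [h, map_smul, map_sum, smul_eq_mul, Finset.sum_add_distrib, Finset.sum_const, hF,
    nsmul_eq_mul]
  field_simp

/-- The gradient of a barycentric coordinate is at most the inverse diameter of an inscribed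
ball. -/
lemma abs_linear_le {c : E d} {ρ : ℝ} (hρ : 0 < ρ) (hB : Metric.closedBall c ρ ⊆ T.carrier)
    {z : E d} {L : E d →L[ℝ] ℝ} {a : ℝ} (h : ∀ x, T.bary z x = L x + a) {v : E d}
    (hv : ‖v‖ = 1) : |L v| ≤ 1 / (2 * ρ) := by
  have hp : c + ρ • v ∈ T.carrier := hB (by simp [norm_smul, hv, abs_of_pos hρ])
  have hm : c - ρ • v ∈ T.carrier := hB (by simp [norm_smul, hv, abs_of_pos hρ])
  have e : 2 * ρ * L v = T.bary z (c + ρ • v) - T.bary z (c - ρ • v) := by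
    simp only [h, map_add, map_sub, map_smul, smul_eq_mul]
    ring
  rw [le_div_iff₀ (by positivity), ← abs_of_pos (by positivity : 0 < 2 * ρ), ← abs_mul, mul_comm,
    e, abs_le]
  constructor <;> linarith [T.bary_nonneg hp z, T.bary_le_one hp z, T.bary_nonneg hm z,
    T.bary_le_one hm z]

lemma exists_opposite {F : Finset (E d)} (hF : F.card = d) (hFT : F ⊆ T.1) :
    ∃ z ∈ T.1, z ∉ F ∧ ∀ y ∈ T.1, y ∉ F → y = z := by
  have h : (T.1 \ F).card = 1 := by
    rw [Finset.card_sdiff_of_subset hFT, T.2.2, hF]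
    omega
  obtain ⟨z, hz⟩ := Finset.card_eq_one.1 h
  have hz' : z ∈ T.1 \ F := by
    rw [hz]
    exact Finset.mem_singleton_self z
  rw [Finset.mem_sdiff] at hz'
  refine ⟨z, hz'.1, hz'.2, fun y hy hyF => ?_⟩
  have : y ∈ T.1 \ F := Finset.mem_sdiff.2 ⟨hy, hyF⟩
  rw [hz] at this
  exact Finset.mem_singleton.1 this

/-- The height of an element over a facet is at least the diameter of an inscribed ball. -/
lemma height_ge {c : E d} {ρ : ℝ} (hρ : 0 < ρ) (hB : Metric.closedBall c ρ ⊆ T.carrier)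
    {F : Finset (E d)} (hFd : F.card = d) {n : E d} (hn : ‖n‖ = 1)
    (horth : ∀ x ∈ F, ∀ y ∈ F, inner ℝ n (x - y) = 0) (hd : d ≠ 0) {z : E d} (hz : z ∈ T.1)
    (hop : ∀ y ∈ T.1, y ∉ F → y = z) :
    2 * ρ ≤ |inner ℝ n ((1 / d : ℝ) • ∑ y ∈ F, y - z)| := by
  have hd' : (d : ℝ) ≠ 0 := Nat.cast_ne_zero.2 hd
  set a := (1 / d : ℝ) • ∑ y ∈ F, y with ha
  have hF0 : ∀ y ∈ F, inner ℝ n (y - a) = 0 := fun y hy => by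
    have e : y - a = (1 / d : ℝ) • ∑ x ∈ F, (y - x) := by
      rw [Finset.sum_sub_distrib, Finset.sum_const, hFd, smul_sub, ha, ← Nat.cast_smul_eq_nsmul ℝ,
        smul_smul, one_div_mul_cancel hd', one_smul]
    rw [e, inner_smul_right, inner_sum, Finset.sum_eq_zero fun x hx => horth y hy x hx, mul_zero]
  -- Above the facet plane the signed height is `λ_z` times the height of `z`. Along the diameter of
  -- the ball in direction `n` it changes by `2ρ`, while `λ_z` changes by at most `1`.
  have key : ∀ x, inner ℝ n (x - a) = T.bary z x * inner ℝ n (z - a) := fun x => by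
    have e : x - a = ∑ y ∈ T.1, T.bary y x • (y - a) := by
      simp only [smul_sub, Finset.sum_sub_distrib, T.sum_bary_smul, ← Finset.sum_smul, T.sum_bary,
        one_smul]
    rw [e, inner_sum, Finset.sum_eq_single z]
    · rw [inner_smul_right]
    · intro y hy hyz
      have hyF : y ∈ F := by
        by_contra hyF
        exact hyz (hop y hy hyF)
      rw [inner_smul_right, hF0 y hyF, mul_zero]
    · exact fun h => absurd hz h
  have hp : c + ρ • n ∈ T.carrier := hB (by simp [norm_smul, hn, abs_of_pos hρ])
  have hm : c - ρ • n ∈ T.carrier := hB (by simp [norm_smul, hn, abs_of_pos hρ])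
  have e : 2 * ρ = (T.bary z (c + ρ • n) - T.bary z (c - ρ • n)) * inner ℝ n (z - a) := by
    rw [sub_mul, ← key, ← key, ← inner_sub_right]
    have : c + ρ • n - a - (c - ρ • n - a) = (2 * ρ) • n := by module
    rw [this, inner_smul_right, real_inner_self_eq_norm_sq, hn]
    ring
  have hle : |T.bary z (c + ρ • n) - T.bary z (c - ρ • n)| ≤ 1 := by
    rw [abs_le]
    constructor <;> linarith [T.bary_nonneg hp z, T.bary_le_one hp z, T.bary_nonneg hm z,
      T.bary_le_one hm z]
  rw [← neg_sub z a, inner_neg_right, abs_neg]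
  calc 2 * ρ = |2 * ρ| := (abs_of_pos (by positivity)).symm
    _ = |T.bary z (c + ρ • n) - T.bary z (c - ρ • n)| * |inner ℝ n (z - a)| := by
        rw [e, abs_mul]
    _ ≤ 1 * |inner ℝ n (z - a)| := by gcongr
    _ = _ := one_mul _

end Element

end Mesh

/-! ### Strains and point values of the basis fields -/

lemma strain_smul_const {d : ℕ} {g : E d → ℝ} {g' : E d →L[ℝ] ℝ} {x : E d}
    (hg : HasFDerivAt g g' x) (v : E d) (i j : Fin d) :
    strain (fun y => g y • v) x i j =
      (g' (EuclideanSpace.single j 1) * v i + g' (EuclideanSpace.single i 1) * v j) / 2 := by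
  have h : fderiv ℝ (fun y => g y • v) x = g'.smulRight v := (hg.smul_const v).fderiv
  simp [strain, h]

namespace Mesh

variable {d : ℕ} {m : Mesh d}

lemma strain_bubble (F : m.FreeFacet) (T : m.Element) {L : E d → E d →L[ℝ] ℝ} {a : E d → ℝ}
    (h : ∀ z x, T.bary z x = L z x + a z) (x : E d) (i j : Fin d) :
    strain (m.bubble F T) x i j = open Classical in ∑ z ∈ F.1,
      ((L z (EuclideanSpace.single j 1) * m.normal F.1 i +
        L z (EuclideanSpace.single i 1) * m.normal F.1 j) / 2) *
        ∏ y ∈ F.1.erase z, T.bary y x := by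
  classical
  have hd : ∀ z ∈ F.1, HasFDerivAt (T.bary z) (L z) x := fun z _ => by
    have e : T.bary z = fun x => L z x + a z := funext (h z)
    rw [e]
    exact (L z).hasFDerivAt.add_const _
  have h1 := HasFDerivAt.finsetProd hd
  have h2 := strain_smul_const h1 (m.normal F.1) i j
  refine h2.trans ?_
  simp only [_root_.sum_apply, _root_.smul_apply, smul_eq_mul, Finset.sum_mul,
    ← Finset.sum_add_distrib, Finset.sum_div]
  exact Finset.sum_congr rfl fun z _ => by ring

lemma strain_hat (k : m.FreeVertex × Fin d) (T : m.Element) (i j : Fin d) :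
    ∃ b : ℝ, ∀ x, strain (m.hat k T) x i j = b := by
  obtain ⟨L, a, h⟩ := T.exists_bary_eq k.1.1
  refine ⟨_, fun x => strain_smul_const (g' := L) ?_ (EuclideanSpace.single k.2 1) i j⟩
  have e : T.bary k.1.1 = fun x => L x + a := funext h
  rw [e]
  exact L.hasFDerivAt.add_const _

/-- Bubbles have degree `d` and hats degree `1`, so strains have degree at most `d - 1`. The
substitution `c + ρ y` preserves this, which gives one inverse inequality for all elements. -/
lemma strain_disp_mem (u : m.DispIdx → ℝ) (T : m.Element) (c : E d) (ρ : ℝ) (i j : Fin d) :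
    (fun y => strain (m.disp u T) (c + ρ • y) i j) ∈ affineFunctions d ^ (d - 1) := by
  classical
  have e : (fun y => strain (m.disp u T) (c + ρ • y) i j) =
      ∑ k, u k • fun y => strain (m.dispBasis k T) (c + ρ • y) i j := by
    funext y
    simp only [Finset.sum_apply, Pi.smul_apply, smul_eq_mul]
    exact strain_sum (fun k => contDiff_dispBasis k T) u _ i j
  rw [e]
  refine Submodule.sum_mem _ fun k _ => Submodule.smul_mem _ _ ?_
  rcases k with F | k
  · choose L a h using T.exists_bary_eq
    have e2 : (fun y => strain (m.dispBasis (Sum.inl F) T) (c + ρ • y) i j) = ∑ z ∈ F.1,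
        ((L z (EuclideanSpace.single j 1) * m.normal F.1 i +
          L z (EuclideanSpace.single i 1) * m.normal F.1 j) / 2) •
          ∏ y ∈ F.1.erase z, fun x => T.bary y (c + ρ • x) := by
      funext y
      simp only [Finset.sum_apply, Pi.smul_apply, smul_eq_mul, Finset.prod_apply]
      refine (strain_bubble F T h (c + ρ • y) i j).trans ?_
      exact Finset.sum_congr rfl fun z _ => by congr!
    rw [e2]
    refine Submodule.sum_mem _ fun z hz => Submodule.smul_mem _ _ ?_
    have h3 := prod_mem_affineFunctions_pow (F.1.erase z)
      (fun y x => T.bary y (c + ρ • x)) fun y _ => by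
        have e3 : (fun x => T.bary y (c + ρ • x)) = fun x => (ρ • L y) x + (L y c + a y) := by
          funext x
          simp only [h, map_add, map_smul, _root_.smul_apply, smul_eq_mul]
          ring
        rw [e3]
        exact affine_mem_affineFunctions _ _
    rwa [Finset.card_erase_of_mem hz, F.2.2.1] at h3
  · obtain ⟨b, hb⟩ := strain_hat k T i j
    have e2 : (fun y => strain (m.dispBasis (Sum.inr k) T) (c + ρ • y) i j) =
        b • (1 : E d → ℝ) := by
      funext y
      simpa [dispBasis] using hb (c + ρ • y)
    rw [e2]
    exact Submodule.smul_mem _ _ (one_mem_affineFunctions_pow d _)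

lemma abs_normal_le (F : m.FreeFacet) (i : Fin d) : |m.normal F.1 i| ≤ 1 := by
  rw [← m.norm_normal F.1 F.2.1 F.2.2.1, ← Real.norm_eq_abs]
  exact PiLp.norm_apply_le _ i

/-- The product rule has `d` terms, each gradient at most `1/(2ρ)` and each remaining factor at most
`1`; then the `d²` squared entries are summed. -/
lemma strainSq_bubble_le (F : m.FreeFacet) (T : m.Element) {c : E d} {ρ : ℝ} (hρ : 0 < ρ)
    (hB : Metric.closedBall c ρ ⊆ T.carrier) {x : E d} (hx : x ∈ T.carrier) :
    strainSq (m.bubble F T) x ≤ (d : ℝ) ^ 4 / (4 * ρ ^ 2) := by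
  classical
  choose L a h using T.exists_bary_eq
  have hL : ∀ z i, |L z (EuclideanSpace.single i 1)| ≤ 1 / (2 * ρ) := fun z i =>
    T.abs_linear_le hρ hB (h z) (by simp)
  have h1 : ∀ i j, |strain (m.bubble F T) x i j| ≤ d / (2 * ρ) := fun i j => by
    rw [strain_bubble F T h]
    refine (Finset.abs_sum_le_sum_abs _ _).trans ?_
    calc _ ≤ ∑ z ∈ F.1, 1 / (2 * ρ) := by
          refine Finset.sum_le_sum fun z _ => ?_
          rw [abs_mul]
          have e1 : |∏ y ∈ F.1.erase z, T.bary y x| ≤ 1 := by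
            rw [abs_of_nonneg (Finset.prod_nonneg fun y _ => T.bary_nonneg hx y)]
            exact Finset.prod_le_one (fun y _ => T.bary_nonneg hx y) fun y _ => T.bary_le_one hx y
          have e2 : ∀ i j, |L z (EuclideanSpace.single j 1) * m.normal F.1 i| ≤ 1 / (2 * ρ) :=
            fun i j => by
              rw [abs_mul, ← mul_one (1 / (2 * ρ))]
              exact mul_le_mul (hL z j) (abs_normal_le F i) (abs_nonneg _) (by positivity)
          have e3 : |(L z (EuclideanSpace.single j 1) * m.normal F.1 i +
              L z (EuclideanSpace.single i 1) * m.normal F.1 j) / 2| ≤ 1 / (2 * ρ) := by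
            rw [abs_div, abs_two, div_le_iff₀ two_pos]
            refine (abs_add_le _ _).trans ?_
            linarith [e2 i j, e2 j i]
          calc _ ≤ 1 / (2 * ρ) * 1 := by
                refine mul_le_mul e3 ?_ (abs_nonneg _) (by positivity)
                convert e1
            _ = _ := mul_one _
      _ = d / (2 * ρ) := by
          rw [Finset.sum_const, F.2.2.1, nsmul_eq_mul]
          ring
  calc _ ≤ ∑ i : Fin d, ∑ j : Fin d, (d / (2 * ρ)) ^ 2 :=
        Finset.sum_le_sum fun i _ => Finset.sum_le_sum fun j _ =>
          sq_le_sq' (by linarith [(abs_le.1 (h1 i j)).1]) (abs_le.1 (h1 i j)).2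
    _ = _ := by
        simp only [Finset.sum_const, Finset.card_univ, Fintype.card_fin, nsmul_eq_mul]
        field_simp
        ring

lemma disp_apply (u : m.DispIdx → ℝ) (T : m.Element) (x : E d) :
    m.disp u T x = ∑ F, u (Sum.inl F) • m.bubble F T x + ∑ i, u (Sum.inr i) • m.hat i T x :=
  Fintype.sum_sum_type _

/-- As `d ≥ 2`, a facet has a vertex other than `z`, whose barycentric coordinate vanishes at `z`.
-/
lemma bubble_vertex (hd : 2 ≤ d) (F : m.FreeFacet) (T : m.Element) {z : E d} (hz : z ∈ T.1) :
    m.bubble F T z = 0 := by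
  obtain ⟨y, hy, hyz⟩ : ∃ y ∈ F.1, y ≠ z := by
    refine Finset.exists_mem_ne ?_ z
    rw [F.2.2.1]
    omega
  have h0 : T.bary y z = 0 := by
    by_cases hyT : y ∈ T.1
    · rw [T.bary_vertex hyT hz, if_neg hyz]
    · exact T.bary_of_notMem hyT z
  rw [bubble, Finset.prod_eq_zero hy h0, zero_smul]

lemma bubble_average (hd : d ≠ 0) (F G : m.FreeFacet) (T : m.Element) (hF : F.1 ⊆ T.1) :
    m.bubble G T ((1 / d : ℝ) • ∑ y ∈ F.1, y) =
      if G = F then (1 / d : ℝ) ^ d • m.normal F.1 else 0 := by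
  by_cases hG : G = F
  · subst hG
    rw [if_pos rfl, bubble]
    congr 1
    have hcard := Finset.prod_eq_pow_card (s := G.1)
      (f := fun z => T.bary z ((1 / d : ℝ) • ∑ y ∈ G.1, y)) (b := 1 / (d : ℝ)) fun z hz => ?_
    · rwa [G.2.2.1] at hcard
    rw [T.bary_average G.2.2.1 hd, Finset.sum_eq_single_of_mem z hz, T.bary_vertex (hF hz) (hF hz),
      if_pos rfl, mul_one]
    intro y hy hyz
    rw [T.bary_vertex (hF hz) (hF hy), if_neg hyz.symm]
  · rw [if_neg hG]
    obtain ⟨z, hzG, hzF⟩ : ∃ z ∈ G.1, z ∉ F.1 := by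
      by_contra hcon
      push Not at hcon
      refine hG (Subtype.ext (Finset.eq_of_subset_of_card_le hcon ?_))
      rw [F.2.2.1, G.2.2.1]
    have h0 : T.bary z ((1 / d : ℝ) • ∑ y ∈ F.1, y) = 0 := by
      by_cases hzT : z ∈ T.1
      · rw [T.bary_average F.2.2.1 hd, Finset.sum_eq_zero, mul_zero]
        intro y hy
        rw [T.bary_vertex hzT (hF hy), if_neg]
        rintro rfl
        exact hzF hy
      · exact T.bary_of_notMem hzT _
    rw [bubble, Finset.prod_eq_zero hzG h0, zero_smul]

/-- At the barycentre of a facet only the bubble of that facet deviates from the linear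
interpolant. -/
lemma disp_average (hd : 2 ≤ d) (u : m.DispIdx → ℝ) (F : m.FreeFacet) (T : m.Element)
    (hF : F.1 ⊆ T.1) :
    m.disp u T ((1 / d : ℝ) • ∑ y ∈ F.1, y) = (1 / d : ℝ) • ∑ y ∈ F.1, m.disp u T y +
      (u (Sum.inl F) * (1 / d : ℝ) ^ d) • m.normal F.1 := by
  have hd0 : d ≠ 0 := by omega
  have h1 : ∀ y ∈ F.1, m.disp u T y = ∑ i, u (Sum.inr i) • m.hat i T y := fun y hy => by
    rw [disp_apply, Finset.sum_eq_zero, zero_add]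
    intro G _
    rw [bubble_vertex hd G T (hF hy), smul_zero]
  have h2 : ∑ G, u (Sum.inl G) • m.bubble G T ((1 / d : ℝ) • ∑ y ∈ F.1, y) =
      (u (Sum.inl F) * (1 / d : ℝ) ^ d) • m.normal F.1 := by
    simp only [bubble_average hd0 F _ T hF]
    rw [Finset.sum_eq_single F]
    · rw [if_pos rfl, smul_smul]
    · intro G _ hG
      rw [if_neg hG, smul_zero]
    · simp
  have h3 : ∀ i, m.hat i T ((1 / d : ℝ) • ∑ y ∈ F.1, y) =
      (1 / d : ℝ) • ∑ y ∈ F.1, m.hat i T y := fun i => by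
    simp only [hat]
    rw [T.bary_average F.2.2.1 hd0, ← Finset.sum_smul, smul_smul]
  have h4 : (1 / d : ℝ) • ∑ y ∈ F.1, m.disp u T y =
      ∑ i, u (Sum.inr i) • m.hat i T ((1 / d : ℝ) • ∑ y ∈ F.1, y) := by
    rw [Finset.sum_congr rfl h1, Finset.sum_comm, Finset.smul_sum]
    refine Finset.sum_congr rfl fun i _ => ?_
    rw [h3, ← Finset.smul_sum, smul_comm]
  rw [h4, disp_apply, h2, add_comm]

/-- The bubble coefficients are controlled by the maximal strain. -/
lemma abs_coeff_le (hd : 2 ≤ d) (u : m.DispIdx → ℝ) (F : m.FreeFacet) (T : m.Element)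
    (hF : F.1 ⊆ T.1) {c : E d} {ρ : ℝ} (hρ : 0 < ρ) (hB : Metric.closedBall c ρ ⊆ T.carrier)
    {s : ℝ} (hs : ∀ z ∈ T.carrier, ∀ i j, |strain (m.disp u T) z i j| ≤ s) :
    |u (Sum.inl F)| * (1 / d : ℝ) ^ d * (2 * ρ) ≤
      5 / 2 * (d * s * Metric.diam T.carrier ^ 2) := by
  have hd0 : d ≠ 0 := by omega
  have hd' : (d : ℝ) ≠ 0 := Nat.cast_ne_zero.2 hd0
  obtain ⟨z, hz, hzF, hop⟩ := T.exists_opposite F.2.2.1 hF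
  have hheight := T.height_ge hρ hB F.2.2.1 (m.norm_normal F.1 F.2.1 F.2.2.1)
    (m.normal_orthogonal F.1 F.2.1 F.2.2.1) hd0 hz hop
  have havg := disp_average hd u F T hF
  set v := m.disp u T with hv
  set a := (1 / d : ℝ) • ∑ y ∈ F.1, y with ha
  set S := d * s * Metric.diam T.carrier ^ 2 with hS
  have hs0 : 0 ≤ s := (abs_nonneg _).trans (hs z (T.vertex_mem hz) ⟨0, by omega⟩ ⟨0, by omega⟩)
  have hq : ∀ x ∈ T.carrier, ∀ y ∈ T.carrier, |inner ℝ (y - x) (v y - v x)| ≤ S :=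
    fun x hx y hy => by
      refine (abs_inner_sub_le (contDiff_disp u T) T.convex_carrier hs hx hy).trans ?_
      have : ‖y - x‖ ≤ Metric.diam T.carrier := by
        rw [← dist_eq_norm]
        exact Metric.dist_le_diam_of_mem T.isCompact_carrier.isBounded hy hx
      rw [hS]
      gcongr
  have haT : a ∈ T.carrier := by
    rw [ha, Finset.smul_sum]
    refine T.convex_carrier.sum_mem (fun _ _ => by positivity) ?_ fun y hy => T.vertex_mem (hF hy)
    rw [Finset.sum_const, F.2.2.1, nsmul_eq_mul]
    field_simp
  have e1 : a - z = (1 / d : ℝ) • ∑ y ∈ F.1, (y - z) := by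
    rw [Finset.sum_sub_distrib, Finset.sum_const, F.2.2.1, smul_sub, ← ha,
      ← Nat.cast_smul_eq_nsmul ℝ, smul_smul, one_div_mul_cancel hd', one_smul]
  have e2 : v a - v z = (1 / d : ℝ) • ∑ y ∈ F.1, (v y - v z) +
      (u (Sum.inl F) * (1 / d : ℝ) ^ d) • m.normal F.1 := by
    rw [havg, Finset.sum_sub_distrib, Finset.sum_const, F.2.2.1, smul_sub,
      ← Nat.cast_smul_eq_nsmul ℝ, smul_smul, one_div_mul_cancel hd', one_smul]
    abel
  have h1 := hq z (T.vertex_mem hz) a haT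
  -- The linear interpolant costs `3/2`; with the elongation between `a` and `z` itself this makes
  -- the final `5/2`.
  have h2 : |inner ℝ (a - z) ((1 / d : ℝ) • ∑ y ∈ F.1, (v y - v z))| ≤ 3 / 2 * S := by
    have h3 := abs_inner_sum_le F.1 (fun y => y - z) (fun y => v y - v z) (s := S)
      (fun y hy => hq z (T.vertex_mem hz) y (T.vertex_mem (hF hy)))
      (fun x hx y hy => by
        simp only [sub_sub_sub_cancel_right]
        exact hq y (T.vertex_mem (hF hy)) x (T.vertex_mem (hF hx)))
    rw [e1, inner_smul_left, inner_smul_right, abs_mul, abs_mul]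
    rw [F.2.2.1] at h3
    have hp : |(1 / d : ℝ)| = 1 / d := abs_of_nonneg (by positivity)
    simp only [conj_trivial, hp]
    calc _ ≤ (1 / d : ℝ) * (1 / d * (3 / 2 * (d : ℝ) ^ 2 * S)) := by gcongr
      _ = _ := by field_simp
  rw [e2, inner_add_right, inner_smul_right _ (m.normal F.1)] at h1
  have h4 : |u (Sum.inl F) * (1 / d : ℝ) ^ d * inner ℝ (a - z) (m.normal F.1)| ≤ 5 / 2 * S := by
    have a1 := abs_le.1 h1
    have a2 := abs_le.1 h2
    rw [abs_le]
    constructor <;> linarith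
  rw [real_inner_comm] at h4
  calc _ ≤ |u (Sum.inl F)| * (1 / d : ℝ) ^ d * |inner ℝ (m.normal F.1) (a - z)| := by gcongr
    _ = _ := by
        rw [abs_mul, abs_mul, abs_of_nonneg (by positivity : 0 ≤ (1 / d : ℝ) ^ d)]
    _ ≤ _ := h4

lemma Element.diam_pos (T : m.Element) (hd : d ≠ 0) : 0 < Metric.diam T.carrier := by
  refine Metric.diam_pos ?_ T.isCompact_carrier.isBounded
  obtain ⟨x, hx, y, hy, hxy⟩ := Finset.one_lt_card.1 (show 1 < T.1.card by
    rw [T.2.2]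
    omega)
  exact ⟨x, T.vertex_mem hx, y, T.vertex_mem hy, hxy⟩

/-- On shape regular elements the splitting into bubbles and linear fields is stable. -/
theorem exists_bubble_stability (hd : 2 ≤ d) {σ : ℝ} (hσ : 0 < σ) : ∃ C : ℝ, 0 ≤ C ∧
    ∀ (m : Mesh d), m.ShapeRegular σ → ∀ (T : m.Element) (u : m.DispIdx → ℝ) (F : m.FreeFacet),
      u (Sum.inl F) ^ 2 * ∫ x in T.carrier, strainSq (m.bubble F T) x ≤
        C * ∫ x in T.carrier, strainSq (m.disp u T) x := by
  have hd0 : d ≠ 0 := by omega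
  have hd' : (0 : ℝ) < d := by positivity
  obtain ⟨C₀, hC₀, hinv⟩ := exists_sq_le_integral_ball d (d - 1) σ
  set ω := volume.real (Metric.ball (0 : E d) 1) with hω
  have hω0 : 0 ≤ ω := measureReal_nonneg
  -- The product of the bounds for the squared coefficient and for the bubble energy; the powers of
  -- the inradius `ρ` cancel.
  refine ⟨25 / 64 * d ^ 6 * ((d : ℝ) ^ d) ^ 2 * σ ^ 4 * σ ^ d * ω * C₀, by positivity,
    fun m hm T u F => ?_⟩
  obtain ⟨c, hB⟩ := hm T
  have hh := T.diam_pos hd0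
  obtain ⟨ρ, hρdef⟩ : ∃ ρ, ρ = Metric.diam T.carrier / σ := ⟨_, rfl⟩
  have hρ : 0 < ρ := by
    rw [hρdef]
    positivity
  have hdiam : Metric.diam T.carrier = σ * ρ := by
    rw [hρdef]
    field_simp
  rw [← hρdef] at hB
  have hsub : T.carrier ⊆ Metric.closedBall c (σ * ρ) := fun x hx => by
    rw [Metric.mem_closedBall, ← hdiam]
    exact Metric.dist_le_diam_of_mem T.isCompact_carrier.isBounded hx
      (hB (Metric.mem_closedBall_self hρ.le))
  have hcv := contDiff_disp u T
  set I := ∫ x in T.carrier, strainSq (m.disp u T) x with hI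
  have hI0 : 0 ≤ I := integral_nonneg fun x => strainSq_nonneg _ x
  by_cases hF : F.1 ⊆ T.1
  swap
  · rw [bubble_eq_zero hF]
    have : ∀ x, strainSq (0 : E d → E d) x = 0 := fun x => by simp [strainSq, strain]
    simp only [this, integral_zero, mul_zero]
    positivity
  have hs : ∀ z ∈ T.carrier, ∀ i j, |strain (m.disp u T) z i j| ≤ √(C₀ / ρ ^ d * I) :=
    fun z hz i j => by
      refine Real.abs_le_sqrt ((hinv c ρ hρ (fun x => strain (m.disp u T) x i j)
        (strain_disp_mem u T c ρ i j) z (hsub hz)).trans ?_)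
      refine mul_le_mul_of_nonneg_left ?_ (by positivity)
      calc _ ≤ ∫ x in T.carrier, strain (m.disp u T) x i j ^ 2 :=
            setIntegral_mono_set (T.integrableOn ((continuous_strain hcv i j).pow 2))
              (ae_of_all _ fun x => sq_nonneg _) hB.eventuallyLE
        _ ≤ I := by
            refine setIntegral_mono (T.integrableOn ((continuous_strain hcv i j).pow 2))
              (T.integrableOn (continuous_strainSq hcv)) fun x => ?_
            exact (Finset.single_le_sum (f := fun j => strain (m.disp u T) x i j ^ 2)
              (fun j _ => sq_nonneg _) (Finset.mem_univ j)).trans (Finset.single_le_sum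
              (f := fun i => ∑ j, strain (m.disp u T) x i j ^ 2)
              (fun i _ => Finset.sum_nonneg fun j _ => sq_nonneg _) (Finset.mem_univ i))
  have h1 := abs_coeff_le hd u F T hF hρ hB hs
  rw [hdiam] at h1
  have h2 : u (Sum.inl F) ^ 2 ≤ ((d : ℝ) ^ d) ^ 2 * (25 / 16) * d ^ 2 * (C₀ / ρ ^ d * I) *
      σ ^ 4 * ρ ^ 2 := by
    have h3 : (|u (Sum.inl F)| * (1 / d : ℝ) ^ d * (2 * ρ)) ^ 2 ≤
        (5 / 2 * (d * √(C₀ / ρ ^ d * I) * (σ * ρ) ^ 2)) ^ 2 :=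
      pow_le_pow_left₀ (by positivity) h1 2
    have e1 : (5 / 2 * (d * √(C₀ / ρ ^ d * I) * (σ * ρ) ^ 2)) ^ 2 =
        25 / 4 * d ^ 2 * (C₀ / ρ ^ d * I) * σ ^ 4 * ρ ^ 4 := by
      have := Real.sq_sqrt (show 0 ≤ C₀ / ρ ^ d * I by positivity)
      calc _ = 25 / 4 * d ^ 2 * √(C₀ / ρ ^ d * I) ^ 2 * σ ^ 4 * ρ ^ 4 := by ring
        _ = _ := by rw [this]
    have e2 : (|u (Sum.inl F)| * (1 / d : ℝ) ^ d * (2 * ρ)) ^ 2 =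
        u (Sum.inl F) ^ 2 * (4 * ρ ^ 2 / ((d : ℝ) ^ d) ^ 2) := by
      rw [mul_pow, mul_pow, sq_abs, one_div, inv_pow]
      field_simp
      ring
    rw [e1, e2, ← le_div_iff₀ (by positivity)] at h3
    refine h3.trans (le_of_eq ?_)
    field_simp
    ring
  have h3 : ∫ x in T.carrier, strainSq (m.bubble F T) x ≤
      (d : ℝ) ^ 4 / (4 * ρ ^ 2) * ((σ * ρ) ^ d * ω) := by
    calc _ ≤ ∫ x in T.carrier, (d : ℝ) ^ 4 / (4 * ρ ^ 2) :=
          setIntegral_mono_on (T.integrableOn (continuous_strainSq (contDiff_bubble F T)))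
            (T.integrableOn continuous_const) T.measurableSet_carrier
            fun x hx => strainSq_bubble_le F T hρ hB hx
      _ = volume.real T.carrier * ((d : ℝ) ^ 4 / (4 * ρ ^ 2)) := by
          rw [setIntegral_const, smul_eq_mul]
      _ ≤ volume.real (Metric.closedBall c (σ * ρ)) * ((d : ℝ) ^ 4 / (4 * ρ ^ 2)) := by
          gcongr
          exact measure_closedBall_lt_top.ne
      _ = _ := by
          rw [Measure.addHaar_real_closedBall _ _ (by positivity)]
          simp only [finrank_euclideanSpace, Fintype.card_fin]
          ring
  calc _ ≤ (((d : ℝ) ^ d) ^ 2 * (25 / 16) * d ^ 2 * (C₀ / ρ ^ d * I) * σ ^ 4 * ρ ^ 2) *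
        ((d : ℝ) ^ 4 / (4 * ρ ^ 2) * ((σ * ρ) ^ d * ω)) :=
        mul_le_mul h2 h3 (integral_nonneg fun x => strainSq_nonneg _ x) (by positivity)
    _ = _ := by
        rw [mul_pow]
        field_simp
        ring

end Mesh

/-! ### The discrete Biot systems -/

namespace Mesh

variable {d : ℕ} (m : Mesh d) (κ : Permeability d) (P : Params)

/-- The blocks of the discrete Biot system. -/
def blockData : BlockData m.FreeFacet (m.FreeVertex × Fin d) m.Element m.FreeFacet where
  Abb := m.Abb P
  Abl := m.Abl P
  All := m.All P
  Dbb := m.Dbb P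
  Bb := m.Bb
  Bl := m.Bl
  Mp := m.Mp
  Bw := m.Bw
  Mw := m.Mw κ P
  alpha := P.alpha
  M := P.M
  tau := P.tau
  zeta := P.zeta d

lemma fullSystem_eq :
    m.fullSystem κ P = (m.blockData κ P).system (m.blockData κ P).Au := rfl

/-- Squaring `hNorm` recovers the quadratic form only for semidefinite matrices, hence the
semidefiniteness of all four blocks. -/
lemma weightedNorm_eq :
    m.weightedNorm κ P = hNorm ((m.blockData κ P).normWith (m.blockData κ P).Au) := by
  funext x
  obtain ⟨u, p, w, rfl⟩ := BlockData.exists_eq_elim x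
  rw [hNorm, BlockData.norm_form, BlockData.Hw_form]
  have e : (m.blockData κ P).alpha ^ 2 / (m.blockData κ P).zeta ^ 2 + 1 / (m.blockData κ P).M =
      (P.cp d)⁻¹ := (inv_inv _).symm
  rw [e]
  simp only [weightedNorm, Sum.elim_inl, Sum.elim_inr]
  rw [hNorm_sq (Au_posSemidef P), hNorm_sq Mp_posSemidef, hNorm_sq (Mw_posSemidef κ P),
    hNorm_sq Mp_posSemidef.inv, ← add_assoc]
  rfl

variable {m κ P}

instance : Nonempty m.FreeFacet := by
  obtain ⟨F, hF, hc, hn, -⟩ := m.traction_nonempty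
  exact ⟨⟨F, hF, hc, hn⟩⟩

lemma FullWellPosed.admissible (hd : d ≠ 0) {ς γ : ℝ} (hγ : 0 < γ)
    (h : m.FullWellPosed κ P ς γ) : (m.blockData κ P).Admissible where
  alpha_pos := P.alpha_pos
  M_pos := P.M_pos
  tau_pos := P.tau_pos
  zeta_pos := P.zeta_pos hd
  gap_psd := gap_posSemidef P
  Mw_psd := Mw_posSemidef κ P
  div_bound := div_bound hd P
  posDef := by
    refine posDef_of_form ?_ fun x hx => ?_
    · have hM := isSymm_of_posSemidef (Mp_posSemidef (m := m))
      have hMi := isSymm_of_posSemidef (Mp_posSemidef (m := m)).inv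
      refine IsSymm.fromBlocks (isSymm_of_posSemidef (Au_posSemidef P)) (by simp)
        (IsSymm.fromBlocks (hM.smul _) (by simp) (IsSymm.add
          ((isSymm_of_posSemidef (Mw_posSemidef κ P)).smul _) (IsSymm.smul ?_ _)))
      rw [IsSymm, transpose_mul, transpose_mul, transpose_transpose, Matrix.mul_assoc]
      exact congrArg (fun X => m.Bwᵀ * (X * m.Bw)) hMi
    · have h0 := ne_zero_of_infSupTest hγ h.2 hx
      rw [weightedNorm_eq] at h0
      exact Real.sqrt_pos.1 (lt_of_le_of_ne (hNorm_nonneg x) h0.symm)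

lemma FullWellPosed.elimContinuous (hd : d ≠ 0) {ς γ : ℝ} (hγ : 0 < γ)
    (h : m.FullWellPosed κ P ς γ) : m.ElimContinuous κ P ς := by
  refine (h.admissible hd hγ).elim_continuous ?_
  rw [← weightedNorm_eq]
  exact h.1

lemma FullWellPosed.elimInfSup (hd : d ≠ 0) {ς γ γt : ℝ} (hγ : 0 < γ)
    (h : m.FullWellPosed κ P ς γ) (hγt : 0 < γt) (hD : m.DiagInfSup κ P γt) :
    m.ElimInfSup κ P (γt / 16) :=
  (h.admissible hd hγ).elim_infSup hγt hD

/-! ### Stability of the Stokes pair -/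

variable (m) in
/-- The squared norm of the strain of a displacement. -/
def strainEnergy (u : m.DispIdx → ℝ) : ℝ :=
  ∑ T : m.Element, ∫ x in T.carrier, strainSq (m.disp u T) x

lemma strainEnergy_smul (c : ℝ) (u : m.DispIdx → ℝ) :
    m.strainEnergy (c • u) = c ^ 2 * m.strainEnergy u := by
  have h : ∀ T x, strainSq (m.disp (c • u) T) x = c ^ 2 * strainSq (m.disp u T) x :=
      fun T x => by
    have hs : ∀ v : m.DispIdx → ℝ, ∀ i j, strain (m.disp v T) x i j =
        ∑ k, v k * strain (m.dispBasis k T) x i j := fun v i j =>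
      strain_sum (fun k => contDiff_dispBasis k T) v x i j
    simp only [strainSq, hs, Pi.smul_apply, smul_eq_mul, mul_assoc, ← Finset.mul_sum, mul_pow]
  simp only [strainEnergy, h, integral_const_mul, Finset.mul_sum]

variable (κ) in
/-- If the Biot systems are uniformly well-posed, then the displacement and pressure spaces satisfy
the inf-sup condition of the Stokes problem. -/
lemma exists_stokes_stability (hd : d ≠ 0) {ς γ : ℝ} (hγ : 0 < γ)
    (h : ∀ P, m.FullWellPosed κ P ς γ) (q : m.Element → ℝ) :
    ∃ u, γ / 4 * (m.Mp.mulVec q ⬝ᵥ q) ≤ -(q ⬝ᵥ m.Bdisp.mulVec u) ∧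
      m.strainEnergy u ≤ m.Mp.mulVec q ⬝ᵥ q := by
  by_cases hq : q = 0
  · subst hq
    refine ⟨0, by simp, ?_⟩
    simpa using (strainEnergy_smul (m := m) 0 0).le
  -- Serves only to make `M_p` and `M_w` definite; `M_w` depends on the parameters through `μ_f`
  -- alone, which is `1` here and below.
  let P₀ : Params := ⟨0, 1 / 2, 1, 1, 1, 1, le_rfl, by norm_num, one_pos, one_pos, one_pos, one_pos⟩
  have h₀ := (h P₀).admissible hd hγ
  have hMp : m.Mp.PosDef := h₀.Mp_posDef
  have hMw : (m.Mw κ P₀).PosDef := by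
    refine posDef_of_form (isSymm_of_posSemidef (Mw_posSemidef κ P₀)) fun w hw => ?_
    refine lt_of_le_of_ne (form_nonneg (Mw_posSemidef κ P₀) w) fun h0 => ?_
    have h1 := form_pos h₀.Hw_posDef hw
    rw [BlockData.Hw_form] at h1
    have h2 : (m.blockData κ P₀).Bw.mulVec w = 0 := Bw_mulVec_eq_zero h0.symm
    have h3 : (m.blockData κ P₀).Mw.mulVec w ⬝ᵥ w = 0 := h0.symm
    rw [h2, h3] at h1
    simp at h1
  obtain ⟨C, hC, hle⟩ := exists_form_le hMw m.Aw
  have hAw : ∀ w, m.Mp⁻¹.mulVec (m.Bw.mulVec w) ⬝ᵥ m.Bw.mulVec w ≤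
      C * ((m.Mw κ P₀).mulVec w ⬝ᵥ w) := fun w => by
    refine (le_of_eq ?_).trans (hle w)
    simp only [Aw, ← mulVec_mulVec, mulVec_transpose, ← dotProduct_mulVec]
  -- `M = 8/γ` bounds the pressure mass term, and `τ = (γ/8)²/C` the flux term, each by `γ/8` times
  -- the norms. `C` depends on the partition and the tensor, but enters only through `τ`, which is
  -- free.
  let P : Params := ⟨0, 1 / 2, 1, 8 / γ, 1, (γ / 8) ^ 2 / C, le_rfl, by norm_num, one_pos,
    by positivity, one_pos, by positivity⟩
  have hP := h P
  have hadm := hP.admissible hd hγ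
  set S := m.blockData κ P with hS
  have hdpos : (1 : ℝ) ≤ d := by exact_mod_cast Nat.one_le_iff_ne_zero.2 hd
  have hζ : P.zeta d ^ 2 = 1 / d := by
    rw [P.zeta_sq hd]
    simp only [P]
    ring
  have hweight : 1 ≤ S.alpha ^ 2 / S.zeta ^ 2 + 1 / S.M := by
    have e1 : S.zeta ^ 2 = 1 / d := hζ
    have e2 : S.alpha = 1 := rfl
    have := hadm.M_pos
    rw [e1, e2]
    have e3 : (1 : ℝ) ^ 2 / (1 / (d : ℝ)) = d := by simp
    rw [e3]
    have : 0 < 1 / S.M := by positivity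
    linarith
  set s := S.alpha ^ 2 / S.zeta ^ 2 + 1 / S.M
  obtain ⟨y, hy⟩ : ∃ y : m.FullIdx → ℝ,
      y = Sum.elim (0 : m.DispIdx → ℝ) (Sum.elim q (0 : m.FreeFacet → ℝ)) := ⟨_, rfl⟩
  have hy0 : y ≠ 0 := by
    rintro rfl
    exact hq (funext fun T => (congr_fun hy (Sum.inr (Sum.inl T))).symm)
  -- A pure pressure test isolates the mass balance row. Of `γ/2`, the two terms above use up `γ/8`
  -- each, leaving `γ/4`.
  obtain ⟨x, hx0, hx⟩ := exists_of_le_infSupTest hP.2 (half_lt_self hγ) hy0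
  rw [weightedNorm_eq, ← hS] at hx
  have hNx := hNorm_pos hadm.posDef hx0
  have hNy := hNorm_pos hadm.posDef hy0
  rw [lt_div_iff₀ (mul_pos hNx hNy)] at hx
  have hNxsq := hNorm_sq hadm.posDef.posSemidef x
  have hNysq := hNorm_sq hadm.posDef.posSemidef y
  set X := hNorm (S.normWith S.Au) x
  set Y := hNorm (S.normWith S.Au) y
  obtain ⟨u, p, w, rfl⟩ := BlockData.exists_eq_elim x
  subst hy
  rw [fullSystem_eq, ← hS, BlockData.system_form] at hx
  rw [BlockData.norm_form] at hNxsq hNysq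
  rw [BlockData.Hw_form] at hNxsq
  simp only [mulVec_zero, dotProduct_zero, zero_add, add_zero, mul_zero, zero_sub] at hx hNysq
  have hqpos := form_pos hMp hq
  set Q := hNorm m.Mp q with hQ
  have hQsq : Q ^ 2 = m.Mp.mulVec q ⬝ᵥ q := hNorm_sq hMp.posSemidef q
  have hQpos : 0 < Q := hNorm_pos hMp hq
  have hYQ : Q ≤ Y := by
    refine le_of_sq_le_sq ?_ hNy.le
    have : S.Mp.mulVec q ⬝ᵥ q = Q ^ 2 := hQsq.symm
    rw [hNysq, this]
    nlinarith [sq_nonneg Q]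
  have hAu : 0 ≤ S.Au.mulVec u ⬝ᵥ u := form_nonneg (Au_posSemidef P) u
  have hpp : 0 ≤ S.Mp.mulVec p ⬝ᵥ p := form_nonneg hMp.posSemidef p
  have hww : 0 ≤ S.Mw.mulVec w ⬝ᵥ w := form_nonneg (Mw_posSemidef κ P) w
  have hbw : 0 ≤ S.Mp⁻¹.mulVec (S.Bw.mulVec w) ⬝ᵥ S.Bw.mulVec w :=
    form_nonneg hMp.inv.posSemidef _
  have hcp := hadm.cp_pos
  have htau := hadm.tau_pos
  have t1 := mul_nonneg htau.le hww
  have t2 : 0 ≤ S.tau ^ 2 * S.cp *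
      (S.Mp⁻¹.mulVec (S.Bw.mulVec w) ⬝ᵥ S.Bw.mulVec w) := by positivity
  have t3 : S.Mp.mulVec p ⬝ᵥ p ≤ s * (S.Mp.mulVec p ⬝ᵥ p) := by nlinarith
  have hpX : S.Mp.mulVec p ⬝ᵥ q ≤ X * Q := by
    refine (le_abs_self _).trans ((abs_form_le hMp.posSemidef p q).trans ?_)
    refine mul_le_mul_of_nonneg_right ?_ hQpos.le
    refine le_of_sq_le_sq ?_ hNx.le
    rw [hNorm_sq hMp.posSemidef, hNxsq]
    have : m.Mp.mulVec p ⬝ᵥ p = S.Mp.mulVec p ⬝ᵥ p := rfl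
    linarith
  have hwX : |S.tau * (q ⬝ᵥ S.Bw.mulVec w)| ≤ γ / 8 * (X * Q) := by
    refine abs_le_of_sq_le_sq ?_ (by positivity)
    have e : q ⬝ᵥ S.Bw.mulVec w = m.Mp.mulVec (m.Mp⁻¹.mulVec (m.Bw.mulVec w)) ⬝ᵥ q := by
      rw [mulVec_mulVec, mul_nonsing_inv _ ((isUnit_iff_isUnit_det _).1 hMp.isUnit),
        one_mulVec, dotProduct_comm]
      rfl
    have e1 := form_sq_le hMp.posSemidef (m.Mp⁻¹.mulVec (m.Bw.mulVec w)) q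
    rw [← e, ← hQsq] at e1
    have e2 : m.Mp.mulVec (m.Mp⁻¹.mulVec (m.Bw.mulVec w)) ⬝ᵥ m.Mp⁻¹.mulVec (m.Bw.mulVec w) =
        m.Mp⁻¹.mulVec (m.Bw.mulVec w) ⬝ᵥ m.Bw.mulVec w := by
      rw [mulVec_mulVec, mul_nonsing_inv _ ((isUnit_iff_isUnit_det _).1 hMp.isUnit),
        one_mulVec, dotProduct_comm]
    rw [e2] at e1
    have e3 : m.Mp⁻¹.mulVec (m.Bw.mulVec w) ⬝ᵥ m.Bw.mulVec w ≤ C * (S.Mw.mulVec w ⬝ᵥ w) := hAw w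
    have e4 : S.tau * C = (γ / 8) ^ 2 := div_mul_cancel₀ _ hC.ne'
    have e5 : S.tau * (S.Mw.mulVec w ⬝ᵥ w) ≤ X ^ 2 := by
      rw [hNxsq]
      linarith
    calc (S.tau * (q ⬝ᵥ S.Bw.mulVec w)) ^ 2 = S.tau ^ 2 * (q ⬝ᵥ S.Bw.mulVec w) ^ 2 := by ring
      _ ≤ S.tau ^ 2 * (C * (S.Mw.mulVec w ⬝ᵥ w) * Q ^ 2) := by
        gcongr
        exact e1.trans (mul_le_mul_of_nonneg_right e3 (sq_nonneg Q))
      _ = (S.tau * C) * (S.tau * (S.Mw.mulVec w ⬝ᵥ w)) * Q ^ 2 := by ring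
      _ ≤ (S.tau * C) * X ^ 2 * Q ^ 2 := by gcongr
      _ = (γ / 8 * (X * Q)) ^ 2 := by
        rw [e4]
        ring
  have hM : 1 / S.M = γ / 8 := one_div_div _ _
  have hal : S.alpha = 1 := rfl
  rw [hM, hal] at hx
  have hkey : γ / 4 * (X * Q) < -(q ⬝ᵥ S.B.mulVec u) := by
    have a1 : γ / 2 * (X * Q) ≤ γ / 2 * (X * Y) := by gcongr
    have a2 : γ / 8 * (S.Mp.mulVec p ⬝ᵥ q) ≤ γ / 8 * (X * Q) := by gcongr
    have a3 := neg_abs_le (S.tau * (q ⬝ᵥ S.Bw.mulVec w))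
    linarith
  have hEn : S.Au.mulVec u ⬝ᵥ u = m.strainEnergy u := by
    have : S.Au.mulVec u ⬝ᵥ u = m.elasticity P (m.disp u) (m.disp u) := Au_form P u u
    rw [this, elasticity_eq, strainEnergy]
    refine Finset.sum_congr rfl fun T _ => integral_congr_ae (ae_of_all _ fun x => ?_)
    simp [density_self, P]
  -- A field without strain has zero pairing by the divergence bound, against the strict inequality
  -- `hkey`; the normalisation by `ε` is therefore legitimate.
  have hpos : 0 < m.strainEnergy u := by
    rw [← hEn]
    refine lt_of_le_of_ne hAu fun h0 => ?_
    have hb := hadm.div_bound q u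
    rw [← h0, mul_zero] at hb
    have hz : (q ⬝ᵥ S.B.mulVec u) ^ 2 = 0 := by
      have := hadm.zeta_pos
      by_contra hne
      have : 0 < (q ⬝ᵥ S.B.mulVec u) ^ 2 := lt_of_le_of_ne (sq_nonneg _) (Ne.symm hne)
      have : 0 < (q ⬝ᵥ S.B.mulVec u) ^ 2 * S.zeta ^ 2 := by positivity
      linarith
    have hz' := pow_eq_zero_iff (two_ne_zero) |>.1 hz
    rw [hz', neg_zero] at hkey
    have : 0 < γ / 4 * (X * Q) := by positivity
    linarith
  set ε := √(m.strainEnergy u) with hε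
  have hεpos : 0 < ε := Real.sqrt_pos.2 hpos
  have hεsq : ε ^ 2 = m.strainEnergy u := Real.sq_sqrt hpos.le
  have hεX : ε ≤ X := by
    refine le_of_sq_le_sq ?_ hNx.le
    rw [hεsq, hNxsq, hEn]
    linarith
  refine ⟨(Q / ε) • u, ?_, ?_⟩
  · rw [mulVec_smul, dotProduct_smul, smul_eq_mul, ← hQsq]
    have hB : q ⬝ᵥ m.Bdisp.mulVec u = q ⬝ᵥ S.B.mulVec u := rfl
    rw [hB]
    calc γ / 4 * Q ^ 2 = Q / ε * (γ / 4 * (ε * Q)) := by field_simp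
      _ ≤ Q / ε * (γ / 4 * (X * Q)) := by gcongr
      _ ≤ Q / ε * (-(q ⬝ᵥ S.B.mulVec u)) := by gcongr
      _ = _ := by ring
  · rw [strainEnergy_smul, ← hεsq, ← hQsq, ← mul_pow, div_mul_cancel₀ _ hεpos.ne']

/-! ### Uniform bound for the lumped form and the uniform inf-sup constant -/

/-- On shape-regular partitions, the displacement form with lumped bubble block is bounded by the
strain, uniformly in the partition. -/
lemma exists_AuD_le (hd : 2 ≤ d) {σ : ℝ} (hσ : 0 < σ) :
    ∃ K : ℝ, 0 < K ∧ ∀ (m : Mesh d) (P : Params), m.ShapeRegular σ →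
      ∀ u : m.DispIdx → ℝ,
        (m.AuD P).mulVec u ⬝ᵥ u ≤ K * P.zeta d ^ 2 * m.strainEnergy u := by
  obtain ⟨C, hC, hbub⟩ := exists_bubble_stability hd hσ
  have hd0 : d ≠ 0 := by omega
  have hdpos : (0 : ℝ) < d := by positivity
  -- The first `d` bounds `A_u`. In the second summand one `d + 1` comes from `D_bb`, the other
  -- counts the bubbles of an element, and `d` is from `density_le`.
  refine ⟨d + d * (d + 1) ^ 2 * C, by positivity, fun m P hm u => ?_⟩
  have hEl : ∀ v : m.VField, (∀ T, ContDiff ℝ 1 (v T)) → ∀ T : m.Element,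
      ∫ x in T.carrier, density P (v T) (v T) x ≤
        d * P.zeta d ^ 2 * ∫ x in T.carrier, strainSq (v T) x := fun v hv T => by
    rw [← integral_const_mul]
    exact setIntegral_mono (T.integrableOn (continuous_density P (hv T) (hv T)))
      ((T.integrableOn (continuous_strainSq (hv T))).const_mul _)
      fun x => density_le hd0 P (v T) x
  have h1 : (m.Au P).mulVec u ⬝ᵥ u ≤ d * P.zeta d ^ 2 * m.strainEnergy u := by
    rw [Au_form, elasticity_eq, strainEnergy, Finset.mul_sum]
    exact Finset.sum_le_sum fun T _ => hEl (m.disp u) (contDiff_disp u) T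
  have h2 : (m.Dbb P).mulVec (u ∘ Sum.inl) ⬝ᵥ (u ∘ Sum.inl) ≤
      (d + 1) * (d * P.zeta d ^ 2 * ((d + 1) * C * m.strainEnergy u)) := by
    rw [Dbb_form]
    refine mul_le_mul_of_nonneg_left ?_ (by positivity)
    simp only [elasticity_eq, strainEnergy, Finset.mul_sum, Function.comp_apply]
    rw [Finset.sum_comm]
    refine Finset.sum_le_sum fun T _ => ?_
    have hI : 0 ≤ ∫ x in T.carrier, strainSq (m.disp u T) x :=
      integral_nonneg fun x => strainSq_nonneg _ x
    set I := ∫ x in T.carrier, strainSq (m.disp u T) x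
    have hz : ∀ F, F ∉ T.freeFacets →
        u (Sum.inl F) ^ 2 * ∫ x in T.carrier, density P (m.bubble F T) (m.bubble F T) x = 0 := by
      intro F hF
      rw [Element.mem_freeFacets] at hF
      rw [bubble_eq_zero hF]
      have : ∀ x : E d, density P 0 0 x = 0 := fun x => by simp [density, strain, divergence]
      simp [this]
    calc _ = ∑ F ∈ T.freeFacets, u (Sum.inl F) ^ 2 *
          ∫ x in T.carrier, density P (m.bubble F T) (m.bubble F T) x :=
          (Finset.sum_subset (Finset.subset_univ _) fun F _ hF => hz F hF).symm
      _ ≤ ∑ F ∈ T.freeFacets, d * P.zeta d ^ 2 * (C * I) := by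
        refine Finset.sum_le_sum fun F _ => ?_
        calc _ ≤ u (Sum.inl F) ^ 2 *
              (d * P.zeta d ^ 2 * ∫ x in T.carrier, strainSq (m.bubble F T) x) :=
              mul_le_mul_of_nonneg_left (hEl (m.bubble F) (contDiff_bubble F) T) (sq_nonneg _)
          _ = d * P.zeta d ^ 2 *
              (u (Sum.inl F) ^ 2 * ∫ x in T.carrier, strainSq (m.bubble F T) x) := by ring
          _ ≤ _ := mul_le_mul_of_nonneg_left (hbub m hm T u F) (by positivity)
      _ = T.freeFacets.card * (d * P.zeta d ^ 2 * (C * I)) := by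
        rw [Finset.sum_const, nsmul_eq_mul]
      _ ≤ (d + 1) * (d * P.zeta d ^ 2 * (C * I)) := by
        refine mul_le_mul_of_nonneg_right ?_ (by positivity)
        exact_mod_cast T.card_freeFacets_le
      _ = _ := by ring
  have h3 : 0 ≤ (m.Abb P).mulVec (u ∘ Sum.inl) ⬝ᵥ (u ∘ Sum.inl) := by
    rw [Abb_form]
    exact elasticity_nonneg P _
  have h4 : (m.AuD P).mulVec u ⬝ᵥ u = (m.Au P).mulVec u ⬝ᵥ u +
      (m.Dbb P - m.Abb P).mulVec (u ∘ Sum.inl) ⬝ᵥ (u ∘ Sum.inl) := by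
    obtain ⟨ub, ul, rfl⟩ : ∃ ub ul, u = Sum.elim ub ul := ⟨u ∘ Sum.inl, u ∘ Sum.inr, by simp⟩
    simp only [AuD, Au, fromBlocks_mulVec, Sum.elim_comp_inl, Sum.elim_comp_inr,
      sumElim_dotProduct_sumElim, add_dotProduct, sub_mulVec, sub_dotProduct]
    ring
  rw [h4, sub_mulVec, sub_dotProduct]
  calc _ ≤ d * P.zeta d ^ 2 * m.strainEnergy u +
        (d + 1) * (d * P.zeta d ^ 2 * ((d + 1) * C * m.strainEnergy u)) := by linarith
    _ = _ := by ring

/-- Uniform well-posedness of the full systems on shape-regular partitions is inherited by the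
systems with lumped bubble block. -/
lemma exists_diagInfSup (hd : 2 ≤ d) {γ σ : ℝ} (hγ : 0 < γ) (hσ : 0 < σ) :
    ∃ γt : ℝ, 0 < γt ∧ ∀ (m : Mesh d) (κ : Permeability d) (ς : ℝ), m.ShapeRegular σ →
      (∀ P, m.FullWellPosed κ P ς γ) → ∀ P, m.DiagInfSup κ P γt := by
  obtain ⟨K, hK, hle⟩ := exists_AuD_le (d := d) hd hσ
  have hs : 0 < √K := Real.sqrt_pos.2 hK
  have hsq : √K ^ 2 = K := Real.sq_sqrt hK.le
  have hβ : 0 < min 1 (γ / 4 / √K) := lt_min one_pos (by positivity)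
  refine ⟨min 1 (γ / 4 / √K) ^ 2 / 8, by positivity, fun m κ ς hm h P => ?_⟩
  have hd0 : d ≠ 0 := by omega
  refine ((h P).admissible hd0 hγ).diag_infSup hβ (min_le_left _ _) fun q => ?_
  obtain ⟨u, hu1, hu2⟩ := exists_stokes_stability κ hd0 hγ h q
  have hq := form_nonneg (Mp_posSemidef (m := m)) q
  -- Dividing by `√K` brings the lumped energy down to `ζ² (M_p q, q)`, at the price of the same
  -- factor in the divergence constant.
  refine ⟨(√K)⁻¹ • u, ?_, ?_⟩
  · rw [mulVec_smul, dotProduct_smul, smul_eq_mul]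
    calc _ ≤ γ / 4 / √K * (m.Mp.mulVec q ⬝ᵥ q) :=
          mul_le_mul_of_nonneg_right (min_le_right _ _) hq
      _ = (√K)⁻¹ * (γ / 4 * (m.Mp.mulVec q ⬝ᵥ q)) := by ring
      _ ≤ (√K)⁻¹ * -(q ⬝ᵥ m.Bdisp.mulVec u) := by gcongr
      _ = -((√K)⁻¹ * (q ⬝ᵥ m.Bdisp.mulVec u)) := by ring
  · rw [mulVec_smul, smul_dotProduct, dotProduct_smul, smul_eq_mul, smul_eq_mul, ← mul_assoc,
      ← mul_inv, ← sq, hsq, inv_mul_le_iff₀ hK]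
    calc _ ≤ K * P.zeta d ^ 2 * m.strainEnergy u := hle m P hm u
      _ ≤ K * P.zeta d ^ 2 * (m.Mp.mulVec q ⬝ᵥ q) := by gcongr
      _ = _ := by
        rw [mul_assoc]
        rfl

end Mesh

end BiotFE

end

theorem theorem3p2 (d : ℕ) (hd : d = 2 ∨ d = 3) (γ : ℝ) (hγ : 0 < γ) :
    -- robust well-posedness: the constants do not depend on the mesh size and the parameters
    (∀ σ : ℝ, 0 < σ → ∃ γt : ℝ, 0 < γt ∧
      ∀ (m : BiotFE.Mesh d) (κ : BiotFE.Permeability d) (ς : ℝ), 0 < ς → m.ShapeRegular σ →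
        (∀ P : BiotFE.Params, m.FullWellPosed κ P ς γ) →
        ∀ P : BiotFE.Params, m.DiagInfSup κ P γt ∧
          m.ElimInfSup κ P (γt / 16) ∧ m.ElimContinuous κ P ς) ∧
    -- one given mesh and one given set of parameters
    (∀ (m : BiotFE.Mesh d) (κ : BiotFE.Permeability d) (P : BiotFE.Params) (ς : ℝ), 0 < ς →
      m.FullWellPosed κ P ς γ →
        (∃ γt : ℝ, 0 < γt ∧ m.DiagInfSup κ P γt) ∧
        (∀ γt : ℝ, 0 < γt → m.DiagInfSup κ P γt → m.ElimInfSup κ P (γt / 16)) ∧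
        m.ElimContinuous κ P ς) := by
  have hd2 : 2 ≤ d := by omega
  have hd0 : d ≠ 0 := by omega
  refine ⟨fun σ hσ => ?_, fun m κ P ς _ h => ?_⟩
  · obtain ⟨γt, hγt, H⟩ := BiotFE.Mesh.exists_diagInfSup hd2 hγ hσ
    refine ⟨γt, hγt, fun m κ ς _ hm h P => ?_⟩
    have hD := H m κ ς hm h P
    exact ⟨hD, (h P).elimInfSup hd0 hγ hγt hD, (h P).elimContinuous hd0 hγ⟩
  · exact ⟨(h.admissible hd0 hγ).exists_diag_infSup,
      fun γt hγt hD => h.elimInfSup hd0 hγ hγt hD, h.elimContinuous hd0 hγ⟩
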